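/- Let $M$ be a closed (compact, without boundary) connected smooth $3$-manifold with a contact structure $\xi=\ker\alpha$, where $\alpha$ is a global smooth $1$-form with $\alpha\wedge d\alpha\neq 0$ everywhere. The Reeb vector field $R_\alpha$ is given by $\alpha(R_\alpha)=1$, $d\alpha(R_\alpha,\cdot)=0$, and Reeb orbits are the closed orbits (with arbitrary, not necessarily minimal, period $T>0$) of its flow. Suppose that $c_1(\xi)\in H^2(M;\mathbb Z)$ is torsion and $H^1(M;\mathbb Q)=0$. Let $J$ be a complex structure on $\xi$ with $d\alpha(v,Jv)>0$ for $v\ne 0$, and let $F$ be a trivialization of the complex line bundle $(\xi^*)^{\otimes N}$ for some $N\ge 1$. For a Reeb orbit $\gamma$ choose a symplectic frame $(e,Je)$ of $\gamma^*\xi$; let $\Psi$ be the path in $\mathrm{Sp}(2)$ which represents the linearized Reeb flow on $\xi$ in this frame, and let $w$ be the winding number of $F(e^{\otimes N})\colon\gamma\to\mathbb C^*$. The rational lower Conley–Zehnder index of $\gamma$ is $$\mu^{\mathbb Q}_{LCZ}(\gamma)=\mu_{LCZ}(\Psi)+\frac{2w}{N},$$ where $\mu_{LCZ}$ is the lower semicontinuous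 extension to all paths in $\mathrm{Sp}(2)$ starting at the identity of the Conley–Zehnder index of nondegenerate paths; it does not depend on the choices. The contact manifold $(M,\xi)$ is called strongly dynamically convex if $c_1(\xi)$ is torsion, $H^1(M;\mathbb Q)=0$, and there is a contact form $\alpha$ with $\ker\alpha=\xi$ such that $\mu^{\mathbb Q}_{LCZ}(\gamma)\ge 3$ for all Reeb orbits $\gamma$ of $\alpha$. **Corollary.** If $(M,\xi)$ is strongly dynamically convex, then $M$ is a rational homology sphere: $H_k(M;\mathbb Q)\cong\mathbb Q$ for $k\in\{0,3\}$, and $H_k(M;\mathbb Q)=0$ for all other $k$. -/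

import Mathlib

open CategoryTheory Manifold ContDiff Set

noncomputable section

universe u

/-! ### Singular homology and cohomology -/

section Singular

/-- The singular chain complex of `X` with coefficients in `R`. -/
def singularChains (R : Type) [CommRing R] (X : Type u) [TopologicalSpace X] :
    ChainComplex (ModuleCat.{u} R) ℕ :=
  ((AlgebraicTopology.singularChainComplexFunctor (ModuleCat.{u} R)).obj
    (ModuleCat.of R (ULift.{u} R))).obj (TopCat.of X)

/-- Singular homology `H_n(X; R)`. -/
def singularHomology (R : Type) [CommRing R] (X : Type u) [TopologicalSpace X] (n : ℕ) :
    ModuleCat.{u} R :=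
  (singularChains R X).homology n

/-- The singular `n`-chain consisting of one singular simplex with coefficient `1`. -/
def simplexChain (R : Type) [CommRing R] {X : Type u} [TopologicalSpace X] {n : ℕ}
    (s : C(stdSimplex ℝ (Fin (n + 1)), X)) : (singularChains R X).X n :=
  ((TopCat.toSSet.obj (TopCat.of X)).ιChainComplex (R := ModuleCat.of R (ULift.{u} R)) (n := n)
    (((TopCat.of X).toSSetObjEquiv (Opposite.op (SimplexCategory.mk n))).symm s)).hom (ULift.up 1)

/-- Singular `n`-cochains `C^n(X; R) = Hom(C_n(X; R), R)`. -/
def singularCochains (R : Type) [CommRing R] (X : Type u) [TopologicalSpace X] (n : ℕ) : Type u :=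
  (singularChains R X).X n →ₗ[R] R

instance (R : Type) [CommRing R] (X : Type u) [TopologicalSpace X] (n : ℕ) :
    AddCommGroup (singularCochains R X n) :=
  inferInstanceAs (AddCommGroup ((singularChains R X).X n →ₗ[R] R))

instance (R : Type) [CommRing R] (X : Type u) [TopologicalSpace X] (n : ℕ) :
    Module R (singularCochains R X n) :=
  inferInstanceAs (Module R ((singularChains R X).X n →ₗ[R] R))

/-- The value of a singular cochain on a singular simplex. -/
def singularCochains.eval {R : Type} [CommRing R] {X : Type u} [TopologicalSpace X] {n : ℕ}
    (c : singularCochains R X n) (s : C(stdSimplex ℝ (Fin (n + 1)), X)) : R :=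
  (show (singularChains R X).X n →ₗ[R] R from c) (simplexChain R s)

/-- The dual `C^n(X; R) → C^m(X; R)` of the boundary map `C_m → C_n` (which is zero unless
`n + 1 = m`). -/
def coboundary (R : Type) [CommRing R] (X : Type u) [TopologicalSpace X] (n m : ℕ) :
    singularCochains R X n →ₗ[R] singularCochains R X m :=
  LinearMap.lcomp R R ((singularChains R X).d m n).hom

/-- Singular `n`-cocycles. -/
abbrev singularCocycles (R : Type) [CommRing R] (X : Type u) [TopologicalSpace X] (n : ℕ) :
    Submodule R (singularCochains R X n) :=
  LinearMap.ker (coboundary R X n (n + 1))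

/-- Singular cohomology `H^n(X; R)`, cocycles modulo coboundaries. (For `n = 0` the map
`coboundary R X (0 - 1) 0` is zero.) -/
abbrev singularCohomology (R : Type) [CommRing R] (X : Type u) [TopologicalSpace X] (n : ℕ) :
    Type u :=
  singularCocycles R X n ⧸
    (LinearMap.range (coboundary R X (n - 1) n)).submoduleOf (singularCocycles R X n)

/-- For `n ≥ 1`: the space `X` has the rational homology of the `n`-sphere. A closed
`n`-manifold with this property is called a rational homology sphere. -/
def HasRationalHomologyOfSphere (n : ℕ) (X : Type u) [TopologicalSpace X] : Prop :=
  ∀ k : ℕ, ((k = 0 ∨ k = n) → Nonempty (singularHomology ℚ X k ≃ₗ[ℚ] ℚ)) ∧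
    (¬ (k = 0 ∨ k = n) → Subsingleton (singularHomology ℚ X k))

end Singular

/-! ### The Conley–Zehnder index of paths in `Sp(2) = SL(2, ℝ)` -/

section ConleyZehnder

/-- A continuous path `[0, T] → Sp(2) = SL(2, ℝ)` which starts at the identity. -/
def IsSymplecticPath (T : ℝ) (Ψ : ℝ → Matrix (Fin 2) (Fin 2) ℝ) : Prop :=
  ContinuousOn Ψ (Icc 0 T) ∧ Ψ 0 = 1 ∧ ∀ t ∈ Icc 0 T, (Ψ t).det = 1

/-- The numbers of (counterclockwise) turns made by the nonzero vectors `v` along the path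
`t ↦ Ψ t v`, `0 ≤ t ≤ T`; for a path in `Sp(2)` starting at the identity this is a compact interval
of length less than `1 / 2`. -/
def rotationSet (T : ℝ) (Ψ : ℝ → Matrix (Fin 2) (Fin 2) ℝ) : Set ℝ :=
  {ρ | ∃ v : Fin 2 → ℝ, v ≠ 0 ∧ ∃ r θ : ℝ → ℝ, ContinuousOn θ (Icc 0 T) ∧
    (∀ t ∈ Icc 0 T, 0 < r t ∧
      (Ψ t).mulVec v = r t • ![Real.cos (θ t), Real.sin (θ t)]) ∧
    ρ = (θ T - θ 0) / (2 * Real.pi)}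

/-- The Conley–Zehnder index of a path with `det (Ψ T - 1) ≠ 0`: it is `2 k` if the rotation
interval contains the integer `k` (in which case `k` is an interior point), and `2 k + 1` if the
rotation interval is contained in the open interval `(k, k + 1)`. -/
def conleyZehnder (T : ℝ) (Ψ : ℝ → Matrix (Fin 2) (Fin 2) ℝ) : ℤ :=
  ⌊sInf (rotationSet T Ψ)⌋ + ⌈sSup (rotationSet T Ψ)⌉

/-- The lower semicontinuous extension of the Conley–Zehnder index to all paths: the limit
inferior of `conleyZehnder T Φ` over the nondegenerate paths `Φ` converging uniformly to `Ψ`. -/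
def lowerConleyZehnder (T : ℝ) (Ψ : ℝ → Matrix (Fin 2) (Fin 2) ℝ) : ℤ :=
  sSup {m : ℤ | ∃ ε > 0, ∀ Φ : ℝ → Matrix (Fin 2) (Fin 2) ℝ,
    IsSymplecticPath T Φ → (Φ T - 1).det ≠ 0 →
    (∀ t ∈ Icc 0 T, ∀ i j, |Φ t i j - Ψ t i j| < ε) → m ≤ conleyZehnder T Φ}

end ConleyZehnder

/-! ### Contact forms and Reeb flows on 3-manifolds -/

section Contact

/-- The model vector space of a 3-manifold. -/
abbrev E3 : Type := EuclideanSpace ℝ (Fin 3)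

/-- A (not necessarily continuous) differential 1-form. -/
abbrev OneForm (M : Type u) [TopologicalSpace M] [ChartedSpace E3 M] : Type u :=
  (x : M) → TangentSpace (𝓡 3) x →L[ℝ] ℝ

variable {M : Type u} [TopologicalSpace M] [ChartedSpace E3 M]

/-- Smoothness of a 1-form, as a section of the cotangent bundle. -/
def OneForm.IsSmooth [IsManifold (𝓡 3) ∞ M] (α : OneForm M) : Prop :=
  ContMDiff (𝓡 3) ((𝓡 3).prod 𝓘(ℝ, E3 →L[ℝ] ℝ)) ∞
    (fun x ↦ Bundle.TotalSpace.mk' (E3 →L[ℝ] ℝ)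
      (E := fun x : M ↦ TangentSpace (𝓡 3) x →L[ℝ] Bundle.Trivial M ℝ x) x (α x))

/-- The 1-form on (an open subset of) `ℝ³` which represents `α` in the preferred chart at `x`. -/
def OneForm.inChart (α : OneForm M) (x : M) (y : E3) : E3 [⋀^Fin 1]→L[ℝ] ℝ :=
  ContinuousAlternatingMap.ofSubsingleton ℝ E3 ℝ 0
    ((α ((extChartAt (𝓡 3) x).symm y)).comp
      (mfderiv 𝓘(ℝ, E3) (𝓡 3) (extChartAt (𝓡 3) x).symm y))

/-- The exterior derivative `dα`, computed at `x` in the preferred chart at `x`. -/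
def OneForm.d (α : OneForm M) (x : M) (v w : TangentSpace (𝓡 3) x) : ℝ :=
  extDeriv (α.inChart x) (extChartAt (𝓡 3) x x)
    ![mfderiv (𝓡 3) 𝓘(ℝ, E3) (extChartAt (𝓡 3) x) x v,
      mfderiv (𝓡 3) 𝓘(ℝ, E3) (extChartAt (𝓡 3) x) x w]

/-- A contact form: a smooth 1-form such that `α ∧ dα` vanishes nowhere. -/
def OneForm.IsContact [IsManifold (𝓡 3) ∞ M] (α : OneForm M) : Prop :=
  α.IsSmooth ∧ ∀ x, ∃ u v w : TangentSpace (𝓡 3) x,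
    α x u * α.d x v w - α x v * α.d x u w + α x w * α.d x u v ≠ 0

variable [IsManifold (𝓡 3) ∞ M]

/-- `φ` is the flow of the Reeb vector field `R`, where `α R = 1` and `dα(R, ·) = 0`. -/
def OneForm.IsReebFlow (α : OneForm M) (φ : ℝ → M → M) : Prop :=
  ∃ R : (x : M) → TangentSpace (𝓡 3) x,
    (∀ x, α x (R x) = 1 ∧ ∀ w, α.d x (R x) w = 0) ∧
    ∀ x, φ 0 x = x ∧ IsMIntegralCurve (I := 𝓡 3) (fun t ↦ φ t x) R

/-- A continuous family `J` of endomorphisms whose restriction to the planes `ξ = ker α` is a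
complex structure with `dα(v, J v) > 0` for `v ≠ 0`. -/
def OneForm.IsCompatibleComplexStructure (α : OneForm M)
    (J : (x : M) → TangentSpace (𝓡 3) x →L[ℝ] TangentSpace (𝓡 3) x) : Prop :=
  Continuous (fun p : TangentBundle (𝓡 3) M ↦ (⟨p.1, J p.1 p.2⟩ : TangentBundle (𝓡 3) M)) ∧
  ∀ x v, α x v = 0 → α x (J x v) = 0 ∧ J x (J x v) = -v ∧ (v ≠ 0 → 0 < α.d x v (J x v))

/-- A nowhere vanishing section `e` of `g^* ξ`, where `ξ = ker α` and `g : A → M`. -/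
def OneForm.IsNonvanishingSection (α : OneForm M) {A : Type} [TopologicalSpace A] (g : A → M)
    (e : (a : A) → TangentSpace (𝓡 3) (g a)) : Prop :=
  Continuous (fun a ↦ (⟨g a, e a⟩ : TangentBundle (𝓡 3) M)) ∧
  ∀ a, α (g a) (e a) = 0 ∧ e a ≠ 0

/-! ### The first Chern class -/

/-- The `i`-th face of a singular 2-simplex. -/
def face (s : C(stdSimplex ℝ (Fin 3), M)) (i : Fin 3) : C(stdSimplex ℝ (Fin 2), M) :=
  ⟨fun q ↦ s (stdSimplex.map i.succAbove q), s.continuous.comp (stdSimplex.continuous_map _)⟩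

/-- `c` is the first Chern class of the complex line bundle `(ξ, J)`, `ξ = ker α`, that is, the
primary obstruction to the existence of a nowhere vanishing section (the Euler class). One chooses
nonzero vectors `u x ∈ ξ_x` at all points and extends them to nowhere vanishing sections
`sec e` along all singular 1-simplices `e`. The value of the obstruction cocycle on a singular
2-simplex `s` is then the winding number of these sections around the boundary of `s`, with respect
to the trivialization of `s^* ξ` given by any nowhere vanishing section `E`. -/
def OneForm.IsFirstChernClass (α : OneForm M) (c : singularCohomology ℤ M 2) : Prop :=
  ∃ (J : (x : M) → TangentSpace (𝓡 3) x →L[ℝ] TangentSpace (𝓡 3) x)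
    (u : (x : M) → TangentSpace (𝓡 3) x)
    (sec : (e : C(stdSimplex ℝ (Fin 2), M)) → (q : stdSimplex ℝ (Fin 2)) →
      TangentSpace (𝓡 3) (e q))
    (κ : singularCocycles ℤ M 2),
    α.IsCompatibleComplexStructure J ∧
    (∀ e : C(stdSimplex ℝ (Fin 2), M), α.IsNonvanishingSection (fun q ↦ e q) (sec e) ∧
      ∀ i : Fin 2, sec e (stdSimplex.vertex i) = u (e (stdSimplex.vertex i))) ∧
    (∀ s : C(stdSimplex ℝ (Fin 3), M),
      ∃ (E : (p : stdSimplex ℝ (Fin 3)) → TangentSpace (𝓡 3) (s p))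
        (r θ : Fin 3 → stdSimplex ℝ (Fin 2) → ℝ),
        α.IsNonvanishingSection (fun p ↦ s p) E ∧
        (∀ i, Continuous (θ i) ∧ ∀ q, 0 < r i q ∧
          sec (face s i) q = r i q •
            (Real.cos (θ i q) • E (stdSimplex.map i.succAbove q) +
              Real.sin (θ i q) • J (s (stdSimplex.map i.succAbove q)) (E (stdSimplex.map i.succAbove q)))) ∧
        2 * Real.pi * ((κ : singularCochains ℤ M 2).eval s : ℝ) =
          ∑ i : Fin 3, (-1 : ℝ) ^ (i : ℕ) *
            (θ i (stdSimplex.vertex 1) - θ i (stdSimplex.vertex 0))) ∧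
    c = Submodule.Quotient.mk κ

/-- `c_1(ξ)` is a torsion element of `H^2(M; ℤ)`. -/
def OneForm.FirstChernClassIsTorsion (α : OneForm M) : Prop :=
  ∃ c : singularCohomology ℤ M 2, α.IsFirstChernClass c ∧ IsOfFinAddOrder c

/-! ### The rational Conley–Zehnder index of Reeb orbits -/

/-- A trivialization (nowhere vanishing section) of the `N`-th tensor power of the complex dual
`ξ^*` of `(ξ, J)`, `ξ = ker α`, written as a family of functions `F x : ξ_x → ℂ` which are
homogeneous of degree `N` over `ℂ`. -/
def OneForm.IsPowerTrivialization (α : OneForm M)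
    (J : (x : M) → TangentSpace (𝓡 3) x →L[ℝ] TangentSpace (𝓡 3) x) (N : ℕ)
    (F : (x : M) → TangentSpace (𝓡 3) x → ℂ) : Prop :=
  ContinuousOn (fun p : TangentBundle (𝓡 3) M ↦ F p.1 p.2) {p | α p.1 p.2 = 0} ∧
  ∀ x v, α x v = 0 → (v ≠ 0 → F x v ≠ 0) ∧
    ∀ a b : ℝ, F x (a • v + b • J x v) = (a + b * Complex.I) ^ N * F x v

/-- `q` is the lower semicontinuous rational Conley–Zehnder index of the closed orbit
`t ↦ φ t x`, `0 ≤ t ≤ T`, of the Reeb flow `φ`. Here `Ψ` is the linearized flow on `ξ = ker α`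
in a symplectic frame `(e, J e)` along the orbit, and `w` is the winding number of `e^{⊗ N}` with
respect to a global trivialization `F` of the `N`-th tensor power of `ξ^*`; passing from `e` to
`F` changes the index by `2 w / N`. If `H^1(M; ℚ) = 0`, the value does not depend on choices. -/
def OneForm.IsRationalIndex (α : OneForm M) (φ : ℝ → M → M) (x : M) (T : ℝ) (q : ℚ) : Prop :=
  ∃ (J : (x : M) → TangentSpace (𝓡 3) x →L[ℝ] TangentSpace (𝓡 3) x)
    (N : ℕ) (F : (x : M) → TangentSpace (𝓡 3) x → ℂ)
    (e : (t : ℝ) → TangentSpace (𝓡 3) (φ t x))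
    (Ψ : ℝ → Matrix (Fin 2) (Fin 2) ℝ) (θ : ℝ → ℝ) (w : ℤ),
    α.IsCompatibleComplexStructure J ∧ 0 < N ∧ α.IsPowerTrivialization J N F ∧
    α.IsNonvanishingSection (fun t ↦ φ t x) e ∧
    (∀ t, α.d (φ t x) (e t) (J (φ t x) (e t)) = 1) ∧
    (∀ t, (⟨φ (t + T) x, e (t + T)⟩ : TangentBundle (𝓡 3) M) = ⟨φ t x, e t⟩) ∧
    (∀ t ∈ Icc 0 T,
      tangentMap (𝓡 3) (𝓡 3) (φ t) ⟨φ 0 x, e 0⟩ =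
        ⟨φ t x, Ψ t 0 0 • e t + Ψ t 1 0 • J (φ t x) (e t)⟩ ∧
      tangentMap (𝓡 3) (𝓡 3) (φ t) ⟨φ 0 x, J (φ 0 x) (e 0)⟩ =
        ⟨φ t x, Ψ t 0 1 • e t + Ψ t 1 1 • J (φ t x) (e t)⟩) ∧
    Continuous θ ∧
    (∀ t, F (φ t x) (e t) = ‖F (φ t x) (e t)‖ * Complex.exp (θ t * Complex.I)) ∧
    θ T - θ 0 = 2 * Real.pi * w ∧
    q = lowerConleyZehnder T Ψ + 2 * w / N

/-- A contact form `α` on a 3-manifold (`2 n - 1 = 3`) is strongly dynamically convex if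
`c_1(ker α)` is torsion, `H^1(M; ℚ) = 0`, and all closed Reeb orbits have rational lower
Conley–Zehnder index at least `n + 1 = 3`. -/
def OneForm.IsStronglyDynamicallyConvex (α : OneForm M) : Prop :=
  α.IsContact ∧ α.FirstChernClassIsTorsion ∧ Subsingleton (singularCohomology ℚ M 1) ∧
  ∀ φ : ℝ → M → M, α.IsReebFlow φ → ∀ (x : M) (T : ℝ), 0 < T → φ T x = x →
    ∀ q : ℚ, α.IsRationalIndex φ x T q → 3 ≤ q

/-- The contact manifold `(M, ξ)` is strongly dynamically convex if `ξ` is the kernel of a strongly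
dynamically convex contact form. -/
def IsStronglyDynamicallyConvexContactStructure
    (ξ : (x : M) → Submodule ℝ (TangentSpace (𝓡 3) x)) : Prop :=
  ∃ α : OneForm M, (∀ x, ξ x = LinearMap.ker (α x).toLinearMap) ∧ α.IsStronglyDynamicallyConvex

end Contact

end

/-! ### Chain complexes of semi-simplicial sets, and singular chains -/

noncomputable section

namespace SingularDuality

/-! ### Finitely supported functions -/

/-! The form `α ∧ dα` orients `M`, and `H¹(M; ℚ) = 0` forces `H₁(M; ℚ) = 0`, since over a field a
cycle that does not bound is detected by a cocycle. Poincaré duality for a closed oriented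
3-manifold then kills `H₂`. A fundamental class spans `H₃`, a point spans `H₀`, and homology above
the dimension vanishes.

Everything happens on the chain level, without cap products or quotients. A class of the pair `(X,
A)` is a chain whose boundary lies in `chainsIn A`; it is zero when the chain lies in `nullRel A`.
Homotopy invariance (`exists_homotopy`) and small simplices (`exists_sub_bd_mem_smallChains`) yield
excision and Mayer–Vietoris arguments. These give the local homology of `ℝⁿ` (`exists_isRelGen`) and
hence a local degree `degAt`. Maps with positive Jacobian preserve it
(`originDeg_push_of_hasFDerivAt`), so charts in which `α ∧ dα` is positive define one degree at each
point of `M` (`contactOrientation`).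

Duality is `LocalOrientation.exists_bd_eq`. A 2-cycle `z` has a filling `b x` near each point `x`.
Two fillings differ on the overlap by a relative 3-cycle, whose degree is locally constant, so the
increments of `y ↦ deg y (b x)` along a path do not depend on `x`. These increments form a
1-cocycle. As every 1-cycle bounds, it is the coboundary of a global function `g`
(`exists_forall_sub_eq`). Adding multiples of local generators makes each filling have degree `g`.
The fillings then agree up to relative boundaries on overlaps, because top-degree relative classes
along compact sets are detected pointwise (`detectsPointwise_of_isCompact`), and they glue to a
filling of `z` (`exists_filling`). The same gluing applied to `z = 0`, `g = 1` produces the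
fundamental cycle. -/

theorem map_mem_of_mem_supported {ι V : Type*} [AddCommGroup V] [Module ℚ V] {s : Set ι}
    {f : (ι →₀ ℚ) →ₗ[ℚ] V} {N : Submodule ℚ V}
    (h : ∀ a ∈ s, f (Finsupp.single a 1) ∈ N) {c : ι →₀ ℚ} (hc : c ∈ Finsupp.supported ℚ ℚ s) :
    f c ∈ N := by
  rw [Finsupp.supported_eq_span_single] at hc
  have : Submodule.span ℚ ((fun i ↦ Finsupp.single i (1 : ℚ)) '' s) ≤ N.comap f := by
    rw [Submodule.span_le]
    rintro _ ⟨a, ha, rfl⟩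
    exact h a ha
  exact this hc

theorem eq_of_mem_supported {ι V : Type*} [AddCommGroup V] [Module ℚ V] {s : Set ι}
    {f g : (ι →₀ ℚ) →ₗ[ℚ] V}
    (h : ∀ a ∈ s, f (Finsupp.single a 1) = g (Finsupp.single a 1)) {c : ι →₀ ℚ}
    (hc : c ∈ Finsupp.supported ℚ ℚ s) : f c = g c := by
  have := map_mem_of_mem_supported (f := f - g) (N := ⊥)
    (fun a ha ↦ by simp [h a ha]) hc
  simpa [sub_eq_zero] using this

/-! ### Chain complexes of semi-simplicial sets -/

/-- Face maps which make the family `S` a semi-simplicial set. -/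
class FaceMaps (S : ℕ → Type*) where
  face : ∀ n, Fin (n + 2) → S (n + 1) → S n
  face_face : ∀ n (i : Fin (n + 2)) (j : Fin (n + 2)) (s : S (n + 2)), j ≤ i →
    face n i (face (n + 1) j.castSucc s) = face n j (face (n + 1) i.succ s)

/-- Rational chains of all degrees. -/
abbrev FaceChains (S : ℕ → Type*) : Type _ := (Σ n, S n) →₀ ℚ

section FaceChains

variable (S : ℕ → Type*)

/-- The boundary of a simplex. -/
def bdBasis [FaceMaps S] : (Σ n, S n) → FaceChains S
  | ⟨0, _⟩ => 0
  | ⟨n + 1, s⟩ => ∑ i : Fin (n + 2), Finsupp.single ⟨n, FaceMaps.face n i s⟩ ((-1) ^ (i : ℕ))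

/-- The boundary operator on chains of all degrees, which is zero in degree zero. -/
def bd [FaceMaps S] : FaceChains S →ₗ[ℚ] FaceChains S := Finsupp.linearCombination ℚ (bdBasis S)

/-- The augmentation, which is zero in positive degrees. -/
def aug : FaceChains S →ₗ[ℚ] ℚ :=
  Finsupp.linearCombination ℚ fun s : Σ n, S n ↦ if s.1 = 0 then 1 else 0

/-- Projection to the component of degree `k`. -/
def proj (k : ℕ) : FaceChains S →ₗ[ℚ] FaceChains S :=
  Finsupp.linearCombination ℚ fun s : Σ n, S n ↦ if s.1 = k then Finsupp.single s 1 else 0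

/-- Chains which are homogeneous of degree `k`. -/
def homog (k : ℕ) : Submodule ℚ (FaceChains S) := Finsupp.supported ℚ ℚ {s | s.1 = k}

variable {S}

theorem bd_single_zero [FaceMaps S] (s : S 0) (q : ℚ) : bd S (Finsupp.single ⟨0, s⟩ q) = 0 := by
  simp [bd, bdBasis]

theorem bd_single_succ [FaceMaps S] {n : ℕ} (s : S (n + 1)) :
    bd S (Finsupp.single ⟨n + 1, s⟩ 1) =
      ∑ i : Fin (n + 2), (-1 : ℚ) ^ (i : ℕ) • Finsupp.single ⟨n, FaceMaps.face n i s⟩ 1 := by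
  simp [bd, bdBasis]

theorem aug_single_zero (s : S 0) : aug S (Finsupp.single ⟨0, s⟩ 1) = 1 := by
  simp [aug]

theorem aug_single_succ {n : ℕ} (s : S (n + 1)) : aug S (Finsupp.single ⟨n + 1, s⟩ 1) = 0 := by
  simp [aug]

theorem proj_single (k : ℕ) (s : Σ n, S n) :
    proj S k (Finsupp.single s 1) = if s.1 = k then Finsupp.single s 1 else 0 := by
  simp [proj]

theorem bd_bd [FaceMaps S] (c : FaceChains S) : bd S (bd S c) = 0 := by
  suffices bd S ∘ₗ bd S = 0 from LinearMap.congr_fun this c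
  refine Finsupp.lhom_ext' fun ⟨n, s⟩ ↦ LinearMap.ext_ring ?_
  match n, s with
  | 0, s => simp [bd_single_zero]
  | 1, s => simp [bd_single_succ, bd_single_zero]
  | n + 2, s =>
    simp only [LinearMap.coe_comp, Function.comp_apply, Finsupp.lsingle_apply, bd_single_succ,
      map_sum, map_smul, Finset.smul_sum, smul_smul, LinearMap.zero_apply]
    rw [← Finset.sum_product', Finset.univ_product_univ]
    -- The terms with `j ≤ i` cancel those with `j > i`: `(j, i) ↦ (i + 1, j)` matches equal
    -- iterated faces, by `face_face`, and flips the sign.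
    let A : Finset (Fin (n + 3) × Fin (n + 2)) := {p | (p.1 : ℕ) ≤ p.2}
    rw [← Finset.sum_add_sum_compl A, ← eq_neg_iff_add_eq_zero, ← Finset.sum_neg_distrib]
    refine Finset.sum_bij
      (fun p hp ↦ (p.2.succ, p.1.castLT (lt_of_le_of_lt (Finset.mem_filter.mp hp).2 p.2.2)))
      ?_ ?_ ?_ ?_
    · rintro ⟨j, i⟩ hp
      simp only [A, Finset.mem_filter_univ, Finset.compl_filter] at hp ⊢
      simp only [Fin.val_succ, Fin.val_castLT]
      omega
    · rintro ⟨j, i⟩ hp ⟨j', i'⟩ hp' h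
      simp only [Prod.mk.injEq, Fin.ext_iff, Fin.val_castLT, Fin.val_succ] at h ⊢
      omega
    · rintro ⟨j, i⟩ hp
      simp only [A, Finset.mem_filter_univ, Finset.compl_filter] at hp
      have hj : j ≠ 0 := by rintro rfl; simp at hp
      refine ⟨(i.castSucc, j.pred hj), ?_, ?_⟩
      · simp only [A, Finset.mem_filter_univ, Fin.val_castSucc, Fin.val_pred]
        omega
      · simp
    · rintro ⟨j, i⟩ hp
      simp only [A, Finset.mem_filter_univ] at hp
      have := FaceMaps.face_face n i (j.castLT (lt_of_le_of_lt hp i.2)) s hp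
      rw [Fin.castSucc_castLT] at this
      simp only [this, Fin.val_succ, Fin.val_castLT, ← neg_smul]
      congr 1
      ring

theorem aug_bd [FaceMaps S] (c : FaceChains S) : aug S (bd S c) = 0 := by
  suffices aug S ∘ₗ bd S = 0 from LinearMap.congr_fun this c
  refine Finsupp.lhom_ext' fun ⟨n, s⟩ ↦ LinearMap.ext_ring ?_
  match n, s with
  | 0, s => simp [bd_single_zero]
  | 1, s => simp [bd_single_succ, aug_single_zero, Fin.sum_univ_two]
  | n + 2, s =>
    simp only [LinearMap.coe_comp, Function.comp_apply, Finsupp.lsingle_apply, bd_single_succ,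
      map_sum, map_smul, aug_single_succ, smul_zero, Finset.sum_const_zero, LinearMap.zero_apply]

/-- All degrees share one vector space, which makes the boundary an endomorphism without index
casts. This commutation recovers the grading: a filling of a homogeneous chain may be replaced by
its component in the right degree. -/
theorem bd_proj_succ [FaceMaps S] (k : ℕ) (c : FaceChains S) :
    bd S (proj S (k + 1) c) = proj S k (bd S c) := by
  suffices bd S ∘ₗ proj S (k + 1) = proj S k ∘ₗ bd S from LinearMap.congr_fun this c
  refine Finsupp.lhom_ext' fun ⟨n, s⟩ ↦ LinearMap.ext_ring ?_
  match n, s with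
  | 0, s => simp [bd_single_zero, proj_single]
  | n + 1, s =>
    simp only [LinearMap.coe_comp, Function.comp_apply, Finsupp.lsingle_apply, bd_single_succ,
      map_sum, map_smul, proj_single]
    by_cases h : n = k
    · simp [bd_single_succ, h]
    · simp [h]

theorem bd_proj_zero [FaceMaps S] (c : FaceChains S) : bd S (proj S 0 c) = 0 := by
  suffices bd S ∘ₗ proj S 0 = 0 from LinearMap.congr_fun this c
  refine Finsupp.lhom_ext' fun ⟨n, s⟩ ↦ LinearMap.ext_ring ?_
  match n, s with
  | 0, s => simp [bd_single_zero, proj_single]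
  | n + 1, s => simp [proj_single]

theorem proj_mem_homog (k : ℕ) (c : FaceChains S) : proj S k c ∈ homog S k := by
  refine map_mem_of_mem_supported (s := univ) (fun s _ ↦ ?_) (by simp)
  rw [proj_single]
  split_ifs with h
  · exact Finsupp.single_mem_supported ℚ 1 h
  · exact zero_mem _

theorem proj_eq_self {k : ℕ} {c : FaceChains S} (hc : c ∈ homog S k) : proj S k c = c :=
  eq_of_mem_supported (g := LinearMap.id) (fun s hs ↦ by
    rw [proj_single, if_pos (show s.1 = k from hs), LinearMap.id_apply]) hc

theorem proj_eq_zero {k l : ℕ} (hkl : l ≠ k) {c : FaceChains S} (hc : c ∈ homog S l) :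
    proj S k c = 0 :=
  eq_of_mem_supported (g := 0) (fun s hs ↦ by
    rw [proj_single, if_neg (by rw [show s.1 = l from hs]; exact hkl), LinearMap.zero_apply]) hc

theorem proj_mem_supported (k : ℕ) {A : Set (Σ n, S n)} {c : FaceChains S}
    (hc : c ∈ Finsupp.supported ℚ ℚ A) : proj S k c ∈ Finsupp.supported ℚ ℚ A := by
  refine map_mem_of_mem_supported (fun s hs ↦ ?_) hc
  rw [proj_single]
  split_ifs
  · exact Finsupp.single_mem_supported ℚ 1 hs
  · exact zero_mem _

theorem bd_mem_homog [FaceMaps S] {k : ℕ} {c : FaceChains S} (hc : c ∈ homog S (k + 1)) :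
    bd S c ∈ homog S k := by
  rw [← proj_eq_self hc, bd_proj_succ]
  exact proj_mem_homog _ _

end FaceChains

/-! ### Singular chains -/

/-- Singular simplices. -/
@[ext]
structure Sing (X : Type*) [TopologicalSpace X] (n : ℕ) where
  toFun : stdSimplex ℝ (Fin (n + 1)) → X
  continuous_toFun : Continuous toFun

/-- The inclusion of the `i`-th face of the standard simplex. -/
def stdFace {n : ℕ} (i : Fin (n + 2)) :
    C(stdSimplex ℝ (Fin (n + 1)), stdSimplex ℝ (Fin (n + 2))) :=
  ⟨stdSimplex.map i.succAbove, stdSimplex.continuous_map _⟩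

theorem succAbove_comp_succAbove {n : ℕ} {i j : Fin (n + 2)} (h : j ≤ i) :
    j.castSucc.succAbove ∘ i.succAbove = i.succ.succAbove ∘ j.succAbove := by
  ext k
  simp only [Function.comp_apply, Fin.succAbove, Fin.lt_def, Fin.le_def] at *
  split_ifs <;> simp_all <;> omega

instance (X : Type*) [TopologicalSpace X] : FaceMaps (Sing X) where
  face _ i s := ⟨s.toFun ∘ stdFace i, s.continuous_toFun.comp (stdFace i).continuous⟩
  face_face n i j s h := by
    refine Sing.ext (funext fun p ↦ congrArg s.toFun ?_)
    have h' := congrArg (fun g ↦ stdSimplex.map (S := ℝ) g p) (succAbove_comp_succAbove h)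
    simpa only [stdFace, ContinuousMap.coe_mk, stdSimplex.map_comp_apply] using h'

section Singular

variable {X Y : Type*} [TopologicalSpace X] [TopologicalSpace Y]

/-- Rational singular chains of all degrees. -/
abbrev Chains (X : Type*) [TopologicalSpace X] : Type _ := FaceChains (Sing X)

/-- The image of a singular simplex. -/
def carrier (s : Σ n, Sing X n) : Set X := range s.2.toFun

/-- The chains in a subset. -/
def chainsIn (A : Set X) : Submodule ℚ (Chains X) := Finsupp.supported ℚ ℚ {s | carrier s ⊆ A}

/-- The chains whose simplices are contained in members of a family of subsets. -/
def smallChains (𝒰 : Set (Set X)) : Submodule ℚ (Chains X) :=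
  Finsupp.supported ℚ ℚ {s | ∃ U ∈ 𝒰, carrier s ⊆ U}

theorem carrier_face {n : ℕ} (i : Fin (n + 2)) (s : Sing X (n + 1)) :
    carrier ⟨n, FaceMaps.face n i s⟩ ⊆ carrier ⟨n + 1, s⟩ := by
  rintro _ ⟨p, rfl⟩
  exact ⟨stdFace i p, rfl⟩

theorem carrier_nonempty (s : Σ n, Sing X n) : (carrier s).Nonempty := range_nonempty _

theorem isCompact_carrier (s : Σ n, Sing X n) : IsCompact (carrier s) :=
  isCompact_range s.2.continuous_toFun

theorem isPathConnected_carrier (s : Σ n, Sing X n) : IsPathConnected (carrier s) :=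
  isPathConnected_range s.2.continuous_toFun

theorem chainsIn_mono {A B : Set X} (h : A ⊆ B) : chainsIn A ≤ chainsIn B :=
  Finsupp.supported_mono fun _ hs ↦ hs.trans h

theorem chainsIn_univ (c : Chains X) : c ∈ chainsIn (univ : Set X) := by
  simp [chainsIn]

theorem chainsIn_inter {A B : Set X} {c : Chains X} (hA : c ∈ chainsIn A) (hB : c ∈ chainsIn B) :
    c ∈ chainsIn (A ∩ B) :=
  fun _ hs ↦ subset_inter (hA hs) (hB hs)

/-- Every simplex has a nonempty image. With `A = univᶜ` this turns a statement modulo the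
complement of the whole space into an absolute one. -/
theorem chainsIn_empty {c : Chains X} (hc : c ∈ chainsIn (∅ : Set X)) : c = 0 := by
  have : {s : Σ n, Sing X n | carrier s ⊆ ∅} = ∅ := by
    refine eq_empty_of_forall_notMem fun s hs ↦ ?_
    exact (carrier_nonempty s).ne_empty (subset_empty_iff.mp hs)
  rw [chainsIn, this, Finsupp.supported_empty] at hc
  simpa using hc

theorem bd_mem_chainsIn {A : Set X} {c : Chains X} (hc : c ∈ chainsIn A) :
    bd _ c ∈ chainsIn A := by
  refine map_mem_of_mem_supported (fun ⟨n, s⟩ hs ↦ ?_) hc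
  match n, s with
  | 0, s => rw [bd_single_zero]; exact zero_mem _
  | n + 1, s =>
    rw [bd_single_succ]
    exact sum_mem fun i _ ↦ Submodule.smul_mem _ _
      (Finsupp.single_mem_supported ℚ 1 ((carrier_face i s).trans hs))

theorem proj_mem_chainsIn (k : ℕ) {A : Set X} {c : Chains X} (hc : c ∈ chainsIn A) :
    proj _ k c ∈ chainsIn A :=
  proj_mem_supported k hc

theorem mem_smallChains_pair {A B : Set X} {c : Chains X} :
    c ∈ smallChains {A, B} ↔ ∃ a ∈ chainsIn A, ∃ b ∈ chainsIn B, a + b = c := by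
  rw [← Submodule.mem_sup, chainsIn, chainsIn, ← Finsupp.supported_union, smallChains]
  have : {s : Σ n, Sing X n | ∃ U ∈ ({A, B} : Set (Set X)), carrier s ⊆ U} =
      {s | carrier s ⊆ A} ∪ {s | carrier s ⊆ B} := by
    ext s
    simp
  rw [this]

/-- A finite chain has compact support. -/
theorem exists_isCompact_chainsIn (c : Chains X) : ∃ C : Set X, IsCompact C ∧ c ∈ chainsIn C ∧
    ∀ A, c ∈ chainsIn A → C ⊆ A := by
  refine ⟨⋃ s ∈ c.support, carrier s, c.support.isCompact_biUnion fun s _ ↦ isCompact_carrier s,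
    fun s hs ↦ ?_, fun A hA ↦ iUnion₂_subset fun s hs ↦ hA hs⟩
  exact subset_biUnion_of_mem (u := fun s ↦ carrier s) hs

open Classical in
/-- The chain given by a function on a standard simplex, zero if the function is discontinuous. -/
def ofFun {n : ℕ} (t : stdSimplex ℝ (Fin (n + 1)) → Y) : Chains Y :=
  if h : Continuous t then Finsupp.single ⟨n, ⟨t, h⟩⟩ 1 else 0

/-- Push-forward of chains by an arbitrary function; simplices with discontinuous image are
mapped to zero. -/
def push (f : X → Y) : Chains X →ₗ[ℚ] Chains Y :=
  Finsupp.linearCombination ℚ fun s : Σ n, Sing X n ↦ ofFun (f ∘ s.2.toFun)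

theorem push_single {f : X → Y} {n : ℕ} {s : Sing X n}
    (h : Continuous (f ∘ s.toFun)) :
    push f (Finsupp.single ⟨n, s⟩ 1) = Finsupp.single ⟨n, ⟨_, h⟩⟩ 1 := by
  simp only [push, Finsupp.linearCombination_single, one_smul]
  exact dif_pos h

theorem continuous_comp_of_carrier {f : X → Y} {A : Set X} (hf : ContinuousOn f A) {n : ℕ}
    {s : Sing X n} (hs : carrier ⟨n, s⟩ ⊆ A) : Continuous (f ∘ s.toFun) :=
  hf.comp_continuous s.continuous_toFun fun p ↦ hs (mem_range_self p)

/-- Some continuity is needed, as a simplex with discontinuous image is sent to zero while its faces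
may survive. Continuity on a set carrying the chain is enough, so charts can be used as total
functions without passing to subtypes. -/
theorem push_bd {f : X → Y} {A : Set X} (hf : ContinuousOn f A) {c : Chains X}
    (hc : c ∈ chainsIn A) : bd _ (push f c) = push f (bd _ c) := by
  refine eq_of_mem_supported (f := bd _ ∘ₗ push f) (g := push f ∘ₗ bd _) (fun ⟨n, s⟩ hs ↦ ?_) hc
  match n, s with
  | 0, s =>
    simp only [LinearMap.comp_apply]
    rw [push_single (continuous_comp_of_carrier hf hs), bd_single_zero, bd_single_zero, map_zero]
  | n + 1, s =>
    simp only [LinearMap.comp_apply]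
    rw [push_single (continuous_comp_of_carrier hf hs), bd_single_succ, bd_single_succ, map_sum]
    refine Finset.sum_congr rfl fun i _ ↦ ?_
    rw [map_smul, push_single (continuous_comp_of_carrier hf ((carrier_face i s).trans hs))]
    rfl

theorem push_mem_chainsIn {f : X → Y} {A : Set X} {B : Set Y} (hf : ContinuousOn f A)
    (hAB : MapsTo f A B) {c : Chains X} (hc : c ∈ chainsIn A) : push f c ∈ chainsIn B := by
  refine map_mem_of_mem_supported (fun ⟨n, s⟩ hs ↦ ?_) hc
  rw [push_single (continuous_comp_of_carrier hf hs)]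
  refine Finsupp.single_mem_supported ℚ 1 ?_
  rintro _ ⟨p, rfl⟩
  exact hAB (hs (mem_range_self p))

theorem push_congr {f g : X → Y} {A : Set X} (h : EqOn f g A) {c : Chains X}
    (hc : c ∈ chainsIn A) : push f c = push g c := by
  refine eq_of_mem_supported (fun ⟨n, s⟩ hs ↦ ?_) hc
  have : f ∘ s.toFun = g ∘ s.toFun :=
    funext fun p ↦ h (hs (mem_range_self p))
  simp only [push, Finsupp.linearCombination_single, this]

theorem push_push {Z : Type*} [TopologicalSpace Z] {f : X → Y} {g : Y → Z} {A : Set X}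
    (hf : ContinuousOn f A) {c : Chains X} (hc : c ∈ chainsIn A) :
    push g (push f c) = push (g ∘ f) c := by
  refine eq_of_mem_supported (f := push g ∘ₗ push f) (fun ⟨n, s⟩ hs ↦ ?_) hc
  rw [LinearMap.comp_apply, push_single (continuous_comp_of_carrier hf hs)]
  simp only [push, Finsupp.linearCombination_single]
  rfl

theorem push_id {f : X → X} {A : Set X} (h : EqOn f id A) {c : Chains X}
    (hc : c ∈ chainsIn A) : push f c = c := by
  rw [push_congr h hc]
  refine eq_of_mem_supported (g := LinearMap.id) (fun ⟨n, s⟩ _ ↦ ?_) hc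
  rw [push_single (by exact s.continuous_toFun)]
  rfl

theorem proj_push (k : ℕ) {f : X → Y} {A : Set X} (hf : ContinuousOn f A) {c : Chains X}
    (hc : c ∈ chainsIn A) : proj _ k (push f c) = push f (proj _ k c) := by
  refine eq_of_mem_supported (f := proj _ k ∘ₗ push f) (g := push f ∘ₗ proj _ k)
    (fun ⟨n, s⟩ hs ↦ ?_) hc
  rw [LinearMap.comp_apply, LinearMap.comp_apply, push_single (continuous_comp_of_carrier hf hs),
    proj_single, proj_single]
  split_ifs
  · rw [push_single (continuous_comp_of_carrier hf hs)]
  · rw [map_zero]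

end Singular

end SingularDuality

end

/-! ### Affine simplices, cones and their realization as singular chains -/

noncomputable section

namespace SingularDuality

/-! ### Chains of affine simplices -/

/-- Affine simplices in `E`, given by their vertices. -/
abbrev AffSimp (E : Type*) (n : ℕ) : Type _ := Fin (n + 1) → E

instance (E : Type*) : FaceMaps (AffSimp E) where
  face _ i v := v ∘ i.succAbove
  face_face n i j v h := by
    have := congrArg (fun g ↦ v ∘ g) (succAbove_comp_succAbove h)
    exact this

/-- Chains of affine simplices. -/
abbrev AffChains (E : Type*) : Type _ := FaceChains (AffSimp E)

section Affine

variable {E F G : Type*}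

/-- The affine chains with vertices in a given set. -/
def affIn (Z : Set E) : Submodule ℚ (AffChains E) := Finsupp.supported ℚ ℚ {s | ∀ i, s.2 i ∈ Z}

/-- The map of affine chains induced by a map of vertices. -/
def amap (L : E → F) : AffChains E →ₗ[ℚ] AffChains F :=
  Finsupp.linearCombination ℚ fun s : Σ n, AffSimp E n ↦ Finsupp.single ⟨s.1, L ∘ s.2⟩ 1

/-- The cone over an affine chain. -/
def cone (p : E) : AffChains E →ₗ[ℚ] AffChains E :=
  Finsupp.linearCombination ℚ fun s : Σ n, AffSimp E n ↦
    Finsupp.single ⟨s.1 + 1, (Fin.cons p s.2 : Fin (s.1 + 2) → E)⟩ 1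

theorem amap_single (L : E → F) (s : Σ n, AffSimp E n) :
    amap L (Finsupp.single s 1) = Finsupp.single ⟨s.1, L ∘ s.2⟩ 1 := by
  simp [amap]

theorem cone_single (p : E) (s : Σ n, AffSimp E n) :
    cone p (Finsupp.single s 1) =
      Finsupp.single ⟨s.1 + 1, (Fin.cons p s.2 : Fin (s.1 + 2) → E)⟩ 1 := by
  simp [cone]

theorem amap_bd (L : E → F) (a : AffChains E) : amap L (bd _ a) = bd _ (amap L a) := by
  suffices amap L ∘ₗ bd _ = bd _ ∘ₗ amap L from LinearMap.congr_fun this a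
  refine Finsupp.lhom_ext' fun ⟨n, s⟩ ↦ LinearMap.ext_ring ?_
  simp only [LinearMap.comp_apply, Finsupp.lsingle_apply, amap_single]
  match n, s with
  | 0, s => rw [bd_single_zero, bd_single_zero, map_zero]
  | n + 1, s =>
    rw [bd_single_succ, bd_single_succ, map_sum]
    simp only [map_smul, amap_single]
    rfl

theorem aug_amap (L : E → F) (a : AffChains E) : aug _ (amap L a) = aug _ a := by
  suffices aug _ ∘ₗ amap L = aug _ from LinearMap.congr_fun this a
  refine Finsupp.lhom_ext' fun ⟨n, s⟩ ↦ LinearMap.ext_ring ?_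
  simp only [LinearMap.comp_apply, Finsupp.lsingle_apply, amap_single]
  simp [aug]

theorem amap_amap (M : F → G) (L : E → F) (a : AffChains E) :
    amap M (amap L a) = amap (M ∘ L) a := by
  suffices amap M ∘ₗ amap L = amap (M ∘ L) from LinearMap.congr_fun this a
  refine Finsupp.lhom_ext' fun s ↦ LinearMap.ext_ring ?_
  simp only [LinearMap.comp_apply, Finsupp.lsingle_apply, amap_single]
  rfl

theorem amap_cone (L : E → F) (p : E) (a : AffChains E) :
    amap L (cone p a) = cone (L p) (amap L a) := by
  suffices amap L ∘ₗ cone p = cone (L p) ∘ₗ amap L from LinearMap.congr_fun this a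
  refine Finsupp.lhom_ext' fun s ↦ LinearMap.ext_ring ?_
  simp only [LinearMap.comp_apply, Finsupp.lsingle_apply, amap_single, cone_single]
  congr 2
  exact Fin.comp_cons L p s.2

theorem amap_mem_affIn {L : E → F} {Z : Set E} {W : Set F} (h : MapsTo L Z W) {a : AffChains E}
    (ha : a ∈ affIn Z) : amap L a ∈ affIn W := by
  refine map_mem_of_mem_supported (fun s hs ↦ ?_) ha
  rw [amap_single]
  exact Finsupp.single_mem_supported ℚ 1 fun i ↦ h (hs i)

theorem cone_mem_affIn {Z : Set E} {p : E} (hp : p ∈ Z) {a : AffChains E}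
    (ha : a ∈ affIn Z) : cone p a ∈ affIn Z := by
  refine map_mem_of_mem_supported (fun s hs ↦ ?_) ha
  rw [cone_single]
  exact Finsupp.single_mem_supported ℚ 1 fun i ↦ Fin.cases hp hs i

theorem bd_mem_affIn {Z : Set E} {a : AffChains E} (ha : a ∈ affIn Z) : bd _ a ∈ affIn Z := by
  refine map_mem_of_mem_supported (fun ⟨n, s⟩ hs ↦ ?_) ha
  match n, s with
  | 0, s => rw [bd_single_zero]; exact zero_mem _
  | n + 1, s =>
    rw [bd_single_succ]
    exact sum_mem fun i _ ↦ Submodule.smul_mem _ _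
      (Finsupp.single_mem_supported ℚ 1 fun j ↦ hs (i.succAbove j))

theorem aug_cone (p : E) (a : AffChains E) : aug _ (cone p a) = 0 := by
  suffices aug _ ∘ₗ cone p = 0 from LinearMap.congr_fun this a
  refine Finsupp.lhom_ext' fun s ↦ LinearMap.ext_ring ?_
  simp only [LinearMap.comp_apply, Finsupp.lsingle_apply, cone_single, aug_single_succ,
    LinearMap.zero_apply]

/-- The vertex `p` as an affine chain. -/
def apt (p : E) : AffChains E := Finsupp.single ⟨0, fun _ ↦ p⟩ 1

/-- Deleting the apex returns the base, and the other faces are cones over faces of the base. The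
exception is a 0-simplex, whose deletion leaves the apex itself; this is the augmentation term. -/
theorem bd_cone (p : E) (a : AffChains E) :
    bd _ (cone p a) = a - cone p (bd _ a) - aug _ a • apt p := by
  suffices bd _ ∘ₗ cone p =
      LinearMap.id - cone p ∘ₗ bd _ - (aug _).smulRight (apt p) from LinearMap.congr_fun this a
  refine Finsupp.lhom_ext' fun ⟨n, s⟩ ↦ LinearMap.ext_ring ?_
  simp only [LinearMap.comp_apply, Finsupp.lsingle_apply, cone_single, LinearMap.sub_apply,
    LinearMap.id_apply, LinearMap.smulRight_apply]
  rw [bd_single_succ, Fin.sum_univ_succ]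
  have h0 : FaceMaps.face n 0 (Fin.cons p s : Fin (n + 2) → E) = s := by
    refine funext fun i ↦ ?_
    change (Fin.cons p s : Fin (n + 2) → E) (Fin.succAbove 0 i) = s i
    simp
  rw [show (FaceMaps.face (S := AffSimp E) n 0 (Fin.cons p s : Fin (n + 2) → E)) = s from h0]
  match n, s with
  | 0, s =>
    have h1 : (FaceMaps.face (S := AffSimp E) 0 1 (Fin.cons p s : Fin 2 → E)) =
        fun _ ↦ p := by
      refine funext fun i ↦ ?_
      change (Fin.cons p s : Fin 2 → E) (Fin.succAbove 1 i) = p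
      rw [Fin.fin_one_eq_zero i]
      rfl
    simp only [bd_single_zero, map_zero, aug_single_zero, apt]
    simp [sub_eq_add_neg, h1]
  | n + 1, s =>
    rw [bd_single_succ, map_sum, aug_single_succ, zero_smul, sub_zero, sub_eq_add_neg,
      ← Finset.sum_neg_distrib]
    congr 1
    · simp
    · refine Finset.sum_congr rfl fun i _ ↦ ?_
      rw [map_smul, cone_single, Fin.val_succ, pow_succ, mul_neg_one, neg_smul]
      congr 4
      refine funext fun j ↦ ?_
      change (Fin.cons p s : Fin (n + 3) → E) (i.succ.succAbove j) =
        (Fin.cons p (s ∘ i.succAbove) : Fin (n + 2) → E) j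
      refine Fin.cases ?_ (fun j ↦ ?_) j
      · simp
      · simp

end Affine

section Barycenter

variable {E F : Type*} [AddCommGroup E] [Module ℝ E] [AddCommGroup F] [Module ℝ F]

/-- The barycenter of the vertices of an affine simplex. -/
def bary {n : ℕ} (v : AffSimp E n) : E := (n + 1 : ℝ)⁻¹ • ∑ i, v i

theorem map_bary (L : E →ₗ[ℝ] F) {n : ℕ} (v : AffSimp E n) :
    L (bary v) = bary (n := n) (L ∘ v) := by
  simp [bary]

theorem bary_mem {Z : Set E} (hZ : Convex ℝ Z) {n : ℕ} {v : AffSimp E n} (hv : ∀ i, v i ∈ Z) :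
    bary v ∈ Z := by
  rw [bary, Finset.smul_sum]
  refine hZ.sum_mem (fun _ _ ↦ by positivity) ?_ fun i _ ↦ hv i
  simp only [Finset.sum_const, Finset.card_univ, Fintype.card_fin, nsmul_eq_mul]
  push_cast
  field_simp

end Barycenter

/-! ### Realization of affine chains -/

section Realization

variable {E F : Type*} [NormedAddCommGroup E] [NormedSpace ℝ E] [NormedAddCommGroup F]
  [NormedSpace ℝ F]

/-- The linear map from the standard simplex given by the vertices of an affine simplex. -/
def affMap {n : ℕ} (v : AffSimp E n) : (Fin (n + 1) → ℝ) →L[ℝ] E :=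
  ∑ i, (ContinuousLinearMap.proj i : (Fin (n + 1) → ℝ) →L[ℝ] ℝ).smulRight (v i)

theorem affMap_apply {n : ℕ} (v : AffSimp E n) (t : Fin (n + 1) → ℝ) :
    affMap v t = ∑ i, t i • v i := by
  simp [affMap]

/-- An affine simplex as a singular simplex. -/
def affSing {n : ℕ} (v : AffSimp E n) : Sing E n :=
  ⟨fun t ↦ affMap v t, (affMap v).continuous.comp continuous_subtype_val⟩

/-- Affine chains as singular chains. -/
def aff : AffChains E →ₗ[ℚ] Chains E :=
  Finsupp.linearCombination ℚ fun s : Σ n, AffSimp E n ↦ Finsupp.single ⟨s.1, affSing s.2⟩ 1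

theorem aff_single (s : Σ n, AffSimp E n) :
    aff (Finsupp.single s 1) = Finsupp.single ⟨s.1, affSing s.2⟩ 1 := by
  simp [aff]

theorem affMap_map {m n : ℕ} (v : AffSimp E n) (f : Fin (m + 1) → Fin (n + 1))
    (t : stdSimplex ℝ (Fin (m + 1))) :
    affMap v (stdSimplex.map f t) = affMap (n := m) (v ∘ f) t := by
  simp only [affMap_apply, stdSimplex.map_coe, Function.comp_apply]
  simp only [FunOnFinite.linearMap_apply_apply, Finset.sum_smul]
  rw [← Finset.sum_fiberwise (s := Finset.univ) (g := f) (f := fun k ↦ t k • v (f k))]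
  refine Finset.sum_congr rfl fun j _ ↦ Finset.sum_congr rfl fun k hk ↦ ?_
  rw [(Finset.mem_filter.mp hk).2]

theorem aff_bd (a : AffChains E) : aff (bd _ a) = bd _ (aff a) := by
  suffices aff ∘ₗ bd _ = bd _ ∘ₗ aff (E := E) from LinearMap.congr_fun this a
  refine Finsupp.lhom_ext' fun ⟨n, s⟩ ↦ LinearMap.ext_ring ?_
  simp only [LinearMap.comp_apply, Finsupp.lsingle_apply, aff_single]
  match n, s with
  | 0, s => rw [bd_single_zero, bd_single_zero, map_zero]
  | n + 1, s =>
    rw [bd_single_succ, bd_single_succ, map_sum]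
    refine Finset.sum_congr rfl fun i _ ↦ ?_
    rw [map_smul, aff_single]
    congr 3
    refine Sing.ext (funext fun t ↦ ?_)
    exact (affMap_map s i.succAbove t).symm

theorem affMap_mem {Z : Set E} (hZ : Convex ℝ Z) {n : ℕ} {v : AffSimp E n} (hv : ∀ i, v i ∈ Z)
    {t : Fin (n + 1) → ℝ} (ht : t ∈ stdSimplex ℝ (Fin (n + 1))) : affMap v t ∈ Z := by
  rw [affMap_apply]
  exact hZ.sum_mem (fun i _ ↦ ht.1 i) ht.2 fun i _ ↦ hv i

theorem carrier_affSing {Z : Set E} (hZ : Convex ℝ Z) {n : ℕ} {v : AffSimp E n}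
    (hv : ∀ i, v i ∈ Z) : carrier ⟨n, affSing v⟩ ⊆ Z := by
  rintro _ ⟨t, rfl⟩
  exact affMap_mem hZ hv t.2

theorem aff_mem_chainsIn {Z : Set E} (hZ : Convex ℝ Z) {a : AffChains E} (ha : a ∈ affIn Z) :
    aff a ∈ chainsIn Z := by
  refine map_mem_of_mem_supported (fun s hs ↦ ?_) ha
  rw [aff_single]
  exact Finsupp.single_mem_supported ℚ 1 (carrier_affSing hZ hs)

theorem aff_amap (L : E →L[ℝ] F) (a : AffChains E) : aff (amap L a) = push L (aff a) := by
  suffices aff ∘ₗ amap L = push L ∘ₗ aff from LinearMap.congr_fun this a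
  refine Finsupp.lhom_ext' fun s ↦ LinearMap.ext_ring ?_
  simp only [LinearMap.comp_apply, Finsupp.lsingle_apply, aff_single, amap_single]
  rw [push_single (L.continuous.comp (affSing s.2).continuous_toFun)]
  congr 2
  refine Sing.ext (funext fun t ↦ ?_)
  simp [affSing, affMap_apply]

end Realization

/-- The vertices of the standard simplex. -/
def stdVert (n : ℕ) : AffSimp (Fin (n + 1) → ℝ) n := fun i ↦ Pi.single i 1

/-- The standard simplex as an affine chain. -/
def stdChain (n : ℕ) : AffChains (Fin (n + 1) → ℝ) := Finsupp.single ⟨n, stdVert n⟩ 1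

theorem stdChain_mem (n : ℕ) : stdChain n ∈ affIn (stdSimplex ℝ (Fin (n + 1))) :=
  Finsupp.single_mem_supported ℚ 1 fun i ↦ single_mem_stdSimplex ℝ i

theorem amap_affMap_stdChain {E : Type*} [NormedAddCommGroup E] [NormedSpace ℝ E] {n : ℕ}
    (v : AffSimp E n) : amap (affMap v) (stdChain n) = Finsupp.single ⟨n, v⟩ 1 := by
  rw [stdChain, amap_single]
  congr 2
  refine funext fun i ↦ ?_
  simp [affMap_apply, stdVert, Pi.single_apply]

theorem affMap_stdVert {n : ℕ} (t : Fin (n + 1) → ℝ) : affMap (stdVert n) t = t := by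
  rw [affMap_apply]
  exact (pi_eq_sum_univ' t).symm

section Singular

variable {X Y : Type*} [TopologicalSpace X] [TopologicalSpace Y]

open Classical in
/-- Extension of a singular simplex by a constant to the space of the standard simplex. -/
def Sing.ext0 {n : ℕ} (s : Sing X n) (p : Fin (n + 1) → ℝ) : X :=
  if h : p ∈ stdSimplex ℝ (Fin (n + 1)) then s.toFun ⟨p, h⟩ else s.toFun (stdSimplex.vertex 0)

theorem Sing.ext0_of_mem {n : ℕ} (s : Sing X n) {p : Fin (n + 1) → ℝ}
    (hp : p ∈ stdSimplex ℝ (Fin (n + 1))) : s.ext0 p = s.toFun ⟨p, hp⟩ :=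
  dif_pos hp

theorem Sing.ext0_coe {n : ℕ} (s : Sing X n) (p : stdSimplex ℝ (Fin (n + 1))) :
    s.ext0 p = s.toFun p :=
  dif_pos p.2

theorem Sing.continuousOn_ext0 {n : ℕ} (s : Sing X n) :
    ContinuousOn s.ext0 (stdSimplex ℝ (Fin (n + 1))) := by
  rw [continuousOn_iff_continuous_domRestrict]
  exact s.continuous_toFun.congr fun p ↦ (s.ext0_coe p).symm

theorem Sing.mapsTo_ext0 {n : ℕ} (s : Sing X n) {A : Set X} (hs : carrier ⟨n, s⟩ ⊆ A) :
    MapsTo s.ext0 (stdSimplex ℝ (Fin (n + 1))) A := by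
  intro p hp
  rw [s.ext0_of_mem hp]
  exact hs (mem_range_self _)

/-- Every singular simplex is the image of one universal affine simplex, so an operator that is
natural on affine chains extends to singular chains from its value on `stdChain`. -/
theorem push_ext0_stdChain {n : ℕ} (s : Sing X n) :
    push s.ext0 (aff (stdChain n)) = Finsupp.single ⟨n, s⟩ 1 := by
  have h : s.ext0 ∘ (affSing (stdVert n)).toFun = s.toFun := by
    refine funext fun t ↦ ?_
    simp only [affSing, Function.comp_apply, affMap_stdVert, s.ext0_coe]
  rw [stdChain, aff_single, push_single (by rw [h]; exact s.continuous_toFun)]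
  congr 3

end Singular

end SingularDuality

end

/-! ### Natural operators on affine chains: prisms and barycentric subdivision -/

noncomputable section

namespace SingularDuality

/-! ### Natural operators on affine chains -/

/-- A natural operator from the affine chains of `E` to the affine chains of `E × ℝ`. -/
structure NatOp where
  op : ∀ (E : Type) [NormedAddCommGroup E] [NormedSpace ℝ E],
    AffChains E →ₗ[ℚ] AffChains (E × ℝ)
  op_amap : ∀ {E F : Type} [NormedAddCommGroup E] [NormedSpace ℝ E] [NormedAddCommGroup F]
    [NormedSpace ℝ F] (L : E →L[ℝ] F) (a : AffChains E),
    op F (amap L a) = amap (Prod.map L id) (op E a)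
  op_mem : ∀ {E : Type} [NormedAddCommGroup E] [NormedSpace ℝ E] {Z : Set E}, Convex ℝ Z →
    ∀ {a : AffChains E}, a ∈ affIn Z → op E a ∈ affIn (Z ×ˢ Icc (0 : ℝ) 1)

/-- A natural operator which is an augmentation-preserving chain map. -/
structure NatOp.IsChainMap (f : NatOp) : Prop where
  bd_op : ∀ (E : Type) [NormedAddCommGroup E] [NormedSpace ℝ E] (a : AffChains E),
    bd _ (f.op E a) = f.op E (bd _ a)
  aug_op : ∀ (E : Type) [NormedAddCommGroup E] [NormedSpace ℝ E] (a : AffChains E),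
    aug _ (f.op E a) = aug _ a

/-- The inclusion of `E` at height `r`. -/
def level (r : ℝ) (hr : r ∈ Icc (0 : ℝ) 1) : NatOp where
  op _ _ _ := amap fun x ↦ (x, r)
  op_amap L a := by simp only [amap_amap]; rfl
  op_mem _ a ha := by
    exact amap_mem_affIn (fun _ hx ↦ mk_mem_prod hx hr) ha

theorem level_isChainMap (r : ℝ) (hr : r ∈ Icc (0 : ℝ) 1) : (level r hr).IsChainMap where
  bd_op _ _ _ a := (amap_bd _ a).symm
  aug_op _ _ _ a := aug_amap _ a

section Homotopy

variable (f g : NatOp) (E : Type) [NormedAddCommGroup E] [NormedSpace ℝ E]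

/-- The natural homotopy between two natural chain maps, on simplices. -/
def homotopyBasis : ∀ n, AffSimp E n → AffChains (E × ℝ)
  -- The barycenter makes the choice of apex natural under linear maps and keeps it in convex sets;
  -- any height in `[0, 1]` would do.
  | 0, v => cone (bary v, 1 / 2) (f.op E (.single ⟨0, v⟩ 1) - g.op E (.single ⟨0, v⟩ 1))
  | n + 1, v => cone (bary v, 1 / 2)
      (f.op E (.single ⟨n + 1, v⟩ 1) - g.op E (.single ⟨n + 1, v⟩ 1) -
        ∑ i : Fin (n + 2), (-1 : ℚ) ^ (i : ℕ) • homotopyBasis n (FaceMaps.face n i v))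

/-- The natural homotopy between two natural chain maps. -/
def homotopyLin : AffChains E →ₗ[ℚ] AffChains (E × ℝ) :=
  Finsupp.linearCombination ℚ fun s : Σ n, AffSimp E n ↦ homotopyBasis f g E s.1 s.2

theorem homotopyLin_single {n : ℕ} (v : AffSimp E n) :
    homotopyLin f g E (.single ⟨n, v⟩ 1) = cone (bary v, 1 / 2)
      (f.op E (.single ⟨n, v⟩ 1) - g.op E (.single ⟨n, v⟩ 1) -
        homotopyLin f g E (bd _ (.single ⟨n, v⟩ 1))) := by
  match n, v with
  | 0, v => rw [bd_single_zero, map_zero, sub_zero]; simp [homotopyLin, homotopyBasis]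
  | n + 1, v =>
    rw [bd_single_succ, map_sum]
    simp only [map_smul, homotopyLin, Finsupp.linearCombination_single, one_smul]
    rw [homotopyBasis]

theorem aug_homotopyLin (a : AffChains E) : aug _ (homotopyLin f g E a) = 0 := by
  suffices aug _ ∘ₗ homotopyLin f g E = 0 from LinearMap.congr_fun this a
  refine Finsupp.lhom_ext' fun ⟨n, s⟩ ↦ LinearMap.ext_ring ?_
  simp only [LinearMap.comp_apply, Finsupp.lsingle_apply, LinearMap.zero_apply]
  rw [homotopyLin_single, aug_cone]

variable {f g}

/-- Acyclic models: by induction on the dimension, `f - g - h ∘ ∂` applied to a simplex is a cycle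
of augmentation zero, so coning it off fills it. The filling is the value of `h` on the simplex. -/
theorem homotopyLin_bd (hf : f.IsChainMap) (hg : g.IsChainMap) (a : AffChains E) :
    bd _ (homotopyLin f g E a) + homotopyLin f g E (bd _ a) = f.op E a - g.op E a := by
  suffices H : ∀ n (v : AffSimp E n), bd _ (homotopyLin f g E (.single ⟨n, v⟩ 1)) +
      homotopyLin f g E (bd _ (.single ⟨n, v⟩ 1)) =
        f.op E (.single ⟨n, v⟩ 1) - g.op E (.single ⟨n, v⟩ 1) by
    suffices bd _ ∘ₗ homotopyLin f g E + homotopyLin f g E ∘ₗ bd _ = f.op E - g.op E from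
      LinearMap.congr_fun this a
    exact Finsupp.lhom_ext' fun ⟨n, v⟩ ↦ LinearMap.ext_ring (H n v)
  have key : ∀ n (v : AffSimp E n),
      bd _ (homotopyLin f g E (bd _ (.single ⟨n, v⟩ 1))) =
        f.op E (bd _ (.single ⟨n, v⟩ 1)) - g.op E (bd _ (.single ⟨n, v⟩ 1)) →
      bd _ (homotopyLin f g E (.single ⟨n, v⟩ 1)) +
        homotopyLin f g E (bd _ (.single ⟨n, v⟩ 1)) =
        f.op E (.single ⟨n, v⟩ 1) - g.op E (.single ⟨n, v⟩ 1) := by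
    intro n v h
    rw [homotopyLin_single, bd_cone]
    simp only [map_sub, h, hf.bd_op, hg.bd_op, aug_homotopyLin, hf.aug_op, hg.aug_op, sub_self,
      map_zero, zero_smul, sub_zero, sub_add_cancel]
  intro n
  induction n with
  | zero =>
    intro v
    refine key 0 v ?_
    simp only [bd_single_zero, map_zero, sub_zero]
  | succ n ih =>
    intro v
    refine key (n + 1) v ?_
    have : bd (AffSimp E) (.single ⟨n + 1, v⟩ 1) ∈ homog (AffSimp E) n :=
      bd_mem_homog (Finsupp.single_mem_supported ℚ 1 rfl)
    have h2 := eq_of_mem_supported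
      (f := bd _ ∘ₗ homotopyLin f g E + homotopyLin f g E ∘ₗ bd _) (g := f.op E - g.op E)
      (fun ⟨m, w⟩ hw ↦ by obtain rfl : m = n := hw; exact ih w) this
    simpa only [LinearMap.add_apply, LinearMap.sub_apply, LinearMap.comp_apply, bd_bd, map_zero, add_zero] using h2

end Homotopy

/-- The natural homotopy between two natural chain maps. -/
def homotopy (f g : NatOp) : NatOp where
  op E _ _ := homotopyLin f g E
  op_amap {E F} _ _ _ _ L a := by
    suffices H : ∀ n (v : AffSimp E n), homotopyLin f g F (amap L (.single ⟨n, v⟩ 1)) =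
        amap (Prod.map L id) (homotopyLin f g E (.single ⟨n, v⟩ 1)) by
      suffices homotopyLin f g F ∘ₗ amap L = amap (Prod.map L id) ∘ₗ homotopyLin f g E from
        LinearMap.congr_fun this a
      exact Finsupp.lhom_ext' fun ⟨n, v⟩ ↦ LinearMap.ext_ring (H n v)
    have key : ∀ n (v : AffSimp E n), homotopyLin f g F (bd _ (amap L (.single ⟨n, v⟩ 1))) =
          amap (Prod.map L id) (homotopyLin f g E (bd _ (.single ⟨n, v⟩ 1))) →
        homotopyLin f g F (amap L (.single ⟨n, v⟩ 1)) =
          amap (Prod.map L id) (homotopyLin f g E (.single ⟨n, v⟩ 1)) := by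
      intro n v h
      rw [homotopyLin_single, amap_cone]
      simp only [map_sub]
      rw [← h, ← f.op_amap, ← g.op_amap, amap_single, homotopyLin_single, map_sub, map_sub]
      have hb : Prod.map L id (bary v, (1 / 2 : ℝ)) = (bary (n := n) (L ∘ v), 1 / 2) :=
        Prod.ext (map_bary (L : E →ₗ[ℝ] F) v) rfl
      rw [hb]
    intro n
    induction n with
    | zero =>
      intro v
      refine key 0 v ?_
      rw [← amap_bd, bd_single_zero, map_zero, map_zero, map_zero, map_zero]
    | succ n ih =>
      intro v
      refine key (n + 1) v ?_
      have : bd (AffSimp E) (.single ⟨n + 1, v⟩ 1) ∈ homog (AffSimp E) n :=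
        bd_mem_homog (Finsupp.single_mem_supported ℚ 1 rfl)
      rw [← amap_bd]
      exact eq_of_mem_supported (f := homotopyLin f g F ∘ₗ amap L)
        (g := amap (Prod.map L id) ∘ₗ homotopyLin f g E)
        (fun ⟨m, w⟩ hw ↦ by obtain rfl : m = n := hw; exact ih w) this
  op_mem {E} _ _ Z hZ a ha := by
    have H : ∀ n (v : AffSimp E n), (∀ i, v i ∈ Z) →
        homotopyLin f g E (.single ⟨n, v⟩ 1) ∈ affIn (Z ×ˢ Icc (0 : ℝ) 1) := by
      have key : ∀ n (v : AffSimp E n), (∀ i, v i ∈ Z) →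
          homotopyLin f g E (bd _ (.single ⟨n, v⟩ 1)) ∈ affIn (Z ×ˢ Icc (0 : ℝ) 1) →
          homotopyLin f g E (.single ⟨n, v⟩ 1) ∈ affIn (Z ×ˢ Icc (0 : ℝ) 1) := by
        intro n v hv h
        have hs : Finsupp.single ⟨n, v⟩ 1 ∈ affIn Z := Finsupp.single_mem_supported ℚ 1 hv
        rw [homotopyLin_single]
        refine cone_mem_affIn (mk_mem_prod (bary_mem hZ hv) (by norm_num)) ?_
        exact sub_mem (sub_mem (f.op_mem hZ hs) (g.op_mem hZ hs)) h
      intro n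
      induction n with
      | zero =>
        intro v hv
        refine key 0 v hv ?_
        rw [bd_single_zero, map_zero]
        exact zero_mem _
      | succ n ih =>
        intro v hv
        refine key (n + 1) v hv ?_
        rw [bd_single_succ, map_sum]
        refine sum_mem fun i _ ↦ ?_
        rw [map_smul]
        exact Submodule.smul_mem _ _ (ih _ fun j ↦ hv _)
    exact map_mem_of_mem_supported (fun ⟨n, v⟩ hv ↦ H n v hv) ha

/-! ### Barycentric subdivision of affine chains -/

section Subdivision

variable (E : Type*) [AddCommGroup E] [Module ℝ E]

/-- The barycentric subdivision of an affine simplex. -/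
def sdBasis : ∀ n, AffSimp E n → AffChains E
  | 0, v => .single ⟨0, v⟩ 1
  | n + 1, v => cone (bary v)
      (∑ i : Fin (n + 2), (-1 : ℚ) ^ (i : ℕ) • sdBasis n (FaceMaps.face n i v))

/-- The barycentric subdivision of affine chains. -/
def sd : AffChains E →ₗ[ℚ] AffChains E :=
  Finsupp.linearCombination ℚ fun s : Σ n, AffSimp E n ↦ sdBasis E s.1 s.2

variable {E}

theorem sd_single_zero (v : AffSimp E 0) : sd E (.single ⟨0, v⟩ 1) = .single ⟨0, v⟩ 1 := by
  simp [sd, sdBasis]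

theorem sd_single_succ {n : ℕ} (v : AffSimp E (n + 1)) :
    sd E (.single ⟨n + 1, v⟩ 1) = cone (bary v) (sd E (bd _ (.single ⟨n + 1, v⟩ 1))) := by
  rw [bd_single_succ, map_sum]
  simp only [map_smul, sd, Finsupp.linearCombination_single, one_smul]
  rw [sdBasis]

theorem aug_sd (a : AffChains E) : aug _ (sd E a) = aug _ a := by
  suffices aug _ ∘ₗ sd E = aug _ from LinearMap.congr_fun this a
  refine Finsupp.lhom_ext' fun ⟨n, v⟩ ↦ LinearMap.ext_ring ?_
  simp only [LinearMap.comp_apply, Finsupp.lsingle_apply]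
  match n, v with
  | 0, v => rw [sd_single_zero]
  | n + 1, v => rw [sd_single_succ, aug_cone, aug_single_succ]

theorem bd_sd (a : AffChains E) : bd _ (sd E a) = sd E (bd _ a) := by
  suffices H : ∀ n (v : AffSimp E n), bd _ (sd E (.single ⟨n, v⟩ 1)) =
      sd E (bd _ (.single ⟨n, v⟩ 1)) by
    suffices bd _ ∘ₗ sd E = sd E ∘ₗ bd _ from LinearMap.congr_fun this a
    exact Finsupp.lhom_ext' fun ⟨n, v⟩ ↦ LinearMap.ext_ring (H n v)
  intro n
  induction n with
  | zero => intro v; rw [sd_single_zero, bd_single_zero, map_zero]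
  | succ n ih =>
    intro v
    have : bd (AffSimp E) (.single ⟨n + 1, v⟩ 1) ∈ homog (AffSimp E) n :=
      bd_mem_homog (Finsupp.single_mem_supported ℚ 1 rfl)
    have h2 := eq_of_mem_supported (f := bd _ ∘ₗ sd E) (g := sd E ∘ₗ bd _)
      (fun ⟨m, w⟩ hw ↦ by obtain rfl : m = n := hw; exact ih w) this
    simp only [LinearMap.comp_apply, bd_bd, map_zero] at h2
    -- The apex term of the cone formula disappears because a boundary has augmentation zero.
    rw [sd_single_succ, bd_cone, h2, aug_sd, aug_bd]
    simp

theorem sd_amap {F : Type*} [AddCommGroup F] [Module ℝ F] (L : E →ₗ[ℝ] F) (a : AffChains E) :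
    sd F (amap L a) = amap L (sd E a) := by
  suffices H : ∀ n (v : AffSimp E n), sd F (amap L (.single ⟨n, v⟩ 1)) =
      amap L (sd E (.single ⟨n, v⟩ 1)) by
    suffices sd F ∘ₗ amap L = amap L ∘ₗ sd E from LinearMap.congr_fun this a
    exact Finsupp.lhom_ext' fun ⟨n, v⟩ ↦ LinearMap.ext_ring (H n v)
  intro n
  induction n with
  | zero => intro v; rw [sd_single_zero, amap_single, sd_single_zero]
  | succ n ih =>
    intro v
    have : bd (AffSimp E) (.single ⟨n + 1, v⟩ 1) ∈ homog (AffSimp E) n :=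
      bd_mem_homog (Finsupp.single_mem_supported ℚ 1 rfl)
    have h2 := eq_of_mem_supported (f := sd F ∘ₗ amap L) (g := amap L ∘ₗ sd E)
      (fun ⟨m, w⟩ hw ↦ by obtain rfl : m = n := hw; exact ih w) this
    simp only [LinearMap.comp_apply] at h2
    rw [sd_single_succ, amap_cone, ← h2, amap_bd, amap_single, sd_single_succ]
    congr 2
    exact (map_bary L v).symm

theorem sd_mem {Z : Set E} (hZ : Convex ℝ Z) {a : AffChains E} (ha : a ∈ affIn Z) :
    sd E a ∈ affIn Z := by
  have H : ∀ n (v : AffSimp E n), (∀ i, v i ∈ Z) → sd E (.single ⟨n, v⟩ 1) ∈ affIn Z := by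
    intro n
    induction n with
    | zero =>
      intro v hv
      rw [sd_single_zero]
      exact Finsupp.single_mem_supported ℚ 1 hv
    | succ n ih =>
      intro v hv
      rw [sd_single_succ, bd_single_succ, map_sum]
      refine cone_mem_affIn (bary_mem hZ hv) (sum_mem fun i _ ↦ ?_)
      rw [map_smul]
      exact Submodule.smul_mem _ _ (ih _ fun j ↦ hv _)
  exact map_mem_of_mem_supported (fun ⟨n, v⟩ hv ↦ H n v hv) ha

end Subdivision

/-- Barycentric subdivision as a natural operator. -/
def sdOp : NatOp where
  op E _ _ := amap (fun x ↦ (x, 0)) ∘ₗ sd E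
  op_amap {E F} _ _ _ _ L a := by
    simp only [LinearMap.comp_apply]
    rw [show sd F (amap L a) = amap L (sd E a) from sd_amap (L : E →ₗ[ℝ] F) a, amap_amap,
      amap_amap]
    rfl
  op_mem hZ a ha := by
    change amap _ (sd _ a) ∈ _
    exact amap_mem_affIn (fun _ hx ↦ mk_mem_prod hx (by simp)) (sd_mem hZ ha)

theorem sdOp_isChainMap : sdOp.IsChainMap where
  bd_op E _ _ a := by simp only [sdOp, LinearMap.comp_apply, ← amap_bd, bd_sd]
  aug_op E _ _ a := by simp only [sdOp, LinearMap.comp_apply, aug_amap, aug_sd]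

section Mesh

variable {E : Type*} [NormedAddCommGroup E] [NormedSpace ℝ E]

/-- The difference between the barycenter and a vertex is an average of `n + 1` edge vectors, one of
which is zero; hence the factor `n / (n + 1)`. Balls are convex, so the bound for vertices extends
to the hull. -/
theorem dist_bary_le {n : ℕ} {v : AffSimp E n} {d : ℝ} (hd : ∀ i j, dist (v i) (v j) ≤ d)
    {p : E} (hp : p ∈ convexHull ℝ (range v)) : dist (bary v) p ≤ n / (n + 1) * d := by
  have h : range v ⊆ Metric.closedBall (bary v) (n / (n + 1) * d) := by
    rintro _ ⟨j, rfl⟩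
    rw [Metric.mem_closedBall, dist_comm, dist_eq_norm]
    have h1 : bary v - v j = (n + 1 : ℝ)⁻¹ • ∑ i, (v i - v j) := by
      rw [Finset.sum_sub_distrib, smul_sub, bary, Finset.sum_const, Finset.card_univ,
        Fintype.card_fin, ← Nat.cast_smul_eq_nsmul ℝ, smul_smul]
      push_cast
      rw [inv_mul_cancel₀ (by positivity), one_smul]
    rw [h1, norm_smul, norm_inv, Real.norm_of_nonneg (by positivity : (0 : ℝ) ≤ n + 1),
      div_mul_eq_mul_div, div_eq_inv_mul]
    gcongr
    rw [← Finset.add_sum_erase _ _ (Finset.mem_univ j), sub_self, zero_add]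
    refine (norm_sum_le_of_le _ fun i _ ↦ ((dist_eq_norm _ _).symm.trans_le (hd i j))).trans ?_
    simp
  rw [dist_comm]
  exact convexHull_min h (convex_closedBall _ _) hp

/-- The simplices of dimension `n` with vertices in `Z` at mutual distance at most `d`. -/
def fineSet (n : ℕ) (d : ℝ) (Z : Set E) : Set (Σ n, AffSimp E n) :=
  {s | s.1 = n ∧ (∀ i, s.2 i ∈ Z) ∧ ∀ i j, dist (s.2 i) (s.2 j) ≤ d}

/-- An edge of the subdivision either ends at the barycenter, where `dist_bary_le` applies, or lies
in a subdivided face, where the inductive factor `n / (n + 1)` is smaller than `(n + 1) / (n + 2)`.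
-/
theorem sd_single_mem_fineSet (n : ℕ) (v : AffSimp E n) {d : ℝ}
    (hd : ∀ i j, dist (v i) (v j) ≤ d) :
    sd E (.single ⟨n, v⟩ 1) ∈
      Finsupp.supported ℚ ℚ (fineSet n (n / (n + 1) * d) (convexHull ℝ (range v))) := by
  induction n with
  | zero =>
    rw [sd_single_zero]
    refine Finsupp.single_mem_supported ℚ 1
      ⟨rfl, fun i ↦ subset_convexHull ℝ _ (mem_range_self i), fun i j ↦ ?_⟩
    rw [Fin.fin_one_eq_zero i, Fin.fin_one_eq_zero j]
    simp
  | succ n ih =>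
    have hd0 : 0 ≤ d := dist_nonneg.trans (hd 0 0)
    rw [sd_single_succ, bd_single_succ, map_sum]
    have h : ∑ i : Fin (n + 2), sd E ((-1 : ℚ) ^ (i : ℕ) •
        .single ⟨n, FaceMaps.face n i v⟩ 1) ∈
        Finsupp.supported ℚ ℚ (fineSet n (n / (n + 1) * d) (convexHull ℝ (range v))) := by
      refine sum_mem fun i _ ↦ ?_
      rw [map_smul]
      refine Submodule.smul_mem _ _ (Finsupp.supported_mono ?_
        (ih (FaceMaps.face n i v) fun j k ↦ hd _ _))
      rintro s ⟨h1, h2, h3⟩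
      refine ⟨h1, fun j ↦ convexHull_mono ?_ (h2 j), h3⟩
      rintro _ ⟨j, rfl⟩
      exact mem_range_self _
    refine map_mem_of_mem_supported ?_ h
    rintro ⟨m, w⟩ ⟨h1, h2, h3⟩
    obtain rfl : m = n := h1
    rw [cone_single]
    have hb : ∀ i, dist (bary v) (w i) ≤ ((m + 1 : ℕ) : ℝ) / ((m + 1 : ℕ) + 1) * d :=
      fun i ↦ dist_bary_le hd (h2 i)
    refine Finsupp.single_mem_supported ℚ 1 ⟨rfl, fun i ↦ ?_, fun i j ↦ ?_⟩
    · refine Fin.cases ?_ (fun i ↦ ?_) i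
      · exact bary_mem (convex_convexHull ℝ _)
          fun i ↦ subset_convexHull ℝ _ (mem_range_self i)
      · exact h2 i
    · refine Fin.cases ?_ (fun i ↦ ?_) i <;> refine Fin.cases ?_ (fun j ↦ ?_) j
      · simp only [Fin.cons_zero, dist_self]
        positivity
      · exact hb j
      · rw [dist_comm]
        exact hb i
      · refine (h3 i j).trans ?_
        gcongr ?_ * d
        rw [div_le_div_iff₀ (by positivity) (by positivity)]
        push_cast
        nlinarith

theorem sd_iterate_mem_fineSet {Z : Set E} (hZ : Convex ℝ Z) (n k : ℕ) {d : ℝ} {a : AffChains E}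
    (ha : a ∈ Finsupp.supported ℚ ℚ (fineSet n d Z)) :
    (sd E)^[k] a ∈ Finsupp.supported ℚ ℚ (fineSet n ((n / (n + 1) : ℝ) ^ k * d) Z) := by
  induction k generalizing a d with
  | zero => simpa using ha
  | succ k ih =>
    rw [Function.iterate_succ_apply, pow_succ, mul_assoc]
    refine ih ?_
    refine map_mem_of_mem_supported ?_ ha
    rintro ⟨m, w⟩ ⟨h1, h2, h3⟩
    obtain rfl : m = n := h1
    refine Finsupp.supported_mono ?_ (sd_single_mem_fineSet m w h3)
    rintro s ⟨g1, g2, g3⟩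
    refine ⟨g1, fun i ↦ convexHull_min ?_ hZ (g2 i), g3⟩
    rintro _ ⟨i, rfl⟩
    exact h2 i

end Mesh

end SingularDuality

end

/-! ### Homotopy invariance and small simplices for singular chains -/

noncomputable section

namespace SingularDuality

/-! ### Natural operators on singular chains -/

section Transfer

variable {X Y : Type*} [TopologicalSpace X] [TopologicalSpace Y]

/-- The operator on singular chains given by a natural operator and a homotopy `H`. -/
def NatOp.sing (N : NatOp) (H : X × ℝ → Y) : Chains X →ₗ[ℚ] Chains Y :=
  Finsupp.linearCombination ℚ fun s : Σ n, Sing X n ↦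
    push (fun p : (Fin (s.1 + 1) → ℝ) × ℝ ↦ H (s.2.ext0 p.1, p.2)) (aff (N.op _ (stdChain s.1)))

theorem NatOp.sing_single (N : NatOp) (H : X × ℝ → Y) {n : ℕ} (s : Sing X n) :
    N.sing H (.single ⟨n, s⟩ 1) =
      push (fun p : (Fin (n + 1) → ℝ) × ℝ ↦ H (s.ext0 p.1, p.2)) (aff (N.op _ (stdChain n))) := by
  simp [NatOp.sing]

theorem convex_prod_Icc {E : Type*} [NormedAddCommGroup E] [NormedSpace ℝ E] {Z : Set E}
    (hZ : Convex ℝ Z) : Convex ℝ (Z ×ˢ Icc (0 : ℝ) 1) :=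
  hZ.prod (convex_Icc 0 1)

theorem NatOp.aff_op_mem (N : NatOp) {E : Type} [NormedAddCommGroup E] [NormedSpace ℝ E]
    {Z : Set E} (hZ : Convex ℝ Z) {a : AffChains E} (ha : a ∈ affIn Z) :
    aff (N.op E a) ∈ chainsIn (Z ×ˢ Icc (0 : ℝ) 1) :=
  aff_mem_chainsIn (convex_prod_Icc hZ) (N.op_mem hZ ha)

theorem aff_single_mem {n : ℕ} : aff (stdChain n) ∈ chainsIn (stdSimplex ℝ (Fin (n + 1))) :=
  aff_mem_chainsIn (convex_stdSimplex ℝ _) (stdChain_mem n)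

variable {A : Set X} {H : X × ℝ → Y}

theorem continuousOn_homotopy {E : Type*} [TopologicalSpace E] {Z : Set E} {f : E → X}
    (hH : ContinuousOn H (A ×ˢ Icc (0 : ℝ) 1)) (hf : ContinuousOn f Z) (hfA : MapsTo f Z A) :
    ContinuousOn (fun p : E × ℝ ↦ H (f p.1, p.2)) (Z ×ˢ Icc (0 : ℝ) 1) :=
  hH.comp ((hf.comp continuousOn_fst fun _ hp ↦ hp.1).prodMk continuousOn_snd)
    fun _ hp ↦ ⟨hfA hp.1, hp.2⟩

/-- Naturality enters here: each affine simplex is the linear image of the standard one, so the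
operator defined simplex by simplex agrees with the affine operator followed by a push-forward.
Applied to `bd _ (stdChain n)`, this transfers affine identities about boundaries. -/
theorem NatOp.sing_push (N : NatOp) {E : Type} [NormedAddCommGroup E] [NormedSpace ℝ E]
    {Z : Set E} (hZ : Convex ℝ Z) {f : E → X} (hf : ContinuousOn f Z) {a : AffChains E}
    (ha : a ∈ affIn Z) :
    N.sing H (push f (aff a)) = push (fun p : E × ℝ ↦ H (f p.1, p.2)) (aff (N.op E a)) := by
  refine eq_of_mem_supported (f := N.sing H ∘ₗ push f ∘ₗ aff)
    (g := push (fun p : E × ℝ ↦ H (f p.1, p.2)) ∘ₗ aff ∘ₗ N.op E) (fun ⟨n, v⟩ hv ↦ ?_) ha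
  simp only [LinearMap.comp_apply]
  rw [aff_single, push_single (continuous_comp_of_carrier hf (carrier_affSing hZ hv)),
    N.sing_single, ← amap_affMap_stdChain v, N.op_amap]
  have h1 : (Prod.map (affMap v) id : (Fin (n + 1) → ℝ) × ℝ → E × ℝ) =
      (affMap v).prodMap (ContinuousLinearMap.id ℝ ℝ) := rfl
  have h2 := N.aff_op_mem (convex_stdSimplex ℝ _) (stdChain_mem n)
  rw [h1, aff_amap, push_push (ContinuousLinearMap.continuous _).continuousOn h2]
  refine push_congr (fun p hp ↦ ?_) h2
  change H (_, _) = H (_, _)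
  rw [Sing.ext0_of_mem _ hp.1]
  rfl

theorem NatOp.sing_bd_single (N : NatOp) {n : ℕ} (s : Sing X n) :
    N.sing H (bd _ (.single ⟨n, s⟩ 1)) =
      push (fun p : (Fin (n + 1) → ℝ) × ℝ ↦ H (s.ext0 p.1, p.2))
        (aff (N.op _ (bd _ (stdChain n)))) := by
  rw [← push_ext0_stdChain s, push_bd s.continuousOn_ext0 aff_single_mem, ← aff_bd,
    N.sing_push (convex_stdSimplex ℝ _) s.continuousOn_ext0 (bd_mem_affIn (stdChain_mem n))]

theorem NatOp.bd_sing_single (N : NatOp) (hH : ContinuousOn H (A ×ˢ Icc (0 : ℝ) 1)) {n : ℕ}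
    (s : Sing X n) (hs : carrier ⟨n, s⟩ ⊆ A) :
    bd _ (N.sing H (.single ⟨n, s⟩ 1)) =
      push (fun p : (Fin (n + 1) → ℝ) × ℝ ↦ H (s.ext0 p.1, p.2))
        (aff (bd _ (N.op _ (stdChain n)))) := by
  rw [N.sing_single, push_bd (continuousOn_homotopy hH s.continuousOn_ext0 (s.mapsTo_ext0 hs))
    (N.aff_op_mem (convex_stdSimplex ℝ _) (stdChain_mem n)), aff_bd]

theorem homotopy_sing_bd {f g : NatOp} (hf : f.IsChainMap) (hg : g.IsChainMap)
    (hH : ContinuousOn H (A ×ˢ Icc (0 : ℝ) 1)) {c : Chains X} (hc : c ∈ chainsIn A) :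
    bd _ ((homotopy f g).sing H c) + (homotopy f g).sing H (bd _ c) =
      f.sing H c - g.sing H c := by
  refine eq_of_mem_supported
    (f := bd _ ∘ₗ (homotopy f g).sing H + (homotopy f g).sing H ∘ₗ bd _)
    (g := f.sing H - g.sing H) (fun ⟨n, s⟩ hs ↦ ?_) hc
  simp only [LinearMap.add_apply, LinearMap.comp_apply, LinearMap.sub_apply]
  rw [NatOp.bd_sing_single _ hH _ hs, NatOp.sing_bd_single, ← map_add, ← map_add,
    show bd _ ((homotopy f g).op _ (stdChain n)) + (homotopy f g).op _ (bd _ (stdChain n)) = _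
      from homotopyLin_bd _ hf hg (stdChain n), map_sub, map_sub, f.sing_single, g.sing_single]

theorem NatOp.IsChainMap.bd_sing {f : NatOp} (hf : f.IsChainMap)
    (hH : ContinuousOn H (A ×ˢ Icc (0 : ℝ) 1)) {c : Chains X} (hc : c ∈ chainsIn A) :
    bd _ (f.sing H c) = f.sing H (bd _ c) := by
  refine eq_of_mem_supported (f := bd _ ∘ₗ f.sing H) (g := f.sing H ∘ₗ bd _)
    (fun ⟨n, s⟩ hs ↦ ?_) hc
  simp only [LinearMap.comp_apply]
  rw [NatOp.bd_sing_single _ hH _ hs, NatOp.sing_bd_single, hf.bd_op]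

theorem NatOp.sing_mem_of_carrier (N : NatOp) (hH : ContinuousOn H (A ×ˢ Icc (0 : ℝ) 1))
    {B : Set Y} (hB : MapsTo H (A ×ˢ Icc (0 : ℝ) 1) B) {n : ℕ} {s : Sing X n}
    (hs : carrier ⟨n, s⟩ ⊆ A) : N.sing H (.single ⟨n, s⟩ 1) ∈ chainsIn B := by
  rw [N.sing_single]
  exact push_mem_chainsIn
    (continuousOn_homotopy hH s.continuousOn_ext0 (s.mapsTo_ext0 hs))
    (fun p hp ↦ hB ⟨s.mapsTo_ext0 hs hp.1, hp.2⟩)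
    (N.aff_op_mem (convex_stdSimplex ℝ _) (stdChain_mem n))

theorem NatOp.sing_mem (N : NatOp) (hH : ContinuousOn H (A ×ˢ Icc (0 : ℝ) 1)) {B : Set Y}
    (hB : MapsTo H (A ×ˢ Icc (0 : ℝ) 1) B) {c : Chains X} (hc : c ∈ chainsIn A) :
    N.sing H c ∈ chainsIn B :=
  map_mem_of_mem_supported (fun ⟨_, _⟩ hs ↦ N.sing_mem_of_carrier hH hB hs) hc

theorem level_sing {r : ℝ} (hr : r ∈ Icc (0 : ℝ) 1) (c : Chains X) :
    (level r hr).sing H c = push (fun x ↦ H (x, r)) c := by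
  refine eq_of_mem_supported (fun ⟨n, s⟩ _ ↦ ?_) (chainsIn_univ c)
  rw [NatOp.sing_single]
  have hcl : Continuous fun x : Fin (n + 1) → ℝ ↦ (x, r) := by fun_prop
  have h1 : aff (amap (fun x ↦ (x, r)) (stdChain n)) =
      push (fun x : Fin (n + 1) → ℝ ↦ (x, r)) (aff (stdChain n)) := by
    rw [stdChain, amap_single, aff_single, aff_single, push_single (hcl.comp
      (affSing (stdVert n)).continuous_toFun)]
    congr 2
    refine Sing.ext (funext fun t ↦ ?_)
    simp only [affSing, affMap_apply, Function.comp_apply]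
    refine Prod.ext ?_ ?_
    · simp [Prod.fst_sum]
    -- Barycentric coordinates sum to one, so an affine simplex with all vertices at height `r`
    -- stays at height `r`.
    · simp only [Prod.snd_sum, Prod.smul_snd, smul_eq_mul, ← Finset.sum_mul]
      rw [show ∑ i, t i = 1 from t.2.2, one_mul]
  change push _ (aff (amap _ _)) = _
  rw [h1, push_push hcl.continuousOn aff_single_mem, ← push_ext0_stdChain s,
    push_push s.continuousOn_ext0 aff_single_mem]
  rfl

/-- Homotopy invariance of singular homology, with control of supports. -/
theorem exists_homotopy (hH : ContinuousOn H (A ×ˢ Icc (0 : ℝ) 1)) :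
    ∃ D : Chains X →ₗ[ℚ] Chains Y,
      (∀ c ∈ chainsIn A, bd _ (D c) + D (bd _ c) =
        push (fun x ↦ H (x, 1)) c - push (fun x ↦ H (x, 0)) c) ∧
      ∀ A' ⊆ A, ∀ B, MapsTo H (A' ×ˢ Icc (0 : ℝ) 1) B → ∀ c ∈ chainsIn A', D c ∈ chainsIn B := by
  have h1 : (1 : ℝ) ∈ Icc (0 : ℝ) 1 := by simp
  have h0 : (0 : ℝ) ∈ Icc (0 : ℝ) 1 := by simp
  refine ⟨(homotopy (level 1 h1) (level 0 h0)).sing H, fun c hc ↦ ?_, fun A' hA B hB c hc ↦ ?_⟩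
  · rw [homotopy_sing_bd (level_isChainMap _ _) (level_isChainMap _ _) hH hc,
      level_sing h1, level_sing h0]
  · exact NatOp.sing_mem _ (hH.mono (prod_mono_left hA)) hB hc

end Transfer

/-! ### Subdivision of singular chains -/

section Subdivision

variable {X : Type*} [TopologicalSpace X]

/-- Barycentric subdivision of singular chains. -/
def subdiv : Chains X →ₗ[ℚ] Chains X := sdOp.sing Prod.fst

/-- The homotopy between the identity and barycentric subdivision. -/
def subdivHomotopy : Chains X →ₗ[ℚ] Chains X := (homotopy (level 0 (by simp)) sdOp).sing Prod.fst

theorem bd_subdiv (c : Chains X) : bd _ (subdiv c) = subdiv (bd _ c) :=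
  sdOp_isChainMap.bd_sing (A := univ) continuousOn_fst (chainsIn_univ c)

theorem subdivHomotopy_bd (c : Chains X) :
    bd _ (subdivHomotopy c) + subdivHomotopy (bd _ c) = c - subdiv c := by
  have := homotopy_sing_bd (level_isChainMap 0 (by simp)) sdOp_isChainMap (H := Prod.fst)
    (A := (univ : Set X)) continuousOn_fst (chainsIn_univ c)
  rw [level_sing (by simp),
    push_id (f := fun x ↦ (x, (0 : ℝ)).1) (A := univ) (fun _ _ ↦ rfl) (chainsIn_univ c)] at this
  exact this

theorem sing_fst_mem_chainsIn (N : NatOp) {A : Set X} {c : Chains X} (hc : c ∈ chainsIn A) :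
    N.sing Prod.fst c ∈ chainsIn A :=
  N.sing_mem continuousOn_fst (fun _ hp ↦ hp.1) hc

theorem chainsIn_le_smallChains {𝒰 : Set (Set X)} {U : Set X} (hU : U ∈ 𝒰) :
    chainsIn U ≤ smallChains 𝒰 :=
  Finsupp.supported_mono fun _ hs ↦ ⟨U, hU, hs⟩

theorem sing_fst_mem_smallChains (N : NatOp) {𝒰 : Set (Set X)} {c : Chains X}
    (hc : c ∈ smallChains 𝒰) : N.sing Prod.fst c ∈ smallChains 𝒰 := by
  refine map_mem_of_mem_supported (fun ⟨n, s⟩ ⟨U, hU, hs⟩ ↦ ?_) hc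
  have := N.sing_mem_of_carrier (H := Prod.fst) (B := U) continuousOn_fst (fun _ hp ↦ hp.1) hs
  exact chainsIn_le_smallChains hU this

theorem subdiv_push {E : Type} [NormedAddCommGroup E] [NormedSpace ℝ E]
    {Z : Set E} (hZ : Convex ℝ Z) {f : E → X} (hf : ContinuousOn f Z) {a : AffChains E}
    (ha : a ∈ affIn Z) : subdiv (push f (aff a)) = push f (aff (sd E a)) := by
  rw [subdiv, sdOp.sing_push hZ hf ha]
  change push _ (aff (amap _ (sd E a))) = _
  have hL : (fun x : E ↦ (x, (0 : ℝ))) = ContinuousLinearMap.inl ℝ E ℝ := rfl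
  rw [hL, aff_amap, push_push (ContinuousLinearMap.continuous _).continuousOn
    (aff_mem_chainsIn hZ (sd_mem hZ ha))]
  rfl

theorem iterate_subdiv_push {E : Type} [NormedAddCommGroup E] [NormedSpace ℝ E]
    {Z : Set E} (hZ : Convex ℝ Z) {f : E → X} (hf : ContinuousOn f Z) {a : AffChains E}
    (ha : a ∈ affIn Z) (k : ℕ) : subdiv^[k] (push f (aff a)) = push f (aff ((sd E)^[k] a)) := by
  induction k generalizing a with
  | zero => rfl
  | succ k ih =>
    rw [Function.iterate_succ_apply, Function.iterate_succ_apply, subdiv_push hZ hf ha,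
      ih (sd_mem hZ ha)]

/-- The cover pulls back to the compact standard simplex and has a Lebesgue number `δ` there;
subdivision shrinks the mesh geometrically, eventually below `δ`. -/
theorem exists_iterate_subdiv_single_mem {𝒰 : Set (Set X)} (h𝒰 : ∀ U ∈ 𝒰, IsOpen U) {n : ℕ}
    (s : Sing X n) (hs : carrier ⟨n, s⟩ ⊆ ⋃₀ 𝒰) :
    ∃ k, subdiv^[k] (.single ⟨n, s⟩ 1) ∈ smallChains 𝒰 := by
  obtain ⟨δ, hδ, hL⟩ := lebesgue_number_lemma_of_metric_sUnion
    (s := (univ : Set (stdSimplex ℝ (Fin (n + 1))))) (c := (s.toFun ⁻¹' ·) '' 𝒰)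
    isCompact_univ (by rintro _ ⟨U, hU, rfl⟩; exact (h𝒰 U hU).preimage s.continuous_toFun)
    (fun p _ ↦ by
      obtain ⟨U, hU, hp⟩ := hs (mem_range_self p)
      exact ⟨_, ⟨U, hU, rfl⟩, hp⟩)
  have hlim : Filter.Tendsto (fun k : ℕ ↦ (n / (n + 1) : ℝ) ^ k * 1) Filter.atTop (nhds 0) := by
    simpa using tendsto_pow_atTop_nhds_zero_of_lt_one (r := (n / (n + 1) : ℝ)) (by positivity)
      (by rw [div_lt_one (by positivity)]; linarith)
  obtain ⟨k, hk⟩ := (hlim.eventually (gt_mem_nhds hδ)).exists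
  refine ⟨k, ?_⟩
  rw [← push_ext0_stdChain s, iterate_subdiv_push (convex_stdSimplex ℝ _) s.continuousOn_ext0
    (stdChain_mem n)]
  -- In the sup metric the standard simplex has diameter at most one, which is the initial mesh.
  have hstd : stdChain n ∈ Finsupp.supported ℚ ℚ (fineSet n 1 (stdSimplex ℝ (Fin (n + 1)))) := by
    refine Finsupp.single_mem_supported ℚ 1
      ⟨rfl, fun i ↦ single_mem_stdSimplex ℝ i, fun i j ↦ ?_⟩
    exact (Metric.dist_le_diam_of_mem (bounded_stdSimplex _) (single_mem_stdSimplex ℝ i)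
      (single_mem_stdSimplex ℝ j)).trans (diam_stdSimplex_le)
  have hfine := sd_iterate_mem_fineSet (convex_stdSimplex ℝ _) n k hstd
  refine map_mem_of_mem_supported
    (f := push s.ext0 ∘ₗ aff) (fun ⟨m, v⟩ ⟨_, h2, h3⟩ ↦ ?_) hfine
  rw [LinearMap.comp_apply, aff_single, push_single (continuous_comp_of_carrier
    s.continuousOn_ext0 (carrier_affSing (convex_stdSimplex ℝ _) h2))]
  obtain ⟨_, ⟨U, hU, rfl⟩, hball⟩ := hL ⟨v 0, h2 0⟩ (mem_univ _)
  refine Finsupp.single_mem_supported ℚ 1 ⟨U, hU, ?_⟩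
  rintro _ ⟨t, rfl⟩
  have hmem := affMap_mem (convex_stdSimplex ℝ (Fin (n + 1))) h2 t.2
  have hmem2 : affMap v t ∈ Metric.ball (v 0) δ :=
    affMap_mem (convex_ball (v 0) δ) (fun i ↦ (h3 i 0).trans_lt hk) t.2
  have := @hball ⟨affMap v t, hmem⟩ hmem2
  change s.ext0 (affMap v t) ∈ U
  have e : s.ext0 (affMap v t) = _ := s.ext0_of_mem hmem
  rw [e]
  exact this

/-- Different simplices need different numbers of subdivisions. Smallness survives further
subdivision, so the chains that become small form a directed union of subspaces, and one number
serves a whole finite chain. -/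
theorem exists_iterate_subdiv_mem {𝒰 : Set (Set X)} (h𝒰 : ∀ U ∈ 𝒰, IsOpen U) {c : Chains X}
    (hc : c ∈ chainsIn (⋃₀ 𝒰)) : ∃ k, subdiv^[k] c ∈ smallChains 𝒰 := by
  have hpow : ∀ k (c : Chains X), subdiv^[k] c = (subdiv ^ k : Module.End ℚ (Chains X)) c :=
    fun k c ↦ (Module.End.pow_apply _ _ _).symm
  have hmono : ∀ {k l : ℕ} {c : Chains X}, k ≤ l → subdiv^[k] c ∈ smallChains 𝒰 →
      subdiv^[l] c ∈ smallChains 𝒰 := by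
    intro k l c hkl h
    induction l, hkl using Nat.le_induction with
    | base => exact h
    | succ l _ ih =>
      rw [Function.iterate_succ_apply']
      exact sing_fst_mem_smallChains _ ih
  have hle : chainsIn (⋃₀ 𝒰) ≤
      ⨆ k : ℕ, (smallChains 𝒰).comap (subdiv ^ k : Module.End ℚ (Chains X)) := by
    rw [chainsIn, Finsupp.supported_eq_span_single, Submodule.span_le]
    rintro _ ⟨⟨n, s⟩, hs, rfl⟩
    obtain ⟨k, hk⟩ := exists_iterate_subdiv_single_mem h𝒰 s hs
    refine Submodule.mem_iSup_of_mem k ?_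
    rw [hpow] at hk
    exact hk
  obtain ⟨k, hk⟩ := (Submodule.mem_iSup_of_directed _ (monotone_nat_of_le_succ
    (fun k c h ↦ by
      rw [Submodule.mem_comap, ← hpow] at h ⊢
      exact hmono k.le_succ h)).directed_le).mp (hle hc)
  exact ⟨k, by rw [hpow]; exact hk⟩

/-- The theorem of small simplices. -/
theorem exists_sub_bd_mem_smallChains {𝒰 : Set (Set X)} (h𝒰 : ∀ U ∈ 𝒰, IsOpen U) {c : Chains X}
    (hc : c ∈ chainsIn (⋃₀ 𝒰)) (hbd : bd _ c ∈ smallChains 𝒰) :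
    ∃ e ∈ chainsIn (⋃₀ 𝒰), c - bd _ e ∈ smallChains 𝒰 := by
  obtain ⟨k, hk⟩ := exists_iterate_subdiv_mem h𝒰 hc
  induction k generalizing c with
  | zero => exact ⟨0, zero_mem _, by simpa using hk⟩
  | succ k ih =>
    obtain ⟨e, he, h⟩ := ih (c := subdiv c) (sing_fst_mem_chainsIn _ hc)
      (by rw [bd_subdiv]; exact sing_fst_mem_smallChains _ hbd)
      (by rwa [Function.iterate_succ_apply] at hk)
    -- With `T` the subdivision homotopy, `c - ∂Tc` equals `subdiv c + T∂c`, and `T∂c` is small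
    -- because natural operators preserve smallness.
    refine ⟨e + subdivHomotopy c, add_mem he (sing_fst_mem_chainsIn _ hc), ?_⟩
    have h1 := subdivHomotopy_bd c
    have h2 : c - bd _ (e + subdivHomotopy c) =
        (subdiv c - bd _ e) + subdivHomotopy (bd _ c) := by
      rw [map_add, ← sub_eq_zero]
      rw [← sub_eq_zero] at h1
      rw [← neg_eq_zero, ← h1]
      abel
    rw [h2]
    exact add_mem h (sing_fst_mem_smallChains _ hbd)

/-- The theorem of small simplices for a pair of open sets. -/
theorem exists_split {A B : Set X} (hA : IsOpen A) (hB : IsOpen B) {c a b : Chains X}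
    (hc : c ∈ chainsIn (A ∪ B)) (ha : a ∈ chainsIn A) (hb : b ∈ chainsIn B)
    (hbd : bd _ c = a + b) :
    ∃ e ∈ chainsIn (A ∪ B), ∃ a' ∈ chainsIn A, ∃ b' ∈ chainsIn B, c = bd _ e + a' + b' := by
  have hU : ⋃₀ ({A, B} : Set (Set X)) = A ∪ B := by simp
  obtain ⟨e, he, h⟩ := exists_sub_bd_mem_smallChains (𝒰 := {A, B}) (by simp [hA, hB])
    (hU.symm ▸ hc) (mem_smallChains_pair.mpr ⟨a, ha, b, hb, hbd.symm⟩)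
  obtain ⟨a', ha', b', hb', h'⟩ := mem_smallChains_pair.mp h
  exact ⟨e, hU ▸ he, a', ha', b', hb', by rw [add_assoc, h']; abel⟩

end Subdivision

end SingularDuality

end

/-! ### Relative homology, excision and the local homology of Euclidean space -/

noncomputable section

namespace SingularDuality

/-! ### Relative null-homologous chains -/

section Relative

variable {X Y : Type*} [TopologicalSpace X] [TopologicalSpace Y]

/-- The chains which are null-homologous modulo a subset. -/
def nullRel (A : Set X) : Submodule ℚ (Chains X) := LinearMap.range (bd (Sing X)) ⊔ chainsIn A

theorem mem_nullRel {A : Set X} {c : Chains X} :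
    c ∈ nullRel A ↔ ∃ e, ∃ a ∈ chainsIn A, c = bd _ e + a := by
  rw [nullRel, Submodule.mem_sup]
  constructor
  · rintro ⟨_, ⟨e, rfl⟩, a, ha, rfl⟩
    exact ⟨e, a, ha, rfl⟩
  · rintro ⟨e, a, ha, rfl⟩
    exact ⟨_, ⟨e, rfl⟩, a, ha, rfl⟩

theorem bd_mem_nullRel (A : Set X) (e : Chains X) : bd _ e ∈ nullRel A :=
  mem_nullRel.mpr ⟨e, 0, zero_mem _, by simp⟩

theorem chainsIn_le_nullRel (A : Set X) : chainsIn A ≤ nullRel A := le_sup_right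

theorem nullRel_mono {A B : Set X} (h : A ⊆ B) : nullRel A ≤ nullRel B :=
  sup_le_sup_left (chainsIn_mono h) _

theorem proj_mem_nullRel {A : Set X} (k : ℕ) {c : Chains X} (hc : c ∈ nullRel A) :
    proj _ k c ∈ nullRel A := by
  obtain ⟨e, a, ha, rfl⟩ := mem_nullRel.mp hc
  rw [map_add, ← bd_proj_succ]
  exact add_mem (bd_mem_nullRel _ _) (chainsIn_le_nullRel _ (proj_mem_chainsIn k ha))

theorem bd_proj_mem_chainsIn {A : Set X} (k : ℕ) {c : Chains X} (hc : bd _ c ∈ chainsIn A) :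
    bd _ (proj _ k c) ∈ chainsIn A := by
  cases k with
  | zero => rw [bd_proj_zero]; exact zero_mem _
  | succ k => rw [bd_proj_succ]; exact proj_mem_chainsIn k hc

theorem push_mem_nullRel {f : X → Y} (hf : Continuous f) {A : Set X} {B : Set Y}
    (h : MapsTo f A B) {c : Chains X} (hc : c ∈ nullRel A) : push f c ∈ nullRel B := by
  obtain ⟨e, a, ha, rfl⟩ := mem_nullRel.mp hc
  rw [map_add, ← push_bd hf.continuousOn (chainsIn_univ e)]
  exact add_mem (bd_mem_nullRel _ _)
    (chainsIn_le_nullRel _ (push_mem_chainsIn hf.continuousOn h ha))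

/-- Homotopic maps of pairs agree on relative homology. -/
theorem push_sub_push_mem_nullRel {H : X × ℝ → Y} {W A : Set X} {B : Set Y}
    (hH : ContinuousOn H (W ×ˢ Icc (0 : ℝ) 1)) (hA : A ⊆ W)
    (hB : MapsTo H (A ×ˢ Icc (0 : ℝ) 1) B) {c : Chains X} (hc : c ∈ chainsIn W)
    (hbd : bd _ c ∈ chainsIn A) :
    push (fun x ↦ H (x, 1)) c - push (fun x ↦ H (x, 0)) c ∈ nullRel B := by
  obtain ⟨D, hD, hD'⟩ := exists_homotopy hH
  rw [← hD c hc]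
  exact add_mem (bd_mem_nullRel _ _) (chainsIn_le_nullRel _ (hD' A hA B hB _ hbd))

/-- Excision, injectivity. -/
theorem exists_eq_of_mem_nullRel {W K : Set X} (hW : IsOpen W) (hK : IsClosed K) (hKW : K ⊆ W)
    {c : Chains X} (hc : c ∈ chainsIn W) (h : c ∈ nullRel Kᶜ) :
    ∃ e ∈ chainsIn W, ∃ a ∈ chainsIn (W ∩ Kᶜ), c = bd _ e + a := by
  obtain ⟨e, a, ha, rfl⟩ := mem_nullRel.mp h
  have hU : W ∪ Kᶜ = univ := by
    rw [eq_univ_iff_forall]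
    intro x
    by_cases hx : x ∈ K
    exacts [Or.inl (hKW hx), Or.inr hx]
  -- The boundary of `e` is `c - a`, a sum of chains in `W` and in `Kᶜ`, so `e` splits accordingly
  -- up to a boundary. The part `e₂` in `Kᶜ` is absorbed into the error `a`.
  obtain ⟨f, -, e₁, he₁, e₂, he₂, rfl⟩ := exists_split (a := bd _ e + a) (b := -a) hW
    hK.isOpen_compl (hU ▸ chainsIn_univ e) hc (neg_mem ha) (by abel)
  refine ⟨e₁, he₁, bd _ e₂ + a, chainsIn_inter ?_ (add_mem (bd_mem_chainsIn he₂) ha), ?_⟩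
  · have := sub_mem hc (bd_mem_chainsIn he₁)
    simp only [map_add, bd_bd, zero_add] at this
    convert this using 1
    abel
  · simp only [map_add, bd_bd, zero_add, add_assoc]

/-- Excision, surjectivity. -/
theorem exists_excision {W K : Set X} (hW : IsOpen W) (hK : IsClosed K) (hKW : K ⊆ W)
    {c : Chains X} (h : bd _ c ∈ chainsIn Kᶜ) :
    ∃ c' ∈ chainsIn W, bd _ c' ∈ chainsIn (W ∩ Kᶜ) ∧ c - c' ∈ nullRel Kᶜ := by
  have hU : W ∪ Kᶜ = univ := by
    rw [eq_univ_iff_forall]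
    intro x
    by_cases hx : x ∈ K
    exacts [Or.inl (hKW hx), Or.inr hx]
  obtain ⟨f, -, e₁, he₁, e₂, he₂, rfl⟩ := exists_split (a := 0) hW
    hK.isOpen_compl (hU ▸ chainsIn_univ c) (zero_mem _) h (by abel)
  refine ⟨e₁, he₁, chainsIn_inter (bd_mem_chainsIn he₁) ?_, ?_⟩
  · have := sub_mem h (bd_mem_chainsIn he₂)
    simp only [map_add, bd_bd, zero_add] at this
    convert this using 1
    abel
  · have : bd _ f + e₁ + e₂ - e₁ = bd _ f + e₂ := by abel
    rw [this]
    exact add_mem (bd_mem_nullRel _ _) (chainsIn_le_nullRel _ he₂)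

/-- A subset with the homology of a point. -/
def IsAcyclicSet (S : Set X) : Prop :=
  S.Nonempty ∧ ∀ c ∈ chainsIn S, bd _ c = 0 → aug _ c = 0 → ∃ e ∈ chainsIn S, bd _ e = c

/-- A point as a singular chain. -/
def ptChain (x : X) : Chains X := .single ⟨0, ⟨fun _ ↦ x, continuous_const⟩⟩ 1

theorem ptChain_mem {A : Set X} {x : X} (hx : x ∈ A) : ptChain x ∈ chainsIn A :=
  Finsupp.single_mem_supported ℚ 1 (by rintro _ ⟨_, rfl⟩; exact hx)

theorem bd_ptChain (x : X) : bd _ (ptChain x) = 0 := bd_single_zero _ _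

theorem aug_ptChain (x : X) : aug _ (ptChain x) = 1 := aug_single_zero _

theorem ptChain_mem_homog (x : X) : ptChain x ∈ homog _ 0 := Finsupp.single_mem_supported ℚ 1 rfl

/-- `g` generates the homology modulo `A`, which is one-dimensional of degree `j`. -/
structure IsRelGen (A : Set X) (j : ℕ) (g : Chains X) : Prop where
  homog : g ∈ homog _ j
  bd_mem : bd _ g ∈ chainsIn A
  notMem : g ∉ nullRel A
  exists_smul : ∀ c, bd _ c ∈ chainsIn A → ∃ q : ℚ, c - q • g ∈ nullRel A

/-- The boundary of `g` bounds some `u` in the acyclic set `U`, and `g - u` is a cycle of the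
acyclic space. A multiple of a point corrects the augmentation, which matters in degree zero, and
the projection restores homogeneity. -/
theorem IsRelGen.exists_homologous {A U : Set X} {j : ℕ} {g : Chains X} (hg : IsRelGen A j g)
    (hX : IsAcyclicSet (univ : Set X)) (hU : IsAcyclicSet U) (hA : A ⊆ U) :
    ∃ u ∈ chainsIn U, u ∈ SingularDuality.homog _ j ∧ ∃ w, bd _ w = g - u := by
  obtain ⟨x, hx⟩ := hU.1
  obtain ⟨u, hu, hbd⟩ := hU.2 _ (chainsIn_mono hA hg.bd_mem) (bd_bd _) (aug_bd _)
  obtain ⟨w, -, hw⟩ := hX.2 (g - (u + (aug _ g - aug _ u) • ptChain x)) (chainsIn_univ _)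
    (by simp [hbd, bd_ptChain]) (by simp [aug_ptChain])
  refine ⟨proj _ j (u + (aug _ g - aug _ u) • ptChain x), proj_mem_chainsIn _
    (add_mem hu (Submodule.smul_mem _ _ (ptChain_mem hx))), proj_mem_homog _ _,
    proj _ (j + 1) w, ?_⟩
  rw [bd_proj_succ, hw, map_sub, proj_eq_self hg.homog]

/-- The Mayer–Vietoris step which raises the degree of a relative generator. -/
theorem IsRelGen.exists_union {U V : Set X} {j : ℕ} {g : Chains X}
    (hX : IsAcyclicSet (univ : Set X)) (hU : IsAcyclicSet U) (hV : IsAcyclicSet V)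
    (hUo : IsOpen U) (hVo : IsOpen V) (hg : IsRelGen (U ∩ V) j g) :
    ∃ g', IsRelGen (U ∪ V) (j + 1) g' := by
  obtain ⟨u, hu, huj, wu, hwu⟩ := hg.exists_homologous hX hU inter_subset_left
  obtain ⟨v, hv, hvj, wv, hwv⟩ := hg.exists_homologous hX hV inter_subset_right
  have hbdu : bd _ u = bd _ g := by
    have := congrArg (bd _) hwu
    rw [bd_bd, map_sub] at this
    exact (sub_eq_zero.mp this.symm).symm
  have hbdv : bd _ v = bd _ g := by
    have := congrArg (bd _) hwv
    rw [bd_bd, map_sub] at this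
    exact (sub_eq_zero.mp this.symm).symm
  -- The new generator inverts the connecting map: `u` and `v` represent `g` in `U` and in `V`, and
  -- `g'` fills their difference.
  obtain ⟨g', hg', hbd⟩ : ∃ g' ∈ SingularDuality.homog _ (j + 1), bd (Sing X) g' = u - v := by
    refine ⟨proj _ (j + 1) (wv - wu), proj_mem_homog _ _, ?_⟩
    rw [bd_proj_succ, map_sub, hwu, hwv, sub_sub_sub_cancel_left,
      proj_eq_self (sub_mem huj hvj)]
  refine ⟨g', hg', ?_, fun h ↦ ?_, fun c hc ↦ ?_⟩
  · rw [hbd]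
    exact sub_mem (chainsIn_mono subset_union_left hu) (chainsIn_mono subset_union_right hv)
  -- If `g'` were null, then `u - v` would bound in `U ∪ V`. Splitting that filling pushes `u` into
  -- `U ∩ V` modulo a boundary, which makes `g` null.
  · obtain ⟨e, a, ha, hea⟩ := mem_nullRel.mp h
    have hbda : bd _ a = u + -v := by
      rw [← sub_eq_add_neg, ← hbd, hea, map_add, bd_bd, zero_add]
    obtain ⟨f, -, a₁, ha₁, a₂, ha₂, rfl⟩ := exists_split hUo hVo ha hu (neg_mem hv) hbda
    rw [map_add, map_add, bd_bd, zero_add] at hbda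
    have h2 : u - bd _ a₁ ∈ chainsIn (U ∩ V) := by
      refine chainsIn_inter (sub_mem hu (bd_mem_chainsIn ha₁)) ?_
      have : u - bd _ a₁ = bd _ a₂ + v := by
        rw [sub_eq_iff_eq_add, ← sub_eq_zero]
        rw [← sub_eq_zero] at hbda
        rw [← neg_eq_zero, ← hbda]
        abel
      rw [this]
      exact add_mem (bd_mem_chainsIn ha₂) hv
    refine hg.notMem (mem_nullRel.mpr ⟨wu + a₁, _, h2, ?_⟩)
    rw [map_add, hwu]
    abel
  -- Conversely, `∂c` splits into `a` in `U` and `b` in `V`. Since `∂a = -∂b` lies in `U ∩ V`, the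
  -- chain `a` is a relative cycle there and hence a multiple `q` of `g`.
  · obtain ⟨f, hf, a, ha, b, hb, hab⟩ := exists_split hUo hVo hc (zero_mem _) (zero_mem _)
      (by rw [bd_bd, add_zero])
    have hbdab : bd _ a = -bd _ b := by
      have := congrArg (bd _) hab
      rw [bd_bd, map_add, map_add, bd_bd, zero_add] at this
      exact eq_neg_of_add_eq_zero_left this.symm
    obtain ⟨q, hq⟩ := hg.exists_smul a (chainsIn_inter (bd_mem_chainsIn ha)
      (hbdab ▸ neg_mem (bd_mem_chainsIn hb)))
    obtain ⟨e, r, hr, her⟩ := mem_nullRel.mp hq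
    have haug : aug _ a + aug _ b = 0 := by
      have := congrArg (aug _) hab
      rw [aug_bd, map_add, map_add, aug_bd, zero_add] at this
      exact this.symm
    have h1 : a - q • u - r = bd _ (e + q • wu) := by
      rw [map_add, map_smul, hwu, smul_sub]
      rw [sub_eq_iff_eq_add] at her
      rw [her]
      abel
    have hbr : bd _ r = bd _ a - q • bd _ g := by
      have := congrArg (bd _) her
      rw [map_sub, map_add, bd_bd, zero_add, map_smul] at this
      exact this.symm
    -- The error `r` in `U ∩ V` is shifted from `a` to `b`; both corrected chains are then cycles of
    -- augmentation zero and bound in `U` and in `V`.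
    obtain ⟨x, hx, hbx⟩ := hU.2 (a - q • u - r)
      (sub_mem (sub_mem ha (Submodule.smul_mem _ _ hu)) (chainsIn_mono inter_subset_left hr))
      (by rw [h1, bd_bd]) (by rw [h1, aug_bd])
    have haugu : aug _ u = aug _ g := by
      have := congrArg (aug _) hwu
      rw [aug_bd, map_sub] at this
      exact (sub_eq_zero.mp this.symm).symm
    have haugv : aug _ v = aug _ g := by
      have := congrArg (aug _) hwv
      rw [aug_bd, map_sub] at this
      exact (sub_eq_zero.mp this.symm).symm
    have haugr : aug _ r = aug _ a - q * aug _ g := by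
      have := congrArg (aug _) h1
      rw [aug_bd, map_sub, map_sub, map_smul, haugu, smul_eq_mul] at this
      linarith
    obtain ⟨y, hy, hby⟩ := hV.2 (b + q • v + r)
      (add_mem (add_mem hb (Submodule.smul_mem _ _ hv)) (chainsIn_mono inter_subset_right hr))
      (by rw [map_add, map_add, hbr, map_smul, hbdv, hbdab]; abel)
      (by rw [map_add, map_add, haugr, map_smul, haugv, smul_eq_mul]; linarith)
    obtain ⟨p, hp⟩ := hU.1
    -- After all corrections an absolute cycle remains, which bounds once its augmentation is
    -- removed by a point.
    set m := c - q • g' - f - x - y with hm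
    obtain ⟨z, -, hz⟩ := hX.2 (m - aug _ m • ptChain p) (chainsIn_univ _)
      (by
        rw [map_sub, map_smul, bd_ptChain, smul_zero, sub_zero, hm]
        simp only [map_sub, map_smul, hbd, hbx, hby, hab, smul_sub]
        abel)
      (by simp [aug_ptChain])
    refine ⟨q, mem_nullRel.mpr ⟨z, f + x + y + aug _ m • ptChain p, ?_, ?_⟩⟩
    · refine add_mem (add_mem (add_mem ?_ ?_) ?_) ?_
      · exact hf
      · exact chainsIn_mono subset_union_left hx
      · exact chainsIn_mono subset_union_right hy
      · exact Submodule.smul_mem _ _ (chainsIn_mono subset_union_left (ptChain_mem hp))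
    · rw [hz, hm]
      abel

end Relative

/-! ### Star-shaped sets -/

section Star

section

variable {E : Type*}

/-- The map of singular chains to chains of affine simplices with all vertices equal to `p`. -/
def constChain {X : Type*} [TopologicalSpace X] (p : E) : Chains X →ₗ[ℚ] AffChains E :=
  Finsupp.linearCombination ℚ fun s : Σ n, Sing X n ↦ .single ⟨s.1, fun _ ↦ p⟩ 1

variable {X : Type*} [TopologicalSpace X]

theorem constChain_single (p : E) (s : Σ n, Sing X n) :
    constChain p (.single s 1) = .single ⟨s.1, fun _ ↦ p⟩ 1 := by
  simp [constChain]

theorem constChain_bd (p : E) (c : Chains X) : constChain p (bd _ c) = bd _ (constChain p c) := by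
  suffices constChain p ∘ₗ bd _ = bd _ ∘ₗ constChain p from LinearMap.congr_fun this c
  refine Finsupp.lhom_ext' fun ⟨n, s⟩ ↦ LinearMap.ext_ring ?_
  simp only [LinearMap.comp_apply, Finsupp.lsingle_apply, constChain_single]
  match n, s with
  | 0, s => rw [bd_single_zero, bd_single_zero, map_zero]
  | n + 1, s =>
    rw [bd_single_succ, bd_single_succ, map_sum]
    refine Finset.sum_congr rfl fun i _ ↦ ?_
    rw [map_smul, constChain_single]
    rfl

theorem aug_constChain (p : E) (c : Chains X) : aug _ (constChain p c) = aug _ c := by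
  suffices aug _ ∘ₗ constChain p = aug _ from LinearMap.congr_fun this c
  refine Finsupp.lhom_ext' fun s ↦ LinearMap.ext_ring ?_
  simp only [LinearMap.comp_apply, Finsupp.lsingle_apply, constChain_single]
  simp [aug]

theorem constChain_mem (p : E) (c : Chains X) : constChain p c ∈ affIn {p} := by
  refine map_mem_of_mem_supported (fun s _ ↦ ?_) (chainsIn_univ c)
  rw [constChain_single]
  exact Finsupp.single_mem_supported ℚ 1 fun _ ↦ rfl

end

variable {E : Type*} [NormedAddCommGroup E] [NormedSpace ℝ E] {X : Type*} [TopologicalSpace X]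

theorem aff_constChain (p : E) (c : Chains X) : aff (constChain p c) = push (fun _ ↦ p) c := by
  refine eq_of_mem_supported (f := aff ∘ₗ constChain p) (fun s _ ↦ ?_) (chainsIn_univ c)
  rw [LinearMap.comp_apply, constChain_single, aff_single,
    push_single (by exact continuous_const)]
  congr 2
  refine Sing.ext (funext fun t ↦ ?_)
  simp only [affSing, affMap_apply, ← Finset.sum_smul, Function.comp_apply]
  rw [show ∑ i, t i = 1 from t.2.2, one_smul]

/-- The straight-line contraction reduces a cycle to constant simplices at `p`. These are not zero
as chains, but they are realized affine simplices with all vertices at `p`, so the cone from `p`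
bounds them. -/
theorem isAcyclicSet_of_starConvex {S : Set E} {p : E} (hS : StarConvex ℝ p S) (hp : p ∈ S) :
    IsAcyclicSet S := by
  refine ⟨⟨p, hp⟩, fun c hc hbd haug ↦ ?_⟩
  have hH : Continuous fun x : E × ℝ ↦ (1 - x.2) • p + x.2 • x.1 := by fun_prop
  obtain ⟨D, hD, hD'⟩ := exists_homotopy (A := S) hH.continuousOn
  have h1 := hD c hc
  have h2 : push (fun x ↦ (1 - (1 : ℝ)) • p + (1 : ℝ) • x) c = c :=
    push_id (fun x _ ↦ by simp) hc
  have h3 : push (fun x ↦ (1 - (0 : ℝ)) • p + (0 : ℝ) • x) c =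
      bd _ (aff (cone p (constChain p c))) := by
    rw [← aff_bd, bd_cone, ← constChain_bd, hbd, aug_constChain, haug, map_zero, map_zero,
      zero_smul, sub_zero]
    refine (push_congr (fun x _ ↦ by simp) hc).trans
      ((aff_constChain p c).symm.trans (congrArg aff (by rw [sub_zero, sub_zero])))
  refine ⟨D c + aff (cone p (constChain p c)), add_mem (hD' S subset_rfl S ?_ c hc) ?_, ?_⟩
  · rintro ⟨x, t⟩ ⟨hx, ht⟩
    exact hS hx (by linarith [ht.2]) ht.1 (by ring)
  · exact chainsIn_mono (singleton_subset_iff.mpr hp) (aff_mem_chainsIn (convex_singleton p)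
      (cone_mem_affIn (mem_singleton p) (constChain_mem p c)))
  · rw [hbd, map_zero, add_zero, h2, h3] at h1
    rw [map_add, h1]
    abel

/-- A relative cycle modulo the complement of a bounded star-shaped set is null-homologous if it
is so modulo the complement of the center. -/
theorem mem_nullRel_of_starConvex {K : Set E} {p : E} (hK : StarConvex ℝ p K)
    (hb : Bornology.IsBounded K) {c : Chains E} (hbd : bd _ c ∈ chainsIn Kᶜ)
    (h : c ∈ nullRel {p}ᶜ) : c ∈ nullRel Kᶜ := by
  obtain ⟨e, a, ha, rfl⟩ := mem_nullRel.mp h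
  obtain ⟨C, hC, haC, hmin⟩ := exists_isCompact_chainsIn a
  obtain ⟨ε, hε, hball⟩ := Metric.isOpen_iff.mp hC.isClosed.isOpen_compl p
    fun hpC ↦ hmin _ ha hpC rfl
  obtain ⟨B, hB⟩ := hb.subset_closedBall p
  -- The dilation by `1 + R` about `p` moves points at distance at least `ε` to distance at least `ε
  -- + |B|`, hence off `K`. Dilations by factors at least one preserve `Kᶜ` because `K` is
  -- star-shaped.
  set R : ℝ := |B| / ε with hR
  have hR0 : 0 ≤ R := by positivity
  have hH : Continuous fun x : E × ℝ ↦ p + (1 + x.2 * R) • (x.1 - p) := by fun_prop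
  have h1 := push_sub_push_mem_nullRel (W := univ) (A := Kᶜ) (B := Kᶜ) hH.continuousOn
    (subset_univ _) ?_ (chainsIn_univ (bd _ e + a)) hbd
  · have h2 : push (fun x ↦ p + (1 + (0 : ℝ) * R) • (x - p)) (bd _ e + a) = bd _ e + a :=
      push_id (A := univ) (fun x _ ↦ by simp) (chainsIn_univ _)
    rw [h2] at h1
    refine (Submodule.sub_mem_iff_right _ ?_).mp h1
    have hcont : Continuous fun x : E ↦ p + (1 + (1 : ℝ) * R) • (x - p) := by fun_prop
    rw [map_add, ← push_bd hcont.continuousOn (chainsIn_univ e)]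
    refine add_mem (bd_mem_nullRel _ _) (chainsIn_le_nullRel _
      (push_mem_chainsIn (A := C) (B := Kᶜ) hcont.continuousOn (fun x hx hxK ↦ ?_) haC))
    have hd : ε ≤ ‖x - p‖ := by
      by_contra! hlt
      exact hball (mem_ball_iff_norm.mpr hlt) hx
    have := mem_closedBall_iff_norm.mp (hB hxK)
    rw [add_sub_cancel_left, norm_smul, Real.norm_of_nonneg (by positivity)] at this
    have h3 : |B| + ε ≤ (1 + 1 * R) * ‖x - p‖ := by
      have h4 : |B| + ε = (1 + 1 * R) * ε := by rw [hR]; field_simp; ring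
      rw [h4]
      gcongr
    linarith [le_abs_self B]
  · rintro ⟨x, t⟩ ⟨hx, ht⟩ hxK
    refine hx ?_
    have hs : (1 : ℝ) ≤ 1 + t * R := by nlinarith [ht.1]
    have := hK.add_smul_sub_mem hxK (t := (1 + t * R)⁻¹) (by positivity)
      (inv_le_one_of_one_le₀ hs)
    simpa [smul_smul, inv_mul_cancel₀ (by positivity : 1 + t * R ≠ 0)] using this

end Star

/-! ### The local homology of Euclidean space -/

section Euclidean

/-- The complement of a coordinate subspace of codimension `j`. -/
def coordCompl (n j : ℕ) : Set (EuclideanSpace ℝ (Fin n)) := {x | ∃ i : Fin n, (i : ℕ) < j ∧ x i ≠ 0}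

theorem isOpen_coordCompl (n j : ℕ) : IsOpen (coordCompl n j) := by
  have : coordCompl n j = ⋃ (i : Fin n) (_ : (i : ℕ) < j), {x | x i ≠ 0} := by
    ext x
    simp [coordCompl]
  rw [this]
  refine isOpen_iUnion fun i ↦ isOpen_iUnion fun _ ↦ isOpen_ne_fun (by fun_prop) continuous_const

/-- Star-shaped about `σ e_j`: the first `j` coordinates of the center vanish, so the segment
towards it only rescales them, while positivity of `σ x_j` persists. -/
theorem isAcyclicSet_half {n : ℕ} (j : Fin n) (σ : ℝ) (hσ : σ ≠ 0) :
    IsAcyclicSet (coordCompl n j ∪ {x | 0 < σ * x j}) := by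
  have hp : EuclideanSpace.single j σ ∈ coordCompl n j ∪ {x | 0 < σ * x j} := by
    right
    simpa using mul_self_pos.mpr hσ
  refine isAcyclicSet_of_starConvex (p := EuclideanSpace.single j σ) ?_ hp
  intro x hx a b ha hb hab
  rcases hb.eq_or_lt with rfl | hb
  · rw [add_zero] at hab
    simpa [hab] using hp
  rcases hx with ⟨i, hij, hi⟩ | hx
  · left
    refine ⟨i, hij, ?_⟩
    have : i ≠ j := by rintro rfl; exact lt_irrefl _ hij
    simpa [this] using ⟨hb.ne', hi⟩
  · right
    have h1 := mul_self_pos.mpr hσ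
    have h2 : (0 : ℝ) < σ * x j := hx
    simp only [mem_ofPred_eq, PiLp.add_apply, PiLp.smul_apply, PiLp.single_apply,
      if_pos, smul_eq_mul]
    nlinarith [mul_pos hb h2, mul_nonneg ha h1.le]

/-- Adding the half-spaces `x_j > 0` and `x_j < 0` to the complement in codimension `j` gives two
acyclic open sets. They meet in that complement, and their union is the one in codimension `j + 1`;
so Mayer–Vietoris raises the degree by one. The start is `H₀` of the contractible space modulo the
empty set. -/
theorem exists_isRelGen_coordCompl (n : ℕ) :
    ∀ j ≤ n, ∃ g, IsRelGen (coordCompl n j) j g := by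
  have hX : IsAcyclicSet (univ : Set (EuclideanSpace ℝ (Fin n))) :=
    isAcyclicSet_of_starConvex (starConvex_univ 0) (mem_univ _)
  intro j
  induction j with
  | zero =>
    intro _
    have hempty : coordCompl n 0 = ∅ := by simp [coordCompl]
    rw [hempty]
    refine ⟨ptChain 0, ptChain_mem_homog 0, by rw [bd_ptChain]; exact zero_mem _, fun h ↦ ?_,
      fun c hc ↦ ⟨aug _ c, ?_⟩⟩
    · obtain ⟨e, a, ha, h⟩ := mem_nullRel.mp h
      have := congrArg (aug _) h
      rw [chainsIn_empty ha, aug_ptChain, add_zero, aug_bd] at this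
      exact one_ne_zero this
    · obtain ⟨e, -, he⟩ := hX.2 (c - aug _ c • ptChain 0) (chainsIn_univ _)
        (by rw [map_sub, chainsIn_empty hc, map_smul, bd_ptChain]; simp)
        (by simp [aug_ptChain])
      rw [← he]
      exact bd_mem_nullRel _ _
  | succ j ih =>
    intro hj
    obtain ⟨g, hg⟩ := ih (by omega)
    have hlt : ∀ σ : ℝ, IsOpen {x : EuclideanSpace ℝ (Fin n) | 0 < σ * x ⟨j, hj⟩} := fun σ ↦
      isOpen_lt continuous_const (by fun_prop)
    have h1 : coordCompl n j = (coordCompl n j ∪ {x | 0 < (1 : ℝ) * x ⟨j, hj⟩}) ∩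
        (coordCompl n j ∪ {x | 0 < (-1 : ℝ) * x ⟨j, hj⟩}) := by
      rw [← union_inter_distrib_left]
      refine (union_eq_self_of_subset_right ?_).symm
      rintro x ⟨hx, hx'⟩
      simp only [mem_ofPred_eq] at hx hx'
      linarith
    have h2 : coordCompl n (j + 1) = (coordCompl n j ∪ {x | 0 < (1 : ℝ) * x ⟨j, hj⟩}) ∪
        (coordCompl n j ∪ {x | 0 < (-1 : ℝ) * x ⟨j, hj⟩}) := by
      ext x
      simp only [coordCompl, mem_ofPred_eq, mem_union]
      constructor
      · rintro ⟨i, hi, hxi⟩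
        by_cases hij : (i : ℕ) < j
        · exact Or.inl (Or.inl ⟨i, hij, hxi⟩)
        · obtain rfl : i = ⟨j, hj⟩ := Fin.ext (by simp; omega)
          rcases lt_or_gt_of_ne hxi with h | h
          · exact Or.inr (Or.inr (by linarith))
          · exact Or.inl (Or.inr (by linarith))
      · rintro ((⟨i, hi, hxi⟩ | h) | (⟨i, hi, hxi⟩ | h))
        · exact ⟨i, by omega, hxi⟩
        · exact ⟨⟨j, hj⟩, by simp, by intro h0; rw [h0] at h; simp at h⟩
        · exact ⟨i, by omega, hxi⟩
        · exact ⟨⟨j, hj⟩, by simp, by intro h0; rw [h0] at h; simp at h⟩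
    rw [h1] at hg
    rw [h2]
    exact hg.exists_union hX (isAcyclicSet_half ⟨j, hj⟩ 1 one_ne_zero)
      (isAcyclicSet_half ⟨j, hj⟩ (-1) (by norm_num)) ((isOpen_coordCompl n j).union (hlt 1))
      ((isOpen_coordCompl n j).union (hlt (-1)))

theorem exists_isRelGen (n : ℕ) : ∃ g, IsRelGen ({0}ᶜ : Set (EuclideanSpace ℝ (Fin n))) n g := by
  have : coordCompl n n = {0}ᶜ := by
    ext x
    simp only [coordCompl, mem_ofPred_eq, Fin.is_lt, true_and, mem_compl_iff, mem_singleton_iff]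
    rw [← not_forall, not_iff_not]
    exact ⟨fun h ↦ PiLp.ext h, fun h i ↦ by simp [h]⟩
  exact this ▸ exists_isRelGen_coordCompl n n le_rfl

end Euclidean

end SingularDuality

end

/-! ### The local degree and its invariance under maps of positive Jacobian -/

noncomputable section

namespace SingularDuality

/-! ### The local degree in Euclidean space -/

section Degree

variable (n : ℕ)

/-- A generator of the local homology of `ℝⁿ` at the origin. -/
def originGen : Chains (EuclideanSpace ℝ (Fin n)) := (exists_isRelGen n).choose

theorem isRelGen_originGen : IsRelGen {0}ᶜ n (originGen n) := (exists_isRelGen n).choose_spec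

/-- Over a field a vector outside a subspace is separated from it by a functional. The degree
thereby becomes linear on all chains, although it carries information only on relative cycles. -/
theorem exists_originDeg : ∃ f : Chains (EuclideanSpace ℝ (Fin n)) →ₗ[ℚ] ℚ,
    f (originGen n) = 1 ∧ ∀ c ∈ nullRel {0}ᶜ, f c = 0 := by
  obtain ⟨f, hf, hle⟩ := Submodule.exists_le_ker_of_notMem (isRelGen_originGen n).notMem
  exact ⟨(f (originGen n))⁻¹ • f, inv_mul_cancel₀ hf, fun c hc ↦ by
    rw [LinearMap.smul_apply, LinearMap.mem_ker.mp (hle hc), smul_zero]⟩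

/-- The degree at the origin of a relative cycle modulo the complement of the origin. -/
def originDeg : Chains (EuclideanSpace ℝ (Fin n)) →ₗ[ℚ] ℚ := (exists_originDeg n).choose

theorem originDeg_originGen : originDeg n (originGen n) = 1 := (exists_originDeg n).choose_spec.1

variable {n}

theorem originDeg_eq_zero {c : Chains (EuclideanSpace ℝ (Fin n))} (hc : c ∈ nullRel {0}ᶜ) :
    originDeg n c = 0 :=
  (exists_originDeg n).choose_spec.2 c hc

theorem originDeg_eq_of_sub_mem {c d : Chains (EuclideanSpace ℝ (Fin n))}
    (h : c - d ∈ nullRel {0}ᶜ) : originDeg n c = originDeg n d := by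
  rw [← sub_eq_zero, ← map_sub, originDeg_eq_zero h]

theorem sub_originDeg_smul_mem {c : Chains (EuclideanSpace ℝ (Fin n))}
    (hc : bd _ c ∈ chainsIn {0}ᶜ) : c - originDeg n c • originGen n ∈ nullRel {0}ᶜ := by
  obtain ⟨q, hq⟩ := (isRelGen_originGen n).exists_smul c hc
  have := originDeg_eq_of_sub_mem hq
  rw [map_smul, originDeg_originGen, smul_eq_mul, mul_one] at this
  rwa [this]

theorem mem_nullRel_of_originDeg {c : Chains (EuclideanSpace ℝ (Fin n))}
    (hc : bd _ c ∈ chainsIn {0}ᶜ) (h : originDeg n c = 0) : c ∈ nullRel {0}ᶜ := by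
  simpa [h] using sub_originDeg_smul_mem hc

theorem originDeg_of_homog {k : ℕ} (hk : k ≠ n) {c : Chains (EuclideanSpace ℝ (Fin n))}
    (hc : bd _ c ∈ chainsIn {0}ᶜ) (hck : c ∈ homog _ k) : originDeg n c = 0 := by
  have := proj_mem_nullRel n (sub_originDeg_smul_mem hc)
  rw [map_sub, map_smul, proj_eq_self (isRelGen_originGen n).homog, proj_eq_zero hk hck,
    zero_sub] at this
  by_contra h
  exact (isRelGen_originGen n).notMem
    ((Submodule.smul_mem_iff _ h).mp (neg_mem_iff.mp this))

/-- The degree at `p` of a relative cycle modulo the complement of `p`. -/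
def degAt (p : EuclideanSpace ℝ (Fin n)) : Chains (EuclideanSpace ℝ (Fin n)) →ₗ[ℚ] ℚ :=
  originDeg n ∘ₗ push fun x ↦ x - p

theorem bd_push_mem {X Y : Type*} [TopologicalSpace X] [TopologicalSpace Y] {f : X → Y}
    {W A : Set X} {B : Set Y} (hf : ContinuousOn f W) (hA : A ⊆ W) (hB : MapsTo f A B)
    {c : Chains X} (hc : c ∈ chainsIn W) (hbd : bd _ c ∈ chainsIn A) :
    bd _ (push f c) ∈ chainsIn B := by
  rw [push_bd hf hc]
  exact push_mem_chainsIn (hf.mono hA) hB hbd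

variable {p : EuclideanSpace ℝ (Fin n)}

theorem bd_push_sub_mem {c : Chains (EuclideanSpace ℝ (Fin n))}
    (hc : bd _ c ∈ chainsIn {p}ᶜ) : bd _ (push (fun x ↦ x - p) c) ∈ chainsIn {0}ᶜ :=
  bd_push_mem (by fun_prop) (subset_univ _) (fun x hx ↦ by simpa [sub_eq_zero] using hx)
    (chainsIn_univ c) hc

theorem degAt_eq_zero {c : Chains (EuclideanSpace ℝ (Fin n))} (hc : c ∈ nullRel {p}ᶜ) :
    degAt p c = 0 :=
  originDeg_eq_zero (push_mem_nullRel (by fun_prop)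
    (fun x hx ↦ by simpa [sub_eq_zero] using hx) hc)

theorem degAt_of_homog {k : ℕ} (hk : k ≠ n) {c : Chains (EuclideanSpace ℝ (Fin n))}
    (hc : bd _ c ∈ chainsIn {p}ᶜ) (hck : c ∈ homog _ k) : degAt p c = 0 := by
  refine originDeg_of_homog hk (bd_push_sub_mem hc) ?_
  rw [← proj_eq_self hck, ← proj_push k (A := univ) (by fun_prop) (chainsIn_univ c)]
  exact proj_mem_homog _ _

theorem mem_nullRel_of_degAt {c : Chains (EuclideanSpace ℝ (Fin n))}
    (hc : bd _ c ∈ chainsIn {p}ᶜ) (h : degAt p c = 0) : c ∈ nullRel {p}ᶜ := by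
  have h1 := mem_nullRel_of_originDeg (bd_push_sub_mem hc) h
  have h2 := push_mem_nullRel (f := fun x ↦ x + p) (B := {p}ᶜ) (by fun_prop)
    (fun x hx ↦ by simpa using hx) h1
  rwa [push_push (A := univ) (by fun_prop) (chainsIn_univ c),
    push_id (A := univ) (fun x _ ↦ by simp) (chainsIn_univ c)] at h2

theorem degAt_zero (c : Chains (EuclideanSpace ℝ (Fin n))) : degAt 0 c = originDeg n c := by
  rw [degAt, LinearMap.comp_apply, push_id (A := univ) (fun x _ ↦ by simp) (chainsIn_univ c)]

/-- The degree is constant on convex sets which do not meet the boundary. -/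
theorem degAt_eq_degAt {K : Set (EuclideanSpace ℝ (Fin n))} (hK : Convex ℝ K)
    {q : EuclideanSpace ℝ (Fin n)} (hp : p ∈ K) (hq : q ∈ K)
    {c : Chains (EuclideanSpace ℝ (Fin n))} (hc : bd _ c ∈ chainsIn Kᶜ) :
    degAt p c = degAt q c := by
  have hH : Continuous fun x : EuclideanSpace ℝ (Fin n) × ℝ ↦
      x.1 - ((1 - x.2) • q + x.2 • p) := by fun_prop
  have h := push_sub_push_mem_nullRel (W := univ) (A := Kᶜ) (B := {0}ᶜ) hH.continuousOn
    (subset_univ _) (by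
      rintro ⟨x, t⟩ ⟨hx, ht⟩ h0
      have h1 : x = (1 - t) • q + t • p := sub_eq_zero.mp h0
      exact hx (h1 ▸ hK hq hp (by linarith [ht.2]) ht.1 (by ring))) (chainsIn_univ c) hc
  simpa [degAt] using originDeg_eq_of_sub_mem h

/-- A generator of the local homology along a given bounded set. -/
theorem exists_degAt_eq_one {K : Set (EuclideanSpace ℝ (Fin n))} (hK : Bornology.IsBounded K) :
    ∃ g ∈ homog (Sing (EuclideanSpace ℝ (Fin n))) n, bd _ g ∈ chainsIn Kᶜ ∧
      ∀ p ∈ K, degAt p g = 1 := by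
  have hg := isRelGen_originGen n
  obtain ⟨C, hC, hgC, hmin⟩ := exists_isCompact_chainsIn (bd _ (originGen n))
  obtain ⟨ε, hε, hball⟩ := Metric.isOpen_iff.mp hC.isClosed.isOpen_compl 0
    fun hpC ↦ hmin _ hg.bd_mem hpC rfl
  obtain ⟨B, hB⟩ := hK.subset_ball 0
  -- The boundary of the generator stays at distance at least `ε` from the origin, so scaling by `R`
  -- pushes it out of the ball of radius `|B|`, which contains `K`.
  set R : ℝ := 1 + |B| / ε with hR
  have hR0 : 0 < R := by positivity
  have hRB : |B| ≤ R * ε := by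
    have : R * ε = ε + |B| := by rw [hR]; field_simp
    linarith
  have hcont : Continuous fun x : EuclideanSpace ℝ (Fin n) ↦ R • x := by fun_prop
  have hbd : bd _ (push (fun x ↦ R • x) (originGen n)) ∈ chainsIn (Metric.ball 0 |B|)ᶜ := by
    refine bd_push_mem (A := C) (B := (Metric.ball 0 |B|)ᶜ) hcont.continuousOn (subset_univ _) (fun x hx hxB ↦ ?_)
      (chainsIn_univ _) hgC
    rw [mem_ball_zero_iff, norm_smul, Real.norm_of_nonneg hR0.le] at hxB
    have : ‖x‖ < ε := by nlinarith
    exact hball (mem_ball_zero_iff.mpr this) hx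
  have hKB : K ⊆ Metric.ball 0 |B| := hB.trans (Metric.ball_subset_ball (le_abs_self B))
  have h0 : degAt 0 (push (fun x ↦ R • x) (originGen n)) = 1 := by
    have hH : Continuous fun x : EuclideanSpace ℝ (Fin n) × ℝ ↦
      (1 - x.2 + x.2 * R) • x.1 := by fun_prop
    have h := push_sub_push_mem_nullRel (W := univ) (A := {0}ᶜ) (B := {0}ᶜ) hH.continuousOn
      (subset_univ _) (by
        rintro ⟨x, t⟩ ⟨hx, ht⟩ h0
        rcases smul_eq_zero.mp h0 with h | h
        · change 1 - t + t * R = 0 at h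
          have : t * R = t + t * (|B| / ε) := by rw [hR]; ring
          have : 0 ≤ t * (|B| / ε) := mul_nonneg ht.1 (by positivity)
          linarith
        · exact hx h) (chainsIn_univ (originGen n)) hg.bd_mem
    have h1 := originDeg_eq_of_sub_mem h
    rw [push_id (f := fun x ↦ (1 - (0 : ℝ) + 0 * R) • x) (A := univ) (fun x _ ↦ by simp)
      (chainsIn_univ _), originDeg_originGen] at h1
    rw [degAt_zero, ← h1]
    congr 3
    funext x
    simp
  refine ⟨push (fun x ↦ R • x) (originGen n), ?_, chainsIn_mono (compl_subset_compl.mpr hKB) hbd,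
    fun p hp ↦ ?_⟩
  · rw [← proj_eq_self hg.homog, ← proj_push n (A := univ) hcont.continuousOn (chainsIn_univ _)]
    exact proj_mem_homog _ _
  · have hp' := hKB hp
    rw [← h0]
    exact degAt_eq_degAt (convex_ball 0 |B|) hp' (by
      rw [Metric.mem_ball, dist_self]
      exact dist_nonneg.trans_lt hp') hbd

end Degree

/-! ### Linear maps act on local homology by the sign of the determinant -/

section Linear

variable {n : ℕ}

/-- The action of a matrix on Euclidean space. -/
def matMap (M : Matrix (Fin n) (Fin n) ℝ) (x : EuclideanSpace ℝ (Fin n)) :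
    EuclideanSpace ℝ (Fin n) :=
  WithLp.toLp 2 (M.mulVec x.ofLp)

theorem continuous_matMap (M : Matrix (Fin n) (Fin n) ℝ) : Continuous (matMap M) :=
  (PiLp.continuous_toLp 2 _).comp
    (continuous_const.matrix_mulVec (PiLp.continuous_ofLp 2 _))

theorem mapsTo_matMap {M : Matrix (Fin n) (Fin n) ℝ} (hM : M.det ≠ 0) :
    MapsTo (matMap M) {0}ᶜ {0}ᶜ := by
  intro x hx h
  refine hx ?_
  have h1 : M.mulVec x.ofLp = 0 := congrArg WithLp.ofLp h
  have := Matrix.eq_zero_of_mulVec_eq_zero hM h1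
  exact PiLp.ext fun i ↦ congrFun this i

theorem matMap_mul (M N : Matrix (Fin n) (Fin n) ℝ) : matMap (M * N) = matMap M ∘ matMap N := by
  funext x
  simp [matMap, Matrix.mulVec_mulVec]

theorem originDeg_push_matMap {M : Matrix (Fin n) (Fin n) ℝ} (hM : M.det ≠ 0)
    {c : Chains (EuclideanSpace ℝ (Fin n))} (hc : bd _ c ∈ chainsIn {0}ᶜ) :
    originDeg n (push (matMap M) c) =
      originDeg n (push (matMap M) (originGen n)) * originDeg n c := by
  have := push_mem_nullRel (continuous_matMap M) (mapsTo_matMap hM) (sub_originDeg_smul_mem hc)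
  rw [map_sub, map_smul] at this
  rw [originDeg_eq_of_sub_mem this, map_smul, smul_eq_mul, mul_comm]

/-- The degree of an invertible matrix. -/
def matDeg : Matrix (Fin n) (Fin n) ℝ →* ℚ where
  -- The value zero on singular matrices gives a homomorphism on the whole monoid, so factorizations
  -- may pass through any matrices.
  toFun M := if M.det = 0 then 0 else originDeg n (push (matMap M) (originGen n))
  map_one' := by
    rw [if_neg (by simp), push_id (A := univ) (fun x _ ↦ by simp [matMap]) (chainsIn_univ _),
      originDeg_originGen]
  map_mul' M N := by
    by_cases hM : M.det = 0
    · simp [hM]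
    by_cases hN : N.det = 0
    · simp [hN]
    rw [if_neg hM, if_neg hN, if_neg (by rw [Matrix.det_mul]; exact mul_ne_zero hM hN),
      matMap_mul, ← push_push (A := univ) (continuous_matMap N).continuousOn (chainsIn_univ _),
      originDeg_push_matMap hM]
    exact bd_push_mem (continuous_matMap N).continuousOn (subset_univ _) (mapsTo_matMap hN)
      (chainsIn_univ _) (isRelGen_originGen n).bd_mem

theorem matDeg_eq_of_path {M : ℝ → Matrix (Fin n) (Fin n) ℝ} (hM : Continuous M)
    (hdet : ∀ t ∈ Icc (0 : ℝ) 1, (M t).det ≠ 0) : matDeg (M 1) = matDeg (M 0) := by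
  have hH : Continuous fun x : EuclideanSpace ℝ (Fin n) × ℝ ↦ matMap (M x.2) x.1 :=
    (PiLp.continuous_toLp 2 _).comp ((hM.comp continuous_snd).matrix_mulVec
      ((PiLp.continuous_ofLp 2 _).comp continuous_fst))
  have h := push_sub_push_mem_nullRel (W := univ) (A := {0}ᶜ) (B := {0}ᶜ) hH.continuousOn
    (subset_univ _) (fun x hx ↦ mapsTo_matMap (hdet _ hx.2) hx.1)
    (chainsIn_univ (originGen n)) (isRelGen_originGen n).bd_mem
  change (if _ then _ else _) = (if _ then _ else _)
  rw [if_neg (hdet 1 (by simp)), if_neg (hdet 0 (by simp))]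
  exact originDeg_eq_of_sub_mem h

theorem matDeg_transvection {i j : Fin n} (hij : i ≠ j) (c : ℝ) :
    matDeg (Matrix.transvection i j c) = 1 := by
  have := matDeg_eq_of_path (M := fun t ↦ Matrix.transvection i j (t * c)) (by
    refine continuous_matrix fun k l ↦ ?_
    simp only [Matrix.transvection, Matrix.add_apply, Matrix.single_apply]
    split_ifs <;> fun_prop)
    (fun t _ ↦ by rw [Matrix.det_transvection_of_ne i j hij]; exact one_ne_zero)
  simpa using this

/-- The two diagonal matrices are conjugate by a permutation matrix, and the target `ℚ` is
commutative; the degree of the permutation matrix itself is never needed. -/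
theorem matDeg_diagonal_comp (σ : Equiv.Perm (Fin n)) (f : Fin n → ℝ) :
    matDeg (Matrix.diagonal (f ∘ σ)) = matDeg (Matrix.diagonal f) := by
  set P : Matrix (Fin n) (Fin n) ℝ := (1 : Matrix _ _ ℝ).submatrix σ id with hP
  set Q : Matrix (Fin n) (Fin n) ℝ := (1 : Matrix _ _ ℝ).submatrix id σ with hQ
  have h1 : P * Matrix.diagonal f * Q = Matrix.diagonal (f ∘ σ) := by
    ext i j
    by_cases h : i = j
    · simp [hP, hQ, Matrix.mul_apply, Matrix.one_apply, Matrix.diagonal_apply, h]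
    · simp [hP, hQ, Matrix.mul_apply, Matrix.one_apply, Matrix.diagonal_apply, h]
  have h2 : P * Q = 1 := by
    ext i j
    simp [hP, hQ, Matrix.mul_apply, Matrix.one_apply]
  have h3 : matDeg P * matDeg Q = 1 := by rw [← map_mul, h2, map_one]
  rw [← h1, map_mul, map_mul, mul_right_comm, h3, one_mul]

/-- A diagonal matrix is a product of matrices with one nontrivial entry each. Permutations move
every such entry to the position `i₀`, where the entries multiply. -/
theorem matDeg_diagonal (i₀ : Fin n) (d : Fin n → ℝ) :
    matDeg (Matrix.diagonal d) = matDeg (Matrix.diagonal (Pi.mulSingle i₀ (∏ i, d i))) := by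
  have h1 : ∀ (i : Fin n) (r : ℝ), matDeg (Matrix.diagonal (Pi.mulSingle (M := fun _ ↦ ℝ) i r)) =
      matDeg (Matrix.diagonal (Pi.mulSingle (M := fun _ ↦ ℝ) i₀ r)) := by
    intro i r
    rw [← matDeg_diagonal_comp (Equiv.swap i i₀)]
    congr 2
    funext k
    simp only [Function.comp_apply, Pi.mulSingle_apply]
    congr 1
    rw [Equiv.swap_apply_eq_iff, Equiv.swap_apply_left]
  let φ : (Fin n → ℝ) →* ℚ := matDeg.comp (Matrix.diagonalRingHom (Fin n) ℝ).toMonoidHom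
  let ψ : ℝ →* ℚ := φ.comp (MonoidHom.mulSingle (fun _ ↦ ℝ) i₀)
  have h2 : φ d = ψ (∏ i, d i) := by
    rw [map_prod]
    conv_lhs => rw [← Finset.univ_prod_mulSingle d, map_prod]
    exact Finset.prod_congr rfl fun i _ ↦ h1 i (d i)
  exact h2

/-- The degree factors through the determinant: matrices are products of transvections, which are
homotopic to the identity, and diagonal matrices. Only one-entry diagonal matrices remain to be
deformed. -/
theorem matDeg_eq (i₀ : Fin n) (M : Matrix (Fin n) (Fin n) ℝ) :
    matDeg M = matDeg (Matrix.diagonal (Pi.mulSingle i₀ M.det)) := by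
  refine Matrix.diagonal_transvection_induction (fun M ↦
    matDeg M = matDeg (Matrix.diagonal (Pi.mulSingle i₀ M.det))) M (fun D _ ↦ ?_) (fun t ↦ ?_)
    fun A B hA hB ↦ ?_
  · rw [Matrix.det_diagonal, matDeg_diagonal i₀]
  · rw [Matrix.TransvectionStruct.det, Matrix.TransvectionStruct.toMatrix,
      matDeg_transvection t.hij]
    simp
  · rw [map_mul, hA, hB, ← map_mul, Matrix.diagonal_mul_diagonal, Matrix.det_mul,
      Pi.mulSingle_mul]
    rfl

theorem matDeg_of_det_pos (i₀ : Fin n) {M : Matrix (Fin n) (Fin n) ℝ} (hM : 0 < M.det) :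
    matDeg M = 1 := by
  rw [matDeg_eq i₀]
  have := matDeg_eq_of_path
    (M := fun t ↦ Matrix.diagonal (Pi.mulSingle i₀ (1 - t + t * M.det))) (by
    refine Continuous.matrix_diagonal (continuous_pi fun i ↦ ?_)
    simp only [Pi.mulSingle_apply]
    split_ifs <;> fun_prop)
    (fun t ht ↦ by
      rw [Matrix.det_diagonal, Fintype.prod_pi_mulSingle']
      rcases ht.1.eq_or_lt with rfl | h
      · simp
      · have := mul_pos h hM
        linarith [ht.2])
  simpa using this

theorem originDeg_push_of_det_pos (i₀ : Fin n)
    (A : EuclideanSpace ℝ (Fin n) →L[ℝ] EuclideanSpace ℝ (Fin n))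
    (hA : 0 < LinearMap.det (A : EuclideanSpace ℝ (Fin n) →ₗ[ℝ] EuclideanSpace ℝ (Fin n)))
    {c : Chains (EuclideanSpace ℝ (Fin n))} (hc : bd _ c ∈ chainsIn {0}ᶜ) :
    originDeg n (push A c) = originDeg n c := by
  set M := Matrix.toEuclideanLin.symm
    (A : EuclideanSpace ℝ (Fin n) →ₗ[ℝ] EuclideanSpace ℝ (Fin n)) with hM
  have hAM : (A : EuclideanSpace ℝ (Fin n) →ₗ[ℝ] EuclideanSpace ℝ (Fin n)) =
      Matrix.toEuclideanLin M := by simp [hM]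
  have hdet : 0 < M.det := by
    rwa [hAM, Matrix.toEuclideanLin, Matrix.toLpLin_eq_toLin, LinearMap.det_toLin] at hA
  have hfun : (A : EuclideanSpace ℝ (Fin n) → EuclideanSpace ℝ (Fin n)) = matMap M := by
    funext x
    exact LinearMap.congr_fun hAM x
  have h1 := matDeg_of_det_pos i₀ hdet
  change (if _ then _ else _) = _ at h1
  rw [if_neg hdet.ne'] at h1
  rw [hfun, originDeg_push_matMap hdet.ne' hc, h1, one_mul]

/-- Maps with positive Jacobian preserve the local degree. -/
theorem originDeg_push_of_hasFDerivAt (i₀ : Fin n)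
    {f : EuclideanSpace ℝ (Fin n) → EuclideanSpace ℝ (Fin n)}
    {W : Set (EuclideanSpace ℝ (Fin n))} (hW : IsOpen W) {p : EuclideanSpace ℝ (Fin n)}
    (hp : p ∈ W) (hf : ContinuousOn f W) (hfp : f p = 0)
    (hmaps : MapsTo f (W ∩ {p}ᶜ) {0}ᶜ)
    {A : EuclideanSpace ℝ (Fin n) →L[ℝ] EuclideanSpace ℝ (Fin n)} (hA : HasFDerivAt f A p)
    (hdet : 0 < LinearMap.det (A : EuclideanSpace ℝ (Fin n) →ₗ[ℝ] EuclideanSpace ℝ (Fin n)))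
    {c : Chains (EuclideanSpace ℝ (Fin n))} (hc : c ∈ chainsIn W)
    (hbd : bd _ c ∈ chainsIn {p}ᶜ) : originDeg n (push f c) = degAt p c := by
  have hker : LinearMap.ker (A : EuclideanSpace ℝ (Fin n) →ₗ[ℝ] EuclideanSpace ℝ (Fin n)) = ⊥ :=
    LinearMap.ker_eq_bot.mpr
      (((LinearMap.isUnit_iff_isUnit_det _).mpr hdet.ne'.isUnit).map
        (RingHom.id _) |> fun h ↦ ((Module.End.isUnit_iff _).mp h).1)
  obtain ⟨m, hm, hanti⟩ := LinearMap.exists_antilipschitzWith _ hker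
  have hlow : ∀ v, ‖v‖ ≤ m * ‖A v‖ := fun v ↦ hanti.le_mul_norm (map_zero _) v
  have hm' : (0 : ℝ) < m := by exact_mod_cast hm
  -- Since `‖v‖ ≤ m ‖A v‖`, an error of at most `‖x - p‖ / (2 m)` is half of what would be needed
  -- for the straight homotopy from `f` to its linearization to vanish off `p`. Excision confines
  -- the chain to a ball where this bound holds.
  obtain ⟨r, hr, hball⟩ := Metric.mem_nhds_iff.mp (Filter.inter_mem
    ((hA.isLittleO.def (c := (2 * m : ℝ)⁻¹) (by positivity))) (hW.mem_nhds hp))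
  obtain ⟨c', hc', hbd', hcc'⟩ := exists_excision (K := {p}) (W := Metric.ball p r)
    Metric.isOpen_ball isClosed_singleton (singleton_subset_iff.mpr (Metric.mem_ball_self hr)) hbd
  have hBW : Metric.ball p r ⊆ W := fun x hx ↦ (hball hx).2
  obtain ⟨e, he, a, ha, hea⟩ := exists_eq_of_mem_nullRel hW isClosed_singleton
    (singleton_subset_iff.mpr hp) (sub_mem hc (chainsIn_mono hBW hc')) hcc'
  have h1 : originDeg n (push f c) = originDeg n (push f c') := by
    refine originDeg_eq_of_sub_mem ?_
    rw [← map_sub, hea, map_add, ← push_bd hf he]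
    exact add_mem (bd_mem_nullRel _ _) (chainsIn_le_nullRel _
      (push_mem_chainsIn (hf.mono inter_subset_left) hmaps ha))
  have h2 : degAt p c = degAt p c' := by
    rw [← sub_eq_zero, ← map_sub]
    exact degAt_eq_zero hcc'
  have hbdp : bd _ c' ∈ chainsIn {p}ᶜ := chainsIn_mono inter_subset_right hbd'
  have hH : ContinuousOn (fun x : EuclideanSpace ℝ (Fin n) × ℝ ↦
      (1 - x.2) • f x.1 + x.2 • A (x.1 - p)) (Metric.ball p r ×ˢ Icc (0 : ℝ) 1) := by
    have : ContinuousOn (fun x : EuclideanSpace ℝ (Fin n) × ℝ ↦ f x.1)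
        (Metric.ball p r ×ˢ Icc (0 : ℝ) 1) :=
      (hf.mono hBW).comp continuousOn_fst fun _ hx ↦ hx.1
    have h' : Continuous fun x : EuclideanSpace ℝ (Fin n) × ℝ ↦ x.2 • A (x.1 - p) := by fun_prop
    exact ((continuous_const.sub continuous_snd).continuousOn.smul this).add h'.continuousOn
  have h3 := push_sub_push_mem_nullRel (A := Metric.ball p r ∩ {p}ᶜ) (B := {0}ᶜ) hH
    inter_subset_left (by
      rintro ⟨x, t⟩ ⟨⟨hxB, hxp⟩, ht⟩ h0
      have hx : ‖f x - f p - A (x - p)‖ ≤ (2 * m : ℝ)⁻¹ * ‖x - p‖ := (hball hxB).1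
      rw [hfp, sub_zero] at hx
      have h4 : A (x - p) = -((1 - t) • (f x - A (x - p))) := by
        have : (1 - t) • f x + t • A (x - p) = 0 := h0
        rw [eq_neg_iff_add_eq_zero, ← this]
        module
      have h5 : ‖A (x - p)‖ ≤ (2 * m : ℝ)⁻¹ * ‖x - p‖ := by
        rw [h4, norm_neg, norm_smul, Real.norm_of_nonneg (by linarith [ht.2])]
        refine (mul_le_of_le_one_left (norm_nonneg _) (by linarith [ht.1])).trans hx
      have h6 : 0 < ‖x - p‖ := norm_sub_pos_iff.mpr hxp
      have h7 := hlow (x - p)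
      have h8 : m * ‖A (x - p)‖ ≤ m * ((2 * m : ℝ)⁻¹ * ‖x - p‖) := by gcongr
      have h9 : m * ((2 * m : ℝ)⁻¹ * ‖x - p‖) = ‖x - p‖ / 2 := by field_simp
      linarith) hc' hbd'
  have h4 := originDeg_eq_of_sub_mem h3
  have h5 : push (fun x ↦ (1 - (0 : ℝ)) • f x + (0 : ℝ) • A (x - p)) c' = push f c' :=
    push_congr (fun x _ ↦ by simp) hc'
  have h6 : push (fun x ↦ (1 - (1 : ℝ)) • f x + (1 : ℝ) • A (x - p)) c' =
      push A (push (fun x ↦ x - p) c') := by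
    rw [push_push (A := univ) (by fun_prop) (chainsIn_univ c')]
    exact push_congr (fun x _ ↦ by simp) hc'
  rw [h5, h6, originDeg_push_of_det_pos i₀ A hdet (bd_push_sub_mem hbdp)] at h4
  rw [h1, h2, ← h4]
  rfl

end Linear

end SingularDuality

end

/-! ### Chart transfer and pointwise detection of relative classes -/

noncomputable section

namespace SingularDuality

/-! ### Transport by charts -/

section Chart

variable {M E : Type*} [TopologicalSpace M] [TopologicalSpace E]

theorem push_mem_homog {f : M → E} {A : Set M} (hf : ContinuousOn f A) {k : ℕ} {c : Chains M}
    (hc : c ∈ chainsIn A) (hck : c ∈ homog _ k) : push f c ∈ homog _ k := by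
  rw [← proj_eq_self hck, ← proj_push k hf hc]
  exact proj_mem_homog _ _

/-- A null-homology in `E` may leave the target of the chart, where `φ.symm` is meaningless;
excision first moves it inside. -/
theorem push_symm_mem_nullRel (φ : OpenPartialHomeomorph M E) {K : Set M} (hK : K ⊆ φ.source)
    (hKE : IsClosed (φ '' K)) {c : Chains E} (hc : c ∈ chainsIn φ.target)
    (h : c ∈ nullRel (φ '' K)ᶜ) : push φ.symm c ∈ nullRel Kᶜ := by
  have hKt : φ '' K ⊆ φ.target := by
    rintro _ ⟨x, hx, rfl⟩
    exact φ.map_source (hK hx)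
  obtain ⟨e, he, a, ha, rfl⟩ := exists_eq_of_mem_nullRel φ.open_target hKE hKt hc h
  rw [map_add, ← push_bd φ.symm.continuousOn he]
  refine add_mem (bd_mem_nullRel _ _) (chainsIn_le_nullRel _ (push_mem_chainsIn
    (φ.symm.continuousOn.mono inter_subset_left) (B := Kᶜ) (fun x hx hxK ↦ ?_) ha))
  exact hx.2 ⟨_, hxK, φ.right_inv hx.1⟩

theorem mem_nullRel_of_push_symm (φ : OpenPartialHomeomorph M E) {K : Set M} (hK : K ⊆ φ.source)
    (hKM : IsClosed K) {c : Chains E} (hc : c ∈ chainsIn φ.target)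
    (h : push φ.symm c ∈ nullRel Kᶜ) : c ∈ nullRel (φ '' K)ᶜ := by
  have hcM : push φ.symm c ∈ chainsIn φ.source :=
    push_mem_chainsIn φ.symm.continuousOn (fun x hx ↦ φ.map_target hx) hc
  have hcc : push φ (push φ.symm c) = c := by
    rw [push_push φ.symm.continuousOn hc]
    exact push_id (fun x hx ↦ φ.right_inv hx) hc
  obtain ⟨e, he, a, ha, hea⟩ := exists_eq_of_mem_nullRel φ.open_source hKM hK hcM h
  rw [← hcc, hea, map_add, ← push_bd φ.continuousOn he]
  refine add_mem (bd_mem_nullRel _ _) (chainsIn_le_nullRel _ (push_mem_chainsIn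
    (φ.continuousOn.mono inter_subset_left) (B := (φ '' K)ᶜ) (fun x hx hxK ↦ ?_) ha))
  obtain ⟨y, hy, hyx⟩ := hxK
  exact hx.2 (φ.injOn (hK hy) hx.1 hyx ▸ hy)

/-- By excision every relative class along `K` comes from a Euclidean chain. Together with the
transfer of null-homologies in both directions, this reduces local statements to `ℝⁿ`. -/
theorem exists_push_symm (φ : OpenPartialHomeomorph M E) {K : Set M} (hK : K ⊆ φ.source)
    (hKM : IsClosed K) {k : ℕ} {c : Chains M} (hck : c ∈ homog _ k) (hc : bd _ c ∈ chainsIn Kᶜ) :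
    ∃ c' ∈ homog _ k, c' ∈ chainsIn φ.target ∧ bd _ c' ∈ chainsIn (φ '' K)ᶜ ∧
      c - push φ.symm c' ∈ nullRel Kᶜ := by
  obtain ⟨c₁, hc₁, hbd, hcc⟩ := exists_excision φ.open_source hKM hK hc
  have h1 : push φ c₁ ∈ chainsIn φ.target :=
    push_mem_chainsIn φ.continuousOn (fun x hx ↦ φ.map_source hx) hc₁
  refine ⟨proj _ k (push φ c₁), proj_mem_homog _ _, proj_mem_chainsIn k h1,
    bd_proj_mem_chainsIn k (bd_push_mem (A := φ.source ∩ Kᶜ) (B := (φ '' K)ᶜ) φ.continuousOn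
      inter_subset_left (fun x hx hxK ↦ ?_)
      hc₁ hbd), ?_⟩
  · obtain ⟨y, hy, hyx⟩ := hxK
    exact hx.2 (φ.injOn (hK hy) hx.1 hyx ▸ hy)
  · rw [← proj_push k φ.symm.continuousOn h1, push_push φ.continuousOn hc₁,
      push_id (f := φ.symm ∘ φ) (fun x hx ↦ φ.left_inv hx) hc₁]
    have := proj_mem_nullRel k hcc
    rwa [map_sub, proj_eq_self hck] at this

end Chart

/-! ### Detecting relative homology classes pointwise -/

section Pointwise

variable {X : Type*} [TopologicalSpace X]

/-- The Mayer–Vietoris step for fillings relative to complements of closed sets. -/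
theorem exists_filling_union {K L : Set X} (hK : IsClosed K) (hL : IsClosed L)
    {z e₁ e₂ : Chains X} (h₁ : z - bd _ e₁ ∈ chainsIn Kᶜ) (h₂ : z - bd _ e₂ ∈ chainsIn Lᶜ)
    (h : e₁ - e₂ ∈ nullRel (K ∩ L)ᶜ) :
    ∃ b, z - bd _ b ∈ chainsIn (K ∪ L)ᶜ ∧ b - e₁ ∈ nullRel Kᶜ ∧ b - e₂ ∈ nullRel Lᶜ := by
  obtain ⟨f, r, hr, hfr⟩ := mem_nullRel.mp h
  have hbr : bd _ r = -(z - bd _ e₁) + (z - bd _ e₂) := by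
    have := congrArg (bd _) hfr
    rw [map_sub, map_add, bd_bd, zero_add] at this
    rw [← this]
    abel
  rw [compl_inter] at hr
  -- The discrepancy `r` splits into a part off `K` and a part off `L`. Subtracting the first from
  -- `e₁` does no harm along `K`, and modulo boundaries only the second then separates the result
  -- from `e₂`.
  obtain ⟨g, -, r₁, hr₁, r₂, hr₂, hrr⟩ :=
    exists_split hK.isOpen_compl hL.isOpen_compl hr (neg_mem h₁) h₂ hbr
  refine ⟨e₁ - r₁, ?_, ?_, ?_⟩
  · rw [compl_union]
    refine chainsIn_inter ?_ ?_
    · have : z - bd _ (e₁ - r₁) = (z - bd _ e₁) + bd _ r₁ := by rw [map_sub]; abel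
      rw [this]
      exact add_mem h₁ (bd_mem_chainsIn hr₁)
    · have h3 := congrArg (bd _) hrr
      rw [map_add, map_add, bd_bd, zero_add, hbr] at h3
      have : z - bd _ (e₁ - r₁) = (z - bd _ e₂) - bd _ r₂ := by
        rw [map_sub, eq_sub_iff_add_eq, ← sub_eq_zero]
        rw [← sub_eq_zero] at h3
        rw [← neg_eq_zero, ← h3]
        abel
      rw [this]
      exact sub_mem h₂ (bd_mem_chainsIn hr₂)
  · rw [sub_sub_cancel_left]
    exact chainsIn_le_nullRel _ (neg_mem hr₁)
  · have : e₁ - r₁ - e₂ = bd _ (f + g) + r₂ := by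
      rw [sub_right_comm, hfr, hrr, map_add]
      abel
    rw [this]
    exact add_mem (bd_mem_nullRel _ _) (chainsIn_le_nullRel _ hr₂)

/-- The local homology of `X` is concentrated in degrees at most `n`. -/
def LocalVanishing (X : Type*) [TopologicalSpace X] (n : ℕ) : Prop :=
  ∀ (x : X) (k : ℕ), k ≠ n → ∀ c ∈ homog (Sing X) k, bd _ c ∈ chainsIn {x}ᶜ → c ∈ nullRel {x}ᶜ

/-- Relative classes of degree at least `n` modulo the complement of `K` vanish if they vanish
at all points of `K`. -/
def DetectsPointwise (n : ℕ) (K : Set X) : Prop :=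
  ∀ k, n ≤ k → ∀ c ∈ homog (Sing X) k, bd _ c ∈ chainsIn Kᶜ → (∀ x ∈ K, c ∈ nullRel {x}ᶜ) →
    c ∈ nullRel Kᶜ

theorem chainsIn_compl_le {K L : Set X} (h : L ⊆ K) : chainsIn Kᶜ ≤ chainsIn Lᶜ :=
  fun _ hc ↦ chainsIn_mono (compl_subset_compl.mpr h) hc

theorem chainsIn_compl_le_singleton {K : Set X} {x : X} (h : x ∈ K) :
    chainsIn Kᶜ ≤ chainsIn {x}ᶜ :=
  chainsIn_compl_le (singleton_subset_iff.mpr h)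

theorem detectsPointwise_empty (n : ℕ) : DetectsPointwise n (∅ : Set X) := by
  intro k _ c _ _ _
  rw [compl_empty]
  exact chainsIn_le_nullRel _ (chainsIn_univ c)

/-- Fillings along `K` and along `L` differ by a relative cycle of degree `k + 1 > n` along `K ∩ L`.
Local homology vanishes in that degree, so detection on the intersection makes the difference null
and the fillings glue. -/
theorem LocalVanishing.union {n : ℕ} (hX : LocalVanishing X n) {K L : Set X} (hK : IsClosed K)
    (hL : IsClosed L) (hdK : DetectsPointwise n K) (hdL : DetectsPointwise n L)
    (hd : DetectsPointwise n (K ∩ L)) : DetectsPointwise n (K ∪ L) := by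
  intro k hk c hck hc hcx
  have key : ∀ K' ⊆ K ∪ L, DetectsPointwise n K' →
      ∃ e ∈ homog (Sing X) (k + 1), c - bd _ e ∈ chainsIn K'ᶜ := by
    intro K' hK' hd'
    obtain ⟨e, a, ha, hea⟩ := mem_nullRel.mp (hd' k hk c hck (chainsIn_compl_le hK' hc)
      fun x hx ↦ hcx x (hK' hx))
    refine ⟨proj _ (k + 1) e, proj_mem_homog _ _, ?_⟩
    have := proj_mem_chainsIn k ha
    rwa [← sub_eq_of_eq_add' hea, map_sub, proj_eq_self hck, ← bd_proj_succ] at this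
  obtain ⟨e₁, he₁, h₁⟩ := key K subset_union_left hdK
  obtain ⟨e₂, he₂, h₂⟩ := key L subset_union_right hdL
  have hbd : bd _ (e₁ - e₂) ∈ chainsIn (K ∩ L)ᶜ := by
    have : bd _ (e₁ - e₂) = (c - bd _ e₂) - (c - bd _ e₁) := by rw [map_sub]; abel
    rw [this]
    exact sub_mem (chainsIn_compl_le inter_subset_right h₂)
      (chainsIn_compl_le inter_subset_left h₁)
  obtain ⟨b, hb, -⟩ := exists_filling_union hK hL h₁ h₂
    (hd (k + 1) (by omega) _ (sub_mem he₁ he₂) hbd fun x hx ↦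
      hX x (k + 1) (by omega) _ (sub_mem he₁ he₂) (chainsIn_compl_le_singleton hx hbd))
  exact mem_nullRel.mpr ⟨b, _, hb, by abel⟩

/-- Closure of `P` under intersections is essential: one piece meets the union of the others in a
union of fewer pieces of the same kind, which the induction covers. -/
theorem LocalVanishing.biUnion {n : ℕ} (hX : LocalVanishing X n) {P : Set X → Prop}
    (hP : ∀ K L, P K → P L → P (K ∩ L)) (hclosed : ∀ K, P K → IsClosed K)
    (hd : ∀ K, P K → DetectsPointwise n K) {ι : Type*} (s : Finset ι) (K : ι → Set X)
    (hK : ∀ i ∈ s, P (K i)) : DetectsPointwise n (⋃ i ∈ s, K i) := by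
  classical
  induction s using Finset.induction_on generalizing K with
  | empty => simpa using detectsPointwise_empty n
  | insert i s _ ih =>
    have hi := hK i (Finset.mem_insert_self i s)
    have hs : ∀ j ∈ s, P (K j) := fun j hj ↦ hK j (Finset.mem_insert_of_mem hj)
    rw [Finset.set_biUnion_insert]
    refine hX.union (hclosed _ hi) (isClosed_biUnion_finset fun j hj ↦ hclosed _ (hs j hj))
      (hd _ hi) (ih K hs) ?_
    rw [inter_iUnion₂]
    exact ih _ fun j hj ↦ hP _ _ hi (hs j hj)

end Pointwise

/-! ### Compact subsets of manifolds -/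

section Compact

variable {n : ℕ}

theorem localVanishing_euclidean : LocalVanishing (EuclideanSpace ℝ (Fin n)) n :=
  fun _ _ hk _ hck hc ↦ mem_nullRel_of_degAt hc (degAt_of_homog hk hc hck)

theorem detectsPointwise_of_convex {K : Set (EuclideanSpace ℝ (Fin n))} (hK : Convex ℝ K)
    (hb : Bornology.IsBounded K) : DetectsPointwise n K := by
  rcases K.eq_empty_or_nonempty with rfl | ⟨p, hp⟩
  · exact detectsPointwise_empty n
  · exact fun _ _ c _ hc hx ↦ mem_nullRel_of_starConvex (hK.starConvex hp) hb hc (hx p hp)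

/-- The compact support of `∂c` misses a neighborhood of `K`, so `K` can be enlarged to a finite
union of closed balls that still avoid it. On each ball, vanishing at the center implies vanishing
at every point. -/
theorem detectsPointwise_euclidean {K : Set (EuclideanSpace ℝ (Fin n))} (hK : IsCompact K) :
    DetectsPointwise n K := by
  intro k hk c hck hc hx
  obtain ⟨C, hC, hcC, hmin⟩ := exists_isCompact_chainsIn (bd _ c)
  have hKC := hmin _ hc
  have hball : ∀ x ∈ K, ∃ ε > 0, Metric.closedBall x ε ⊆ Cᶜ := fun x hxK ↦
    Metric.nhds_basis_closedBall.mem_iff.mp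
      (hC.isClosed.isOpen_compl.mem_nhds fun hxC ↦ hKC hxC hxK)
  choose! ε hε hεC using hball
  obtain ⟨s, hsK, hs⟩ := hK.elim_nhds_subcover (fun x ↦ Metric.closedBall x (ε x))
    fun x hxK ↦ Metric.closedBall_mem_nhds x (hε x hxK)
  have hd := (localVanishing_euclidean (n := n)).biUnion
    (P := fun K ↦ IsClosed K ∧ Bornology.IsBounded K ∧ Convex ℝ K)
    (fun K L hK hL ↦ ⟨hK.1.inter hL.1, hK.2.1.subset inter_subset_left, hK.2.2.inter hL.2.2⟩)
    (fun K hK ↦ hK.1) (fun K hK ↦ detectsPointwise_of_convex hK.2.2 hK.2.1) s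
    (fun x ↦ Metric.closedBall x (ε x))
    fun x _ ↦ ⟨Metric.isClosed_closedBall, Metric.isBounded_closedBall, convex_closedBall _ _⟩
  refine nullRel_mono (compl_subset_compl.mpr hs) (hd k hk c hck (chainsIn_mono ?_ hcC) ?_)
  · rw [subset_compl_comm]
    exact iUnion₂_subset fun x hxs ↦ hεC x (hsK x hxs)
  · intro y hy
    obtain ⟨x, hxs, hyx⟩ := mem_iUnion₂.mp hy
    have hxK := hsK x hxs
    exact nullRel_mono (compl_subset_compl.mpr (singleton_subset_iff.mpr hyx))
      (mem_nullRel_of_starConvex ((convex_closedBall x (ε x)).starConvex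
        (Metric.mem_closedBall_self (hε x hxK).le)) Metric.isBounded_closedBall
        (chainsIn_mono (subset_compl_comm.mp (hεC x hxK)) hcC) (hx x hxK))

variable {M : Type*} [TopologicalSpace M] [T2Space M]

theorem detectsPointwise_of_chart (φ : OpenPartialHomeomorph M (EuclideanSpace ℝ (Fin n)))
    {K : Set M} (hK : IsCompact K) (hKφ : K ⊆ φ.source) : DetectsPointwise n K := by
  intro k hk c hck hc hx
  obtain ⟨c', hck', hc', hbd, hcc⟩ := exists_push_symm φ hKφ hK.isClosed hck hc
  have hKE : IsCompact (φ '' K) := hK.image_of_continuousOn (φ.continuousOn.mono hKφ)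
  have h : c' ∈ nullRel (φ '' K)ᶜ := by
    refine detectsPointwise_euclidean hKE k hk c' hck' hbd ?_
    rintro _ ⟨x, hxK, rfl⟩
    rw [← image_singleton]
    refine mem_nullRel_of_push_symm φ (singleton_subset_iff.mpr (hKφ hxK)) isClosed_singleton hc' ?_
    rw [← sub_sub_cancel c (push φ.symm c')]
    exact sub_mem (hx x hxK)
      (nullRel_mono (compl_subset_compl.mpr (singleton_subset_iff.mpr hxK)) hcc)
  rw [← sub_add_cancel c (push φ.symm c')]
  exact add_mem hcc (push_symm_mem_nullRel φ hKφ hKE.isClosed hc' h)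

variable [ChartedSpace (EuclideanSpace ℝ (Fin n)) M]

variable (n M) in
theorem localVanishing_of_chartedSpace : LocalVanishing M n := by
  intro x k hk c hck hc
  set φ := chartAt (EuclideanSpace ℝ (Fin n)) x
  have hx : {x} ⊆ φ.source := singleton_subset_iff.mpr (mem_chart_source _ x)
  obtain ⟨c', hck', hc', hbd, hcc⟩ := exists_push_symm φ hx isClosed_singleton hck hc
  rw [← sub_add_cancel c (push φ.symm c')]
  refine add_mem hcc (push_symm_mem_nullRel φ hx (by simp) hc' ?_)
  rw [image_singleton] at hbd ⊢
  exact localVanishing_euclidean _ k hk c' hck' hbd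

theorem detectsPointwise_of_isCompact {K : Set M} (hK : IsCompact K) : DetectsPointwise n K := by
  have : LocallyCompactSpace M := ChartedSpace.locallyCompactSpace (EuclideanSpace ℝ (Fin n)) M
  have hnhds : ∀ x : M, ∃ N ∈ nhds x, N ⊆ (chartAt (EuclideanSpace ℝ (Fin n)) x).source ∧
      IsCompact N := fun x ↦
    local_compact_nhds ((chartAt (EuclideanSpace ℝ (Fin n)) x).open_source.mem_nhds
      (mem_chart_source _ x))
  choose N hN hNs hNc using hnhds
  obtain ⟨s, -, hs⟩ := hK.elim_nhds_subcover N fun x _ ↦ hN x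
  have hKs : K = ⋃ x ∈ s, K ∩ N x := by
    rw [← inter_iUnion₂]
    exact (inter_eq_self_of_subset_left hs).symm
  rw [hKs]
  exact (localVanishing_of_chartedSpace n M).biUnion
    (P := fun K ↦ IsCompact K ∧ ∃ φ : OpenPartialHomeomorph M (EuclideanSpace ℝ (Fin n)),
      K ⊆ φ.source)
    (fun K L hK hL ↦ ⟨hK.1.inter hL.1, hK.2.imp fun φ h ↦ inter_subset_left.trans h⟩)
    (fun K hK ↦ hK.1.isClosed)
    (fun K hK ↦ let ⟨φ, hφ⟩ := hK.2; detectsPointwise_of_chart φ hK.1 hφ) s _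
    fun x _ ↦ ⟨hK.inter (hNc x), _, inter_subset_right.trans (hNs x)⟩

end Compact

end SingularDuality

end

/-! ### Orientations, fundamental class and duality -/

noncomputable section

namespace SingularDuality

/-! ### Functions with prescribed differences -/

section Cochain

variable {X : Type*} [TopologicalSpace X]

/-- The value of a singular simplex at the vertex `i`. -/
def Sing.atVertex {n : ℕ} (σ : Sing X n) (i : Fin (n + 1)) : X := σ.toFun (stdSimplex.vertex i)

theorem atVertex_mem (σ : Σ n, Sing X n) (i : Fin (σ.1 + 1)) : σ.2.atVertex i ∈ carrier σ :=
  ⟨_, rfl⟩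

theorem atVertex_face {n : ℕ} (σ : Sing X (n + 1)) (i : Fin (n + 2)) (j : Fin (n + 1)) :
    Sing.atVertex (FaceMaps.face n i σ) j = σ.atVertex (i.succAbove j) :=
  congrArg σ.toFun (stdSimplex.map_vertex i.succAbove j)

theorem single_eq_ptChain (σ : Sing X 0) : Finsupp.single ⟨0, σ⟩ 1 = ptChain (σ.atVertex 0) := by
  refine congrArg (fun τ ↦ Finsupp.single (⟨0, τ⟩ : Σ n, Sing X n) (1 : ℚ))
    (Sing.ext (funext fun t ↦ congrArg σ.toFun (Subsingleton.elim _ _)))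

theorem bd_single_one (σ : Sing X 1) :
    bd _ (Finsupp.single ⟨1, σ⟩ 1) = ptChain (σ.atVertex 1) - ptChain (σ.atVertex 0) := by
  rw [bd_single_succ, Fin.sum_univ_two, single_eq_ptChain, single_eq_ptChain, atVertex_face,
    atVertex_face]
  simp [sub_eq_add_neg]

/-- The singular simplex of a path. -/
def pathSing {x y : X} (γ : Path x y) : Sing X 1 :=
  ⟨γ ∘ stdSimplexHomeomorphUnitInterval, by fun_prop⟩

theorem carrier_pathSing {x y : X} (γ : Path x y) : carrier ⟨1, pathSing γ⟩ ⊆ range γ :=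
  range_comp_subset_range stdSimplexHomeomorphUnitInterval γ

theorem atVertex_zero_pathSing {x y : X} (γ : Path x y) : (pathSing γ).atVertex 0 = x :=
  (congrArg γ stdSimplexHomeomorphUnitInterval_zero).trans γ.source

theorem atVertex_one_pathSing {x y : X} (γ : Path x y) : (pathSing γ).atVertex 1 = y :=
  (congrArg γ stdSimplexHomeomorphUnitInterval_one).trans γ.target

theorem bd_pathSing {x y : X} (γ : Path x y) :
    bd _ (Finsupp.single ⟨1, pathSing γ⟩ 1) = ptChain y - ptChain x := by
  rw [bd_single_one, atVertex_zero_pathSing, atVertex_one_pathSing]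

theorem exists_comp_eq_of_ker_le {V W : Type*} [AddCommGroup V] [Module ℚ V] [AddCommGroup W]
    [Module ℚ W] (D : V →ₗ[ℚ] W) (κ : V →ₗ[ℚ] ℚ) (h : LinearMap.ker D ≤ LinearMap.ker κ) :
    ∃ g : W →ₗ[ℚ] ℚ, g ∘ₗ D = κ := by
  have : κ ∈ LinearMap.range D.dualMap := by
    rw [LinearMap.range_dualMap_eq_dualAnnihilator_ker]
    exact (Submodule.mem_dualAnnihilator κ).mpr fun w hw ↦ h hw
  exact this

/-- If every `1`-cycle bounds, then compatible differences of local functions along paths come from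
a global function. -/
theorem exists_forall_sub_eq (hX : ∀ ζ ∈ homog (Sing X) 1, bd _ ζ = 0 → ∃ η, bd _ η = ζ)
    {ι : Type*} {U : ι → Set X} (hU : ∀ i, IsOpen (U i)) (hcover : ⋃ i, U i = univ)
    (s : ι → X → ℚ) (hs : ∀ i j, ∀ P, IsPathConnected P → IsCompact P → P ⊆ U i → P ⊆ U j →
      ∀ y ∈ P, ∀ y' ∈ P, s i y' - s i y = s j y' - s j y) :
    ∃ g : X → ℚ, ∀ i, ∀ y y', JoinedIn (U i) y y' → s i y' - s i y = g y' - g y := by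
  classical
  -- A 1-cochain on simplices contained in some `U i`: the increment of `s i` between the end
  -- vertices. By `hs` the choice of `i` is immaterial.
  let κ₀ : (Σ n, Sing X n) → ℚ := fun σ ↦ if h : ∃ i, carrier σ ⊆ U i then
    s h.choose (σ.2.atVertex (Fin.last _)) - s h.choose (σ.2.atVertex 0) else 0
  have hκ₀ : ∀ σ i, carrier σ ⊆ U i →
      κ₀ σ = s i (σ.2.atVertex (Fin.last _)) - s i (σ.2.atVertex 0) := by
    intro σ i hi
    have h : ∃ i, carrier σ ⊆ U i := ⟨i, hi⟩
    simp only [κ₀, dif_pos h]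
    exact hs _ _ _ (isPathConnected_carrier σ) (isCompact_carrier σ) h.choose_spec hi _
      (atVertex_mem σ _) _ (atVertex_mem σ _)
  let κ : Chains X →ₗ[ℚ] ℚ := Finsupp.linearCombination ℚ κ₀
  have hκ : ∀ σ, κ (.single σ 1) = κ₀ σ := fun σ ↦ by simp [κ]
  set 𝒰 := range U with h𝒰
  -- The cochain is closed: around a small 2-simplex the increments of a single `s i` cancel.
  have hbd2 : ∀ η ∈ smallChains 𝒰, κ (bd _ (proj _ 2 η)) = 0 := by
    intro η hη
    refine eq_of_mem_supported (f := κ ∘ₗ bd _ ∘ₗ proj _ 2) (g := 0) ?_ hη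
    rintro ⟨k, τ⟩ ⟨_, ⟨i, rfl⟩, hi⟩
    simp only [LinearMap.comp_apply, proj_single, LinearMap.zero_apply]
    split_ifs with hk
    · obtain rfl : k = 2 := hk
      rw [bd_single_succ, map_sum, Fin.sum_univ_three]
      simp only [map_smul, hκ]
      rw [hκ₀ _ i ((carrier_face 0 τ).trans hi), hκ₀ _ i ((carrier_face 1 τ).trans hi),
        hκ₀ _ i ((carrier_face 2 τ).trans hi)]
      simp only [atVertex_face]
      have h1 : (0 : Fin 3).succAbove (Fin.last 1) = 2 := rfl
      have h2 : (0 : Fin 3).succAbove (0 : Fin 2) = 1 := rfl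
      have h3 : (1 : Fin 3).succAbove (Fin.last 1) = 2 := rfl
      have h4 : (1 : Fin 3).succAbove (0 : Fin 2) = 0 := rfl
      have h5 : (2 : Fin 3).succAbove (Fin.last 1) = 1 := rfl
      have h6 : (2 : Fin 3).succAbove (0 : Fin 2) = 0 := rfl
      rw [h1, h2, h3, h4, h5, h6]
      simp
    · simp
  let S : Submodule ℚ (Chains X) := smallChains 𝒰 ⊓ homog _ 1
  -- A small 1-cycle bounds by `hX`, and by small simplices it bounds a small 2-chain, so `κ`
  -- vanishes on it. Hence `κ` factors through the boundary, and `g` on points is the desired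
  -- function.
  obtain ⟨g, hg⟩ := exists_comp_eq_of_ker_le ((bd (Sing X)).domRestrict S) (κ.domRestrict S) (by
    rintro ⟨ζ, hζ, hζ1⟩ h
    change bd _ ζ = 0 at h
    change κ ζ = 0
    obtain ⟨η, hη⟩ := hX ζ hζ1 h
    have huniv : ⋃₀ 𝒰 = univ := by rw [h𝒰, sUnion_range, hcover]
    obtain ⟨e, -, he⟩ := exists_sub_bd_mem_smallChains (𝒰 := 𝒰) (c := η)
      (by rintro _ ⟨i, rfl⟩; exact hU i) (huniv ▸ chainsIn_univ η) (hη ▸ hζ)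
    have := hbd2 _ he
    rwa [bd_proj_succ, map_sub (bd _), bd_bd, sub_zero, hη, proj_eq_self hζ1] at this)
  refine ⟨fun y ↦ g (ptChain y), fun i y y' hyy ↦ ?_⟩
  obtain ⟨γ, hγ⟩ := hyy
  have hc : carrier ⟨1, pathSing γ⟩ ⊆ U i :=
    (carrier_pathSing γ).trans (range_subset_iff.mpr hγ)
  have := LinearMap.congr_fun hg ⟨.single ⟨1, pathSing γ⟩ 1,
    Finsupp.single_mem_supported ℚ 1 ⟨_, mem_range_self i, hc⟩,
    Finsupp.single_mem_supported ℚ 1 rfl⟩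
  simp only [LinearMap.comp_apply, LinearMap.domRestrict_apply, bd_pathSing, map_sub, hκ] at this
  rw [this, hκ₀ _ i hc]
  change _ = s i ((pathSing γ).atVertex 1) - _
  rw [atVertex_one_pathSing, atVertex_zero_pathSing]

end Cochain

/-! ### Oriented manifolds -/

/-- An orientation of `M`: a family of functionals on chains, vanishing on the local boundaries,
which is given by the degree in suitable charts. -/
structure LocalOrientation (n : ℕ) (M : Type*) [TopologicalSpace M] where
  /-- The local degree. -/
  deg : M → Chains M →ₗ[ℚ] ℚ
  deg_eq_zero : ∀ x, ∀ c ∈ nullRel {x}ᶜ, deg x c = 0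
  exists_chart : ∀ x, ∃ φ : OpenPartialHomeomorph M (EuclideanSpace ℝ (Fin n)), x ∈ φ.source ∧
    ∀ p ∈ φ.target, ∀ c ∈ chainsIn φ.target, bd _ c ∈ chainsIn {p}ᶜ →
      deg (φ.symm p) (push φ.symm c) = degAt p c

namespace LocalOrientation

variable {n : ℕ} {M : Type*} [TopologicalSpace M] (o : LocalOrientation n M)

theorem deg_eq_of_sub_mem {x : M} {c d : Chains M} (h : c - d ∈ nullRel {x}ᶜ) :
    o.deg x c = o.deg x d := by
  rw [← sub_eq_zero, ← map_sub, o.deg_eq_zero x _ h]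

theorem ne_bd_of_deg_eq_one [Nonempty M] {μ : Chains M} (hμ1 : ∀ y, o.deg y μ = 1)
    (e : Chains M) : μ ≠ bd _ e := by
  rintro rfl
  obtain ⟨x⟩ := (inferInstance : Nonempty M)
  exact one_ne_zero ((hμ1 x).symm.trans (o.deg_eq_zero x _ (bd_mem_nullRel _ _)))

variable [T2Space M]

/-- In a chart around `x` the local homology in degree `n` is one-dimensional and the degree is an
isomorphism on it; excision and the chart transfer this to `M`. -/
theorem mem_nullRel_of_deg {x : M} {c : Chains M} (hcn : c ∈ homog _ n)
    (hc : bd _ c ∈ chainsIn {x}ᶜ) (h : o.deg x c = 0) : c ∈ nullRel {x}ᶜ := by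
  obtain ⟨φ, hx, hφ⟩ := o.exists_chart x
  have hxs : {x} ⊆ φ.source := singleton_subset_iff.mpr hx
  obtain ⟨c', -, hc', hbd, hcc⟩ := exists_push_symm φ hxs isClosed_singleton hcn hc
  rw [image_singleton] at hbd
  have h1 := hφ (φ x) (φ.map_source hx) c' hc' hbd
  rw [φ.left_inv hx, ← o.deg_eq_of_sub_mem hcc, h] at h1
  rw [← sub_add_cancel c (push φ.symm c')]
  refine add_mem hcc (push_symm_mem_nullRel φ hxs (by simp) hc' ?_)
  rw [image_singleton]
  exact mem_nullRel_of_degAt hbd h1.symm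

/-- Small closed balls around a point. -/
theorem exists_ball {x : M} {U : Set M} (hU : U ∈ nhds x) : ∃ N ∈ nhds x, N ⊆ U ∧ IsCompact N ∧
    IsPathConnected N ∧
    (∀ k, ∀ c ∈ homog (Sing M) k, bd _ c ∈ chainsIn Nᶜ → c ∈ nullRel {x}ᶜ → c ∈ nullRel Nᶜ) ∧
    (∀ k, ∀ c ∈ homog (Sing M) k, bd _ c ∈ chainsIn Nᶜ → ∀ y ∈ N, o.deg y c = o.deg x c) ∧
    ∃ g ∈ homog (Sing M) n, bd _ g ∈ chainsIn Nᶜ ∧ ∀ y ∈ N, o.deg y g = 1 := by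
  obtain ⟨φ, hx, hφ⟩ := o.exists_chart x
  have hV : φ.target ∩ φ.symm ⁻¹' U ∈ nhds (φ x) := by
    refine Filter.inter_mem (φ.open_target.mem_nhds (φ.map_source hx))
      ((φ.continuousAt_symm (φ.map_source hx)).preimage_mem_nhds ?_)
    rwa [φ.left_inv hx]
  obtain ⟨r, hr, hrV⟩ := Metric.nhds_basis_closedBall.mem_iff.mp hV
  set B := Metric.closedBall (φ x) r with hB
  have hBt : B ⊆ φ.target := hrV.trans inter_subset_left
  have hBx : φ x ∈ B := Metric.mem_closedBall_self hr.le
  have hBc : Convex ℝ B := convex_closedBall _ _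
  have hcont : ContinuousOn φ.symm B := φ.symm.continuousOn.mono hBt
  have hBK : IsCompact B := isCompact_closedBall _ _
  have hNs : φ.symm '' B ⊆ φ.source := by
    rintro _ ⟨p, hp, rfl⟩
    exact φ.map_target (hBt hp)
  have hNB : φ '' (φ.symm '' B) = B := by
    rw [← image_comp]
    exact (image_congr fun p hp ↦ φ.right_inv (hBt hp)).trans (image_id B)
  have hN : IsCompact (φ.symm '' B) := hBK.image_of_continuousOn hcont
  have hxN : x ∈ φ.symm '' B := ⟨φ x, hBx, φ.left_inv hx⟩
  have hmono : ∀ {y}, y ∈ φ.symm '' B → ∀ {c : Chains M}, c ∈ nullRel (φ.symm '' B)ᶜ →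
      c ∈ nullRel {y}ᶜ := fun hy _ h ↦
    nullRel_mono (compl_subset_compl.mpr (singleton_subset_iff.mpr hy)) h
  refine ⟨φ.symm '' B, ?_, ?_, hN, ?_, ?_, ?_, ?_⟩
  · have := φ.symm.image_mem_nhds (φ.map_source hx) (Metric.closedBall_mem_nhds (φ x) hr)
    rwa [φ.left_inv hx] at this
  · rintro _ ⟨p, hp, rfl⟩
    exact (hrV hp).2
  · exact (hBc.isPathConnected ⟨_, hBx⟩).image' hcont
  · intro k c hck hc hcx
    obtain ⟨c', hck', hc', hbd, hcc⟩ := exists_push_symm φ hNs hN.isClosed hck hc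
    rw [hNB] at hbd
    have h1 : push φ.symm c' ∈ nullRel {x}ᶜ := by
      rw [← sub_sub_cancel c (push φ.symm c')]
      exact sub_mem hcx (hmono hxN hcc)
    have h2 := mem_nullRel_of_push_symm φ (singleton_subset_iff.mpr hx) isClosed_singleton hc' h1
    rw [image_singleton] at h2
    rw [← sub_add_cancel c (push φ.symm c')]
    refine add_mem hcc (push_symm_mem_nullRel φ hNs ?_ hc' ?_)
    · rw [hNB]
      exact hBK.isClosed
    · rw [hNB]
      exact mem_nullRel_of_starConvex (hBc.starConvex hBx) hBK.isBounded hbd h2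
  · intro k c hck hc
    obtain ⟨c', hck', hc', hbd, hcc⟩ := exists_push_symm φ hNs hN.isClosed hck hc
    rw [hNB] at hbd
    have h1 : ∀ p ∈ B, o.deg (φ.symm p) c = degAt p c' := fun p hp ↦ by
      rw [o.deg_eq_of_sub_mem (hmono ⟨p, hp, rfl⟩ hcc)]
      exact hφ p (hBt hp) c' hc' (chainsIn_compl_le_singleton hp hbd)
    rintro _ ⟨p, hp, rfl⟩
    have h2 := h1 _ hBx
    rw [φ.left_inv hx] at h2
    rw [h2, h1 p hp]
    exact degAt_eq_degAt hBc hp hBx hbd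
  · obtain ⟨g, hgn, hg, hgB⟩ := exists_degAt_eq_one hBK.isBounded
    obtain ⟨g', hg', hbd, hgg⟩ := exists_excision φ.open_target hBK.isClosed hBt hg
    have hg'' := proj_mem_chainsIn n hg'
    have hbd' := bd_proj_mem_chainsIn n hbd
    refine ⟨push φ.symm (proj _ n g'), push_mem_homog φ.symm.continuousOn hg''
      (proj_mem_homog _ _), bd_push_mem φ.symm.continuousOn inter_subset_left
      (B := (φ.symm '' B)ᶜ) ?_ hg'' hbd', ?_⟩
    · rintro p ⟨hp, hpB⟩ ⟨q, hq, hqp⟩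
      exact hpB (φ.symm.injOn (hBt hq) hp hqp ▸ hq)
    · rintro _ ⟨p, hp, rfl⟩
      rw [hφ p (hBt hp) _ hg'' (chainsIn_compl_le_singleton hp
        (chainsIn_mono inter_subset_right hbd')), ← hgB p hp, eq_comm, ← sub_eq_zero, ← map_sub]
      refine degAt_eq_zero (nullRel_mono
        (compl_subset_compl.mpr (singleton_subset_iff.mpr hp)) ?_)
      have := proj_mem_nullRel n hgg
      rwa [map_sub, proj_eq_self hgn] at this

theorem deg_eq_of_isPreconnected {P : Set M} (hP : IsPreconnected P) {k : ℕ} {c : Chains M}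
    (hck : c ∈ homog _ k) (hc : bd _ c ∈ chainsIn Pᶜ) {x y : M} (hx : x ∈ P) (hy : y ∈ P) :
    o.deg x c = o.deg y c := by
  obtain ⟨C, hC, hcC, hmin⟩ := exists_isCompact_chainsIn (bd _ c)
  have hPC := hmin _ hc
  -- With the discrete topology on `ℚ`, continuity means local constancy, which holds on small balls
  -- avoiding `∂c`.
  let τ : TopologicalSpace ℚ := ⊥
  have : DiscreteTopology ℚ := ⟨rfl⟩
  refine hP.constant (f := fun x ↦ o.deg x c) (fun z hz ↦ ?_) hx hy
  obtain ⟨N, hN, hNC, -, -, -, hNd, -⟩ := o.exists_ball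
    (hC.isClosed.isOpen_compl.mem_nhds fun hzC ↦ hPC hzC hz)
  have : (fun x ↦ o.deg x c) =ᶠ[nhds z] fun _ ↦ o.deg z c :=
    Filter.mem_of_superset hN (hNd k c hck (chainsIn_mono (subset_compl_comm.mp hNC) hcC))
  exact (continuousAt_const.congr this.symm).continuousWithinAt

variable [CompactSpace M] [ChartedSpace (EuclideanSpace ℝ (Fin n)) M]

/-- Local fillings of `z` with consistent local degrees can be glued. -/
theorem exists_filling {m : ℕ} (hm : m + 1 = n) {z : Chains M} (hz : z ∈ homog _ m) (g : M → ℚ)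
    (h : ∀ x, ∃ N ∈ nhds x, ∃ b ∈ homog (Sing M) n, z - bd _ b ∈ chainsIn Nᶜ ∧
      ∀ y ∈ N, o.deg y b = g y) :
    ∃ b ∈ homog (Sing M) n, bd _ b = z ∧ ∀ y, o.deg y b = g y := by
  subst hm
  -- Compactness induction over sets contained in a compact set that carries a filling of degree
  -- `g`. On an overlap two such fillings differ by a relative `n`-cycle of degree zero everywhere,
  -- hence by a null one, so they glue.
  obtain ⟨K, hK, hKu, b, hb, hbz, hbg⟩ := isCompact_univ.induction_on
    (p := fun S : Set M ↦ ∃ K, IsCompact K ∧ S ⊆ K ∧ ∃ b ∈ homog (Sing M) (m + 1),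
      z - bd _ b ∈ chainsIn Kᶜ ∧ ∀ y ∈ K, o.deg y b = g y)
    ⟨∅, isCompact_empty, subset_rfl, 0, zero_mem _, by simpa using chainsIn_univ z, by simp⟩
    (fun S T hST ⟨K, hK, hTK, hb⟩ ↦ ⟨K, hK, hST.trans hTK, hb⟩)
    (by
      rintro S T ⟨K, hK, hSK, b₁, hb₁, hz₁, hg₁⟩ ⟨L, hL, hTL, b₂, hb₂, hz₂, hg₂⟩
      have hbd : bd _ (b₁ - b₂) ∈ chainsIn (K ∩ L)ᶜ := by
        have : bd _ (b₁ - b₂) = (z - bd _ b₂) - (z - bd _ b₁) := by rw [map_sub]; abel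
        rw [this]
        exact sub_mem (chainsIn_compl_le inter_subset_right hz₂)
          (chainsIn_compl_le inter_subset_left hz₁)
      obtain ⟨b, hbz, hbb₁, hbb₂⟩ := exists_filling_union hK.isClosed hL.isClosed hz₁ hz₂
        (detectsPointwise_of_isCompact (hK.inter hL) (m + 1) le_rfl _ (sub_mem hb₁ hb₂) hbd
          fun x hx ↦ o.mem_nullRel_of_deg (sub_mem hb₁ hb₂) (chainsIn_compl_le_singleton hx hbd)
            (by rw [map_sub, hg₁ x hx.1, hg₂ x hx.2, sub_self]))
      refine ⟨K ∪ L, hK.union hL, union_subset_union hSK hTL, proj _ (m + 1) b,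
        proj_mem_homog _ _, ?_, ?_⟩
      · have := proj_mem_chainsIn m hbz
        rwa [map_sub, proj_eq_self hz, ← bd_proj_succ] at this
      · have key : ∀ {K : Set M} {b' : Chains M}, b' ∈ homog _ (m + 1) → b - b' ∈ nullRel Kᶜ →
            ∀ y ∈ K, o.deg y (proj _ (m + 1) b) = o.deg y b' := fun hb' h y hy ↦ by
          have := proj_mem_nullRel (m + 1) h
          rw [map_sub, proj_eq_self hb'] at this
          exact o.deg_eq_of_sub_mem
            (nullRel_mono (compl_subset_compl.mpr (singleton_subset_iff.mpr hy)) this)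
        rintro y (hy | hy)
        · rw [key hb₁ hbb₁ y hy, hg₁ y hy]
        · rw [key hb₂ hbb₂ y hy, hg₂ y hy])
    (fun x _ ↦ by
      obtain ⟨N, hN, b, hb, hbz, hbg⟩ := h x
      obtain ⟨N', hN', hNN, hc, -⟩ := o.exists_ball hN
      exact ⟨N', mem_nhdsWithin_of_mem_nhds hN', N', hc, subset_rfl, b, hb,
        chainsIn_compl_le hNN hbz, fun y hy ↦ hbg y (hNN hy)⟩)
  refine ⟨b, hb, ?_, fun y ↦ hbg y (hKu (mem_univ y))⟩
  rw [univ_subset_iff.mp hKu, compl_univ] at hbz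
  exact (sub_eq_zero.mp (chainsIn_empty hbz)).symm

/-- The fundamental class. -/
theorem exists_fundamentalCycle (hn : n ≠ 0) :
    ∃ μ ∈ homog (Sing M) n, bd _ μ = 0 ∧ ∀ y, o.deg y μ = 1 := by
  obtain ⟨m, rfl⟩ := Nat.exists_eq_succ_of_ne_zero hn
  -- A fundamental cycle is a filling of the zero chain with degree one; locally the generator of a
  -- small ball serves.
  refine o.exists_filling rfl (zero_mem _) (fun _ ↦ 1) fun x ↦ ?_
  obtain ⟨N, hN, -, -, -, -, -, g, hg, hbd, hdeg⟩ := o.exists_ball (x := x) Filter.univ_mem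
  exact ⟨N, hN, g, hg, by rw [zero_sub]; exact neg_mem hbd, hdeg⟩

/-- The degree of a cycle is constant by connectedness. Subtracting that multiple of `μ` leaves a
cycle of degree zero everywhere, which bounds by pointwise detection along all of `M`. -/
theorem exists_sub_smul_eq_bd [ConnectedSpace M] {μ : Chains M} (hμ : μ ∈ homog _ n)
    (hμ0 : bd _ μ = 0) (hμ1 : ∀ y, o.deg y μ = 1) {z : Chains M} (hz : z ∈ homog _ n)
    (hz0 : bd _ z = 0) : ∃ q : ℚ, ∃ e, z - q • μ = bd _ e := by
  obtain ⟨x⟩ := (inferInstance : Nonempty M)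
  have hmem := sub_mem hz (Submodule.smul_mem _ (o.deg x z) hμ)
  have hbd : bd _ (z - o.deg x z • μ) = 0 := by rw [map_sub, map_smul, hz0, hμ0]; simp
  have h := detectsPointwise_of_isCompact (isCompact_univ (X := M)) n le_rfl _ hmem
    (by rw [hbd]; exact zero_mem _) fun y _ ↦
      o.mem_nullRel_of_deg hmem (by rw [hbd]; exact zero_mem _) (by
        rw [map_sub, map_smul, hμ1, o.deg_eq_of_isPreconnected isPreconnected_univ hz
          (by rw [hz0]; exact zero_mem _) (mem_univ y) (mem_univ x)]
        simp)
  obtain ⟨e, a, ha, hea⟩ := mem_nullRel.mp h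
  rw [compl_univ] at ha
  exact ⟨_, e, by rw [hea, chainsIn_empty ha, add_zero]⟩

/-- If every `1`-cycle of a closed oriented `(m + 1)`-manifold bounds, so does every `m`-cycle. -/
theorem exists_bd_eq (o : LocalOrientation n M) {m : ℕ} (hm : m + 1 = n)
    (hX : ∀ ζ ∈ homog (Sing M) 1, bd _ ζ = 0 → ∃ η, bd _ η = ζ) {z : Chains M}
    (hz : z ∈ homog _ m) (hz0 : bd _ z = 0) : ∃ b, bd _ b = z := by
  -- Local homology vanishes in degree `m < n`, so the cycle bounds relative to the complement of a
  -- small ball.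
  have hloc : ∀ x, ∃ N ∈ nhds x, ∃ b ∈ homog (Sing M) n, z - bd _ b ∈ chainsIn Nᶜ := by
    intro x
    obtain ⟨N, hN, -, -, -, hNx, -⟩ := o.exists_ball (x := x) Filter.univ_mem
    have hbd : ∀ A : Set M, bd _ z ∈ chainsIn A := fun A ↦ by rw [hz0]; exact zero_mem _
    obtain ⟨e, a, ha, hea⟩ := mem_nullRel.mp (hNx m z hz (hbd _)
      (localVanishing_of_chartedSpace n M x m (by omega) z hz (hbd _)))
    refine ⟨N, hN, proj _ n e, proj_mem_homog _ _, ?_⟩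
    have := proj_mem_chainsIn m ha
    rwa [← sub_eq_of_eq_add' hea, map_sub, proj_eq_self hz, ← bd_proj_succ, hm] at this
  choose N hN b hb hbz using hloc
  -- On a connected set where both fillings are valid, `b x - b x'` has constant degree. The
  -- increments of the local degree functions therefore match and integrate to a global function
  -- `g`.
  obtain ⟨g, hg⟩ := exists_forall_sub_eq hX (U := fun x ↦ interior (N x))
    (fun _ ↦ isOpen_interior)
    (eq_univ_of_forall fun x ↦ mem_iUnion.mpr ⟨x, mem_interior_iff_mem_nhds.mpr (hN x)⟩)
    (fun x y ↦ o.deg y (b x)) (by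
      intro x x' P hP _ hPx hPx' y hy y' hy'
      have hbd : bd _ (b x - b x') ∈ chainsIn Pᶜ := by
        have : bd _ (b x - b x') = (z - bd _ (b x')) - (z - bd _ (b x)) := by rw [map_sub]; abel
        rw [this]
        exact sub_mem (chainsIn_compl_le (hPx'.trans interior_subset) (hbz x'))
          (chainsIn_compl_le (hPx.trans interior_subset) (hbz x))
      have := o.deg_eq_of_isPreconnected hP.isConnected.isPreconnected
        (sub_mem (hb x) (hb x')) hbd hy hy'
      rw [map_sub, map_sub] at this
      linarith)
  obtain ⟨b', -, hb', -⟩ := o.exists_filling hm hz g fun x ↦ by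
    obtain ⟨N', hN', hNN, -, hpc, -, -, γ, hγ, hbd, hdeg⟩ :=
      o.exists_ball (isOpen_interior.mem_nhds (mem_interior_iff_mem_nhds.mpr (hN x)))
    -- On a small path-connected ball the degree of `b x` differs from `g` by a constant;
    -- subtracting that multiple of the local generator `γ` removes the difference and only changes
    -- the boundary outside the ball.
    refine ⟨N', hN', b x - (o.deg x (b x) - g x) • γ, sub_mem (hb x) (Submodule.smul_mem _ _ hγ),
      ?_, fun y hy ↦ ?_⟩
    · have : z - bd _ (b x - (o.deg x (b x) - g x) • γ) =
          (z - bd _ (b x)) + (o.deg x (b x) - g x) • bd _ γ := by rw [map_sub, map_smul]; abel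
      rw [this]
      exact add_mem (chainsIn_compl_le (hNN.trans interior_subset) (hbz x))
        (Submodule.smul_mem _ _ hbd)
    · have := hg x x y ((hpc.joinedIn x (mem_of_mem_nhds hN') y hy).mono hNN)
      rw [map_sub, map_smul, hdeg y hy, smul_eq_mul, mul_one]
      linarith
  exact ⟨b', hb'⟩

end LocalOrientation

/-- Above the dimension all local classes vanish, so pointwise detection along the compact manifold
makes every cycle a boundary. -/
theorem exists_eq_bd_of_lt {n : ℕ} {M : Type*} [TopologicalSpace M] [T2Space M] [CompactSpace M]
    [ChartedSpace (EuclideanSpace ℝ (Fin n)) M] {k : ℕ} (hk : n < k) {z : Chains M}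
    (hz : z ∈ homog _ k) (hz0 : bd _ z = 0) : ∃ e, bd _ e = z := by
  have hbd : ∀ A : Set M, bd _ z ∈ chainsIn A := fun A ↦ by rw [hz0]; exact zero_mem _
  obtain ⟨e, a, ha, hea⟩ := mem_nullRel.mp (detectsPointwise_of_isCompact (n := n)
    (isCompact_univ (X := M)) k hk.le z hz (hbd _) fun x _ ↦
      localVanishing_of_chartedSpace n M x k hk.ne' z hz (hbd _))
  rw [compl_univ] at ha
  exact ⟨e, by rw [hea, chainsIn_empty ha, add_zero]⟩

end SingularDuality

end

/-! ### The contact volume form in charts -/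

noncomputable section

namespace SingularDuality

/-! ### The volume form of a contact form -/

section Wedge

/-- The wedge product of a `1`-form and a `2`-form. -/
def wedgeForm {E : Type*} [NormedAddCommGroup E] [NormedSpace ℝ E]
    (a : E [⋀^Fin 1]→L[ℝ] ℝ) (D : E [⋀^Fin 2]→L[ℝ] ℝ) : E [⋀^Fin 3]→ₗ[ℝ] ℝ :=
  AlternatingMap.alternatizeUncurryFin
    (((ContinuousAlternatingMap.ofSubsingleton ℝ E ℝ (0 : Fin 1)).symm a :
      E →ₗ[ℝ] ℝ).smulRight D.toAlternatingMap)

theorem wedgeForm_apply {E : Type*} [NormedAddCommGroup E] [NormedSpace ℝ E]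
    (a : E [⋀^Fin 1]→L[ℝ] ℝ) (D : E [⋀^Fin 2]→L[ℝ] ℝ) (v : Fin 3 → E) :
    wedgeForm a D v = a ![v 0] * D ![v 1, v 2] - a ![v 1] * D ![v 0, v 2] +
      a ![v 2] * D ![v 0, v 1] := by
  have h0 : Fin.removeNth 0 v = ![v 1, v 2] := by funext i; fin_cases i <;> rfl
  have h1 : Fin.removeNth 1 v = ![v 0, v 2] := by funext i; fin_cases i <;> rfl
  have h2 : Fin.removeNth 2 v = ![v 0, v 1] := by funext i; fin_cases i <;> rfl
  have h : ∀ w : E, (fun _ : Fin 1 ↦ w) = ![w] := fun w ↦ by funext i; fin_cases i; rfl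
  rw [wedgeForm, AlternatingMap.alternatizeUncurryFin_apply, Fin.sum_univ_three, h0, h1, h2]
  simp [h]
  ring

theorem wedgeForm_comp {E : Type*} [NormedAddCommGroup E] [NormedSpace ℝ E]
    (a : E [⋀^Fin 1]→L[ℝ] ℝ) (D : E [⋀^Fin 2]→L[ℝ] ℝ) (A : E →L[ℝ] E) (v : Fin 3 → E) :
    wedgeForm (a.compContinuousLinearMap A) (D.compContinuousLinearMap A) v =
      wedgeForm a D (A ∘ v) := by
  simp only [wedgeForm_apply, ContinuousAlternatingMap.compContinuousLinearMap_apply,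
    Function.comp_apply]
  congr! <;> (funext i; fin_cases i <;> rfl)

theorem alternating_comp_eq_det_mul {E ι : Type*} [AddCommGroup E] [Module ℝ E] [Fintype ι]
    [DecidableEq ι] (b : Module.Basis ι ℝ E) (f : E [⋀^ι]→ₗ[ℝ] ℝ) (A : E →ₗ[ℝ] E) (v : ι → E) :
    f (A ∘ v) = LinearMap.det A * f v := by
  rw [f.eq_smul_basis_det b]
  simp only [AlternatingMap.smul_apply, smul_eq_mul]
  rw [Module.Basis.det_comp]
  ring

/-- The standard basis of `ℝ³`. -/
def stdBasis : Module.Basis (Fin 3) ℝ E3 := (EuclideanSpace.basisFun (Fin 3) ℝ).toBasis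

end Wedge

section Contact

variable {M : Type*} [TopologicalSpace M] [ChartedSpace E3 M]

/-- The change of the preferred charts from `x` to `x'`. -/
def chartChange (x x' : M) (q : E3) : E3 := chartAt E3 x' ((chartAt E3 x).symm q)

theorem isOpen_chartChange_source (x x' : M) :
    IsOpen ((chartAt E3 x).target ∩ (chartAt E3 x).symm ⁻¹' (chartAt E3 x').source) :=
  (chartAt E3 x).isOpen_inter_preimage_symm (chartAt E3 x').open_source

variable [IsManifold (𝓡 3) ∞ M] {α : OneForm M}

/-- The derivative of the inverse chart is the inverse of the tangent trivialization, so `inChart`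
is the coordinate expression of `α` in the cotangent trivialization, where smoothness of the section
can be read off. -/
theorem contDiffOn_inChart (hα : α.IsSmooth) (x : M) :
    ContDiffOn ℝ ∞ (α.inChart x) (chartAt E3 x).target := by
  set e := trivializationAt (E3 →L[ℝ] ℝ)
    (fun x : M ↦ TangentSpace (𝓡 3) x →L[ℝ] Bundle.Trivial M ℝ x) x with he
  have h1 := (e.contMDiffOn_section_baseSet_iff (IB := 𝓡 3) (n := ∞) (s := α)).mp hα.contMDiffOn
  have h2 := contMDiffOn_extChartAt_symm (I := 𝓡 3) (n := ∞) x
  have htar : (extChartAt (𝓡 3) x).target = (chartAt E3 x).target := by simp [mfld_simps]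
  have hbase : e.baseSet = (chartAt E3 x).source := by
    simp [he, hom_trivializationAt_baseSet]
  rw [htar] at h2
  have hmaps : MapsTo (extChartAt (𝓡 3) x).symm (chartAt E3 x).target e.baseSet := by
    intro y hy
    rw [hbase]
    exact (chartAt E3 x).map_target hy
  have h3 := (h1.comp h2 hmaps).contDiffOn
  have h4 : ContDiffOn ℝ ∞ (fun y ↦ ContinuousAlternatingMap.ofSubsingleton ℝ E3 ℝ (0 : Fin 1)
      ((fun x ↦ (e ⟨x, α x⟩).2) ((extChartAt (𝓡 3) x).symm y))) (chartAt E3 x).target :=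
    (ContinuousAlternatingMap.ofSubsingletonLIE (𝕜 := ℝ) (E := E3) (F := ℝ) (0 : Fin 1)).contDiff.comp_contDiffOn h3
  refine h4.congr fun y hy ↦ ?_
  simp only [OneForm.inChart]
  congr 1
  have hy' := hmaps hy
  rw [hbase] at hy'
  rw [he, hom_trivializationAt_apply]
  have h5 := TangentBundle.symmL_trivializationAt (I := 𝓡 3) (𝕜 := ℝ) hy'
  have h6 : extChartAt (𝓡 3) x ((extChartAt (𝓡 3) x).symm y) = y :=
    (extChartAt (𝓡 3) x).right_inv (htar ▸ hy)
  rw [h6, ModelWithCorners.range_eq_univ, mfderivWithin_univ] at h5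
  simp only [ContinuousLinearMap.inCoordinates]
  rw [h5]
  ext v
  simp

/-- The coefficient of `α ∧ dα` in the preferred chart at `x`. -/
def volAt (α : OneForm M) (x : M) (y : E3) : ℝ :=
  wedgeForm (α.inChart x y) (extDeriv (α.inChart x) y) stdBasis

theorem continuousOn_volAt (hα : α.IsSmooth) (x : M) :
    ContinuousOn (volAt α x) (chartAt E3 x).target := by
  have h := contDiffOn_inChart hα x
  have h1 := h.continuousOn
  have h2 : ContinuousOn (extDeriv (α.inChart x)) (chartAt E3 x).target :=
    (ContinuousAlternatingMap.alternatizeUncurryFinCLM ℝ E3 ℝ).continuous.comp_continuousOn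
      (h.continuousOn_fderiv_of_isOpen (chartAt E3 x).open_target (by simp))
  have h3 : ∀ v, ContinuousOn (fun y ↦ α.inChart x y v) (chartAt E3 x).target := fun v ↦
    (ContinuousAlternatingMap.apply ℝ E3 ℝ v).continuous.comp_continuousOn h1
  have h4 : ∀ v, ContinuousOn (fun y ↦ extDeriv (α.inChart x) y v) (chartAt E3 x).target :=
    fun v ↦ (ContinuousAlternatingMap.apply ℝ E3 ℝ v).continuous.comp_continuousOn h2
  unfold volAt
  simp only [wedgeForm_apply]
  exact ((((h3 _).mul (h4 _)).sub ((h3 _).mul (h4 _))).add ((h3 _).mul (h4 _)))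

/-- An alternating 3-form on `ℝ³` that vanishes on a basis is zero. The chart derivative `T` carries
the contact condition on the tangent space at `x` to coordinates, so a zero coefficient would
contradict it. -/
theorem volAt_ne_zero (hα : α.IsContact) (x : M) : volAt α x (chartAt E3 x x) ≠ 0 := by
  obtain ⟨u, v, w, h⟩ := hα.2 x
  intro h0
  refine h ?_
  have hw : wedgeForm (α.inChart x (chartAt E3 x x))
      (extDeriv (α.inChart x) (chartAt E3 x x)) = 0 :=
    (AlternatingMap.map_basis_eq_zero_iff stdBasis _).mp h0
  set T := mfderiv (𝓡 3) 𝓘(ℝ, E3) (extChartAt (𝓡 3) x) x with hT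
  have hα1 : ∀ u, α.inChart x (chartAt E3 x x) ![T u] = α x u := by
    intro u
    have h1 := mfderivWithin_extChartAt_symm_comp_mfderiv_extChartAt' (I := 𝓡 3)
      (mem_extChartAt_source (I := 𝓡 3) x)
    rw [ModelWithCorners.range_eq_univ, mfderivWithin_univ] at h1
    have h2 := DFunLike.congr_fun h1 u
    have h3 : ∀ z, z = x → ∀ w : E3, (α z : E3 →L[ℝ] ℝ) w = (α x : E3 →L[ℝ] ℝ) w := by
      rintro z rfl w
      rfl
    exact (h3 _ (extChartAt_to_inv (I := 𝓡 3) x) _).trans (congrArg (α x) h2)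
  have := DFunLike.congr_fun hw (![T u, T v, T w] : Fin 3 → E3)
  rw [wedgeForm_apply] at this
  simp only [Matrix.cons_val, hα1] at this
  exact this

theorem contDiffOn_chartChange (x x' : M) : ContDiffOn ℝ ∞ (chartChange x x')
    ((chartAt E3 x).target ∩ (chartAt E3 x).symm ⁻¹' (chartAt E3 x').source) := by
  have h1 := contMDiffOn_extChartAt_symm (I := 𝓡 3) (n := ∞) x
  have h2 := contMDiffOn_extChartAt (I := 𝓡 3) (n := ∞) (x := x')
  refine (h2.comp (h1.mono fun q hq ↦ ?_) fun q hq ↦ ?_).contDiffOn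
  · simpa [mfld_simps] using hq.1
  · exact hq.2

theorem inChart_eq_comp (α : OneForm M) {x x' : M} {q : E3}
    (hq : q ∈ (chartAt E3 x).target ∩ (chartAt E3 x).symm ⁻¹' (chartAt E3 x').source) :
    α.inChart x q = (α.inChart x' (chartChange x x' q)).compContinuousLinearMap
      (fderiv ℝ (chartChange x x') q) := by
  have hU := (isOpen_chartChange_source x x').mem_nhds hq
  have hq' : chartChange x x' q ∈ (chartAt E3 x').target := (chartAt E3 x').map_source hq.2
  have hτ : MDifferentiableAt 𝓘(ℝ, E3) 𝓘(ℝ, E3) (chartChange x x') q :=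
    (((contDiffOn_chartChange x x').contDiffAt hU).differentiableAt
      (by simp)).mdifferentiableAt
  have hs : MDifferentiableAt 𝓘(ℝ, E3) (𝓡 3) (extChartAt (𝓡 3) x').symm (chartChange x x' q) :=
    (mdifferentiableOn_extChartAt_symm (I := 𝓡 3) (x := x')).mdifferentiableAt
      (by simpa [mfld_simps] using (chartAt E3 x').open_target.mem_nhds hq')
  have heq : (extChartAt (𝓡 3) x).symm =ᶠ[nhds q]
      (extChartAt (𝓡 3) x').symm ∘ chartChange x x' :=
    Filter.mem_of_superset hU fun p hp ↦ ((chartAt E3 x').left_inv hp.2).symm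
  have h1 := heq.mfderiv_eq (I := 𝓘(ℝ, E3)) (I' := 𝓡 3)
  have h2 := mfderiv_comp q hs hτ
  have h3 : ∀ z z' : M, z = z' → ∀ w : E3, (α z : E3 →L[ℝ] ℝ) w = (α z' : E3 →L[ℝ] ℝ) w := by
    rintro z _ rfl w
    rfl
  ext v
  rw [mfderiv_eq_fderiv] at h2
  have h4 : (mfderiv 𝓘(ℝ, E3) (𝓡 3) (extChartAt (𝓡 3) x).symm q (v 0) : E3) =
      (mfderiv 𝓘(ℝ, E3) (𝓡 3) (extChartAt (𝓡 3) x').symm (chartChange x x' q)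
        (fderiv ℝ (chartChange x x') q (v 0)) : E3) :=
    DFunLike.congr_fun (h1.trans h2) (v 0)
  exact (congrArg (fun w : E3 ↦ (α ((extChartAt (𝓡 3) x).symm q) : E3 →L[ℝ] ℝ) w) h4).trans
    (h3 _ _ heq.eq_of_nhds _)

/-- The exterior derivative commutes with pullback along the smooth transition map, and a top-degree
form on `ℝ³` pulls back by the determinant. -/
theorem volAt_eq_det_mul (hα : α.IsSmooth) {x x' : M} {q : E3}
    (hq : q ∈ (chartAt E3 x).target ∩ (chartAt E3 x).symm ⁻¹' (chartAt E3 x').source) :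
    volAt α x q = LinearMap.det (fderiv ℝ (chartChange x x') q : E3 →ₗ[ℝ] E3) *
      volAt α x' (chartChange x x' q) := by
  have hU := (isOpen_chartChange_source x x').mem_nhds hq
  have hq' : chartChange x x' q ∈ (chartAt E3 x').target := (chartAt E3 x').map_source hq.2
  have h1 : α.inChart x =ᶠ[nhds q] fun q ↦ (α.inChart x' (chartChange x x' q)).compContinuousLinearMap
      (fderiv ℝ (chartChange x x') q) :=
    Filter.mem_of_superset hU fun q' hq' ↦ inChart_eq_comp α hq'
  have h2 : extDeriv (α.inChart x) q = (extDeriv (α.inChart x')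
      (chartChange x x' q)).compContinuousLinearMap (fderiv ℝ (chartChange x x') q) := by
    rw [h1.extDeriv_eq]
    exact extDeriv_pullback (r := ∞) (((contDiffOn_inChart hα x').contDiffAt
      ((chartAt E3 x').open_target.mem_nhds hq')).differentiableAt (by simp))
      ((contDiffOn_chartChange x x').contDiffAt hU) (by
      simpa using WithTop.coe_le_coe.mpr (le_top : (2 : ℕ∞) ≤ ⊤))
  rw [volAt, h2, inChart_eq_comp α hq, wedgeForm_comp]
  exact alternating_comp_eq_det_mul stdBasis _ _ _

end Contact

end SingularDuality

end

/-! ### From the volume form to a homological orientation -/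

noncomputable section

namespace SingularDuality

/-! ### Orientations from compatible charts -/

section LocalDegree

variable {n : ℕ} {M : Type*} [TopologicalSpace M]

/-- The functional `Λ` on chains is the local degree at `x` in the chart `φ`. -/
structure IsLocalDegree (φ : OpenPartialHomeomorph M (EuclideanSpace ℝ (Fin n))) (x : M)
    (Λ : Chains M →ₗ[ℚ] ℚ) : Prop where
  eq_zero : ∀ c ∈ nullRel {x}ᶜ, Λ c = 0
  eq_degAt : ∀ c ∈ chainsIn φ.target, bd _ c ∈ chainsIn {φ x}ᶜ →
    Λ (push φ.symm c) = degAt (φ x) c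

/-- A Euclidean generator at `φ x`, excised into the chart target, stays non-null after transfer to
`M`. A functional that separates it from `nullRel {x}ᶜ`, normalized on it, must agree with `degAt`,
since degree-zero relative cycles are null. -/
theorem exists_isLocalDegree [T2Space M] (φ : OpenPartialHomeomorph M (EuclideanSpace ℝ (Fin n))) {x : M}
    (hx : x ∈ φ.source) : ∃ Λ, IsLocalDegree φ x Λ := by
  have hxs : {x} ⊆ φ.source := singleton_subset_iff.mpr hx
  obtain ⟨g, -, hg, hg1⟩ := exists_degAt_eq_one (n := n) (Bornology.isBounded_singleton (x := φ x))
  obtain ⟨g', hg', hbd, hgg⟩ := exists_excision φ.open_target isClosed_singleton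
    (singleton_subset_iff.mpr (φ.map_source hx)) hg
  have hd : degAt (φ x) g' = 1 := by
    rw [← hg1 _ rfl, eq_comm, ← sub_eq_zero, ← map_sub, degAt_eq_zero hgg]
  have hne : push φ.symm g' ∉ nullRel {x}ᶜ := fun h ↦ by
    have := mem_nullRel_of_push_symm φ hxs isClosed_singleton hg' h
    rw [image_singleton] at this
    exact one_ne_zero (hd.symm.trans (degAt_eq_zero this))
  obtain ⟨f, hf, hle⟩ := Submodule.exists_le_ker_of_notMem hne
  have hnull : ∀ c ∈ nullRel {x}ᶜ, f c = 0 := fun c hc ↦ LinearMap.mem_ker.mp (hle hc)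
  refine ⟨(f (push φ.symm g'))⁻¹ • f, fun c hc ↦ by simp [hnull c hc], fun c hc hbdc ↦ ?_⟩
  have hsub : c - degAt (φ x) c • g' ∈ nullRel {φ x}ᶜ := by
    refine mem_nullRel_of_degAt ?_ (by rw [map_sub, map_smul, hd]; simp)
    rw [map_sub, map_smul]
    exact sub_mem hbdc (Submodule.smul_mem _ _ (chainsIn_mono inter_subset_right hbd))
  have := hnull _ (push_symm_mem_nullRel φ hxs (by simp)
    (sub_mem hc (Submodule.smul_mem _ _ hg')) (by rwa [image_singleton]))
  rw [map_sub, map_sub, map_smul, map_smul, sub_eq_zero, smul_eq_mul] at this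
  rw [LinearMap.smul_apply, smul_eq_mul, this]
  field_simp

/-- The local degree is the same in charts which are related by an orientation preserving
transition map. -/
theorem IsLocalDegree.of_hasFDerivAt (i₀ : Fin n)
    {φ ψ : OpenPartialHomeomorph M (EuclideanSpace ℝ (Fin n))} {x : M}
    (hφ : x ∈ φ.source) (hψ : x ∈ ψ.source) {Λ : Chains M →ₗ[ℚ] ℚ} (hΛ : IsLocalDegree ψ x Λ)
    {A : EuclideanSpace ℝ (Fin n) →L[ℝ] EuclideanSpace ℝ (Fin n)}
    (hA : HasFDerivAt (ψ ∘ φ.symm) A (φ x))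
    (hdet : 0 < LinearMap.det (A : EuclideanSpace ℝ (Fin n) →ₗ[ℝ] EuclideanSpace ℝ (Fin n))) :
    IsLocalDegree φ x Λ := by
  refine ⟨hΛ.eq_zero, fun c hc hbd ↦ ?_⟩
  have hxφ : {x} ⊆ φ.source := singleton_subset_iff.mpr hφ
  set V := φ.target ∩ φ.symm ⁻¹' ψ.source with hV
  have hVo : IsOpen V := φ.isOpen_inter_preimage_symm ψ.open_source
  have hpV : φ x ∈ V := ⟨φ.map_source hφ, by rwa [mem_preimage, φ.left_inv hφ]⟩
  obtain ⟨c', hc', hbd', hcc⟩ := exists_excision hVo isClosed_singleton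
    (singleton_subset_iff.mpr hpV) hbd
  have hVt : V ⊆ φ.target := inter_subset_left
  have h1 : degAt (φ x) c = degAt (φ x) c' := by
    rw [← sub_eq_zero, ← map_sub, degAt_eq_zero hcc]
  have h2 : Λ (push φ.symm c) = Λ (push φ.symm c') := by
    rw [← sub_eq_zero, ← map_sub, ← map_sub]
    exact hΛ.eq_zero _ (push_symm_mem_nullRel φ hxφ (by simp)
      (sub_mem hc (chainsIn_mono hVt hc')) (by rwa [image_singleton]))
  set f := ψ ∘ φ.symm with hf
  have hfc : ContinuousOn f V := ψ.continuousOn.comp (φ.symm.continuousOn.mono hVt) fun q hq ↦ hq.2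
  have hft : MapsTo f V ψ.target := fun q hq ↦ ψ.map_source hq.2
  have hfx : f (φ x) = ψ x := by rw [hf, Function.comp_apply, φ.left_inv hφ]
  have hfne : MapsTo f (V ∩ {φ x}ᶜ) {ψ x}ᶜ := by
    rintro q ⟨hq, hqx⟩ h
    have h3 := ψ.injOn hq.2 hψ h
    exact hqx (by rw [mem_singleton_iff, ← h3, φ.right_inv hq.1])
  have h3 : push φ.symm c' = push ψ.symm (push f c') := by
    rw [push_push hfc hc']
    exact push_congr (fun q hq ↦ (ψ.left_inv hq.2).symm) hc'
  rw [h1, h2, h3, hΛ.eq_degAt _ (push_mem_chainsIn hfc hft hc')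
    (bd_push_mem hfc inter_subset_left hfne hc' hbd'), degAt, LinearMap.comp_apply,
    push_push hfc hc']
  refine originDeg_push_of_hasFDerivAt i₀ hVo hpV (hfc.sub continuousOn_const)
    (by simp [hfx]) (fun q hq ↦ ?_) (hA.sub_const _) hdet hc'
    (chainsIn_mono inter_subset_right hbd')
  simpa [sub_eq_zero] using hfne hq

end LocalDegree

/-! ### The orientation of a contact manifold -/

section Contact

variable {M : Type*} [TopologicalSpace M] [ChartedSpace E3 M]

/-- The sign of `α ∧ dα` at `x` in the preferred chart at `x`. -/
def volSign (α : OneForm M) (x : M) : ℝ := if 0 < volAt α x (chartAt E3 x x) then 1 else -1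

theorem volSign_mul_self (α : OneForm M) (x : M) : volSign α x * volSign α x = 1 := by
  unfold volSign
  split_ifs <;> norm_num

theorem volSign_ne_zero (α : OneForm M) (x : M) : volSign α x ≠ 0 :=
  left_ne_zero_of_mul_eq_one (volSign_mul_self α x)

/-- The preferred chart at `x`, composed with the reflection in the origin if it is orientation
reversing. -/
def orientedChart (α : OneForm M) (x : M) : OpenPartialHomeomorph M E3 :=
  (chartAt E3 x).transHomeomorph (Homeomorph.smulOfNeZero _ (volSign_ne_zero α x))

theorem mem_orientedChart_source (α : OneForm M) (x : M) : x ∈ (orientedChart α x).source :=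
  mem_chart_source E3 x

variable [IsManifold (𝓡 3) ∞ M] {α : OneForm M}

theorem volSign_mul_volAt_pos (hα : α.IsContact) (x : M) :
    0 < volSign α x * volAt α x (chartAt E3 x x) := by
  have := volAt_ne_zero hα x
  unfold volSign
  split_ifs with h
  · simpa using h
  · simpa using lt_of_le_of_ne (not_lt.mp h) this

/-- The determinant of a chart change is the ratio of the two volume coefficients; correcting both
charts so that the coefficients become positive makes it positive. -/
theorem hasFDerivAt_orientedChart (hα : α.IsContact) {x x' y : M}
    (hx : y ∈ (chartAt E3 x).source) (hx' : y ∈ (chartAt E3 x').source)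
    (hvx : 0 < volSign α x * volAt α x (chartAt E3 x y))
    (hvx' : 0 < volSign α x' * volAt α x' (chartAt E3 x' y)) :
    ∃ A : E3 →L[ℝ] E3, HasFDerivAt (orientedChart α x' ∘ (orientedChart α x).symm) A
      (orientedChart α x y) ∧ 0 < LinearMap.det (A : E3 →ₗ[ℝ] E3) := by
  set q := chartAt E3 x y with hq
  have hsymm : (chartAt E3 x).symm q = y := (chartAt E3 x).left_inv hx
  have hqU : q ∈ (chartAt E3 x).target ∩ (chartAt E3 x).symm ⁻¹' (chartAt E3 x').source :=
    ⟨(chartAt E3 x).map_source hx, by rwa [mem_preimage, hsymm]⟩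
  have hdiff : HasFDerivAt (chartChange x x') (fderiv ℝ (chartChange x x') q) q :=
    (((contDiffOn_chartChange x x').contDiffAt
      ((isOpen_chartChange_source x x').mem_nhds hqU)).differentiableAt (by simp)).hasFDerivAt
  have hvol := volAt_eq_det_mul hα.1 hqU
  have hτ : chartChange x x' q = chartAt E3 x' y := by rw [chartChange, hsymm]
  rw [hτ] at hvol
  set B := fderiv ℝ (chartChange x x') q with hB
  refine ⟨volSign α x' • (B.comp ((volSign α x)⁻¹ • ContinuousLinearMap.id ℝ E3)), ?_, ?_⟩
  · have h1 : HasFDerivAt (fun p : E3 ↦ (volSign α x)⁻¹ • p)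
        ((volSign α x)⁻¹ • ContinuousLinearMap.id ℝ E3) (volSign α x • q) :=
      ((volSign α x)⁻¹ • ContinuousLinearMap.id ℝ E3).hasFDerivAt
    have h2 : (volSign α x)⁻¹ • (volSign α x • q) = q := inv_smul_smul₀ (volSign_ne_zero α x) q
    have h3 := (HasFDerivAt.comp (volSign α x • q) (h2.symm ▸ hdiff) h1).const_smul (volSign α x')
    exact h3
  · have h1 : LinearMap.det ((volSign α x' • (B.comp ((volSign α x)⁻¹ •
        ContinuousLinearMap.id ℝ E3)) : E3 →L[ℝ] E3) : E3 →ₗ[ℝ] E3) =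
        (volSign α x') ^ 3 * (LinearMap.det (B : E3 →ₗ[ℝ] E3) * ((volSign α x)⁻¹) ^ 3) := by
      simp [LinearMap.det_smul]
      exact Or.inl (mul_comm _ _)
    rw [h1]
    -- The dimension is odd, so scaling by `-1` reverses orientation and the cube of a sign is that
    -- sign.
    have hs : ((volSign α x)⁻¹) ^ 3 = volSign α x := by
      unfold volSign; split_ifs <;> norm_num
    have hs' : (volSign α x') ^ 3 = volSign α x' := by
      unfold volSign; split_ifs <;> norm_num
    rw [hs, hs']
    -- Multiplying by a positive square turns the determinant into a product of the two positive
    -- volume coefficients.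
    have h5 : 0 < (volSign α x' * (LinearMap.det (B : E3 →ₗ[ℝ] E3) * volSign α x)) *
        (volSign α x' * volAt α x' (chartAt E3 x' y)) ^ 2 := by
      have : (volSign α x' * (LinearMap.det (B : E3 →ₗ[ℝ] E3) * volSign α x)) *
        (volSign α x' * volAt α x' (chartAt E3 x' y)) ^ 2 =
        (volSign α x * volAt α x q) * (volSign α x' * volAt α x' (chartAt E3 x' y)) *
          (volSign α x' * volSign α x') := by rw [hvol]; ring
      rw [this, volSign_mul_self, mul_one]
      exact mul_pos hvx hvx'
    exact pos_of_mul_pos_left h5 (sq_nonneg _)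

variable [T2Space M]

/-- The orientation of a contact manifold. -/
def contactOrientation (hα : α.IsContact) : LocalOrientation 3 M where
  deg x := (exists_isLocalDegree (orientedChart α x)
    (mem_orientedChart_source α x)).choose
  deg_eq_zero x := (exists_isLocalDegree (orientedChart α x)
    (mem_orientedChart_source α x)).choose_spec.eq_zero
  exists_chart x := by
    -- The degree at `y` is defined by the chart centered at `y`. The chart at `x` computes it
    -- wherever its volume coefficient keeps its sign, which is an open condition; the chart is
    -- restricted to that set.
    have hWo : IsOpen ((chartAt E3 x).source ∩
        chartAt E3 x ⁻¹' ((chartAt E3 x).target ∩ {q | 0 < volSign α x * volAt α x q})) := by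
      refine (chartAt E3 x).isOpen_inter_preimage ?_
      exact (continuousOn_const.mul (continuousOn_volAt hα.1 x)).isOpen_inter_preimage
        (chartAt E3 x).open_target isOpen_Ioi
    set φ := (orientedChart α x).restrOpen _ hWo with hφ
    have hφs : ∀ y ∈ φ.source, y ∈ (chartAt E3 x).source ∧
        0 < volSign α x * volAt α x (chartAt E3 x y) := fun y hy ↦ ⟨hy.1, hy.2.2.2⟩
    refine ⟨φ, ⟨mem_chart_source E3 x, mem_chart_source E3 x, mem_chart_target E3 x,
      volSign_mul_volAt_pos hα x⟩, fun p hp c hc hbd ↦ ?_⟩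
    set y := φ.symm p with hy
    have hys : y ∈ φ.source := φ.map_target hp
    have hyp : φ y = p := φ.right_inv hp
    obtain ⟨A, hA, hdet⟩ := hasFDerivAt_orientedChart hα (hφs y hys).1 (mem_chart_source E3 y)
      (hφs y hys).2 (volSign_mul_volAt_pos hα y)
    have := IsLocalDegree.of_hasFDerivAt 0 hys (mem_orientedChart_source α y)
      (exists_isLocalDegree (orientedChart α y) (mem_orientedChart_source α y)).choose_spec
      (φ := φ) hA hdet
    rw [← hyp]
    exact this.eq_degAt c hc (by rwa [hyp])

end Contact

end SingularDuality

end

/-! ### Comparison with the categorical singular chain complex -/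

noncomputable section

namespace SingularDuality

/-! ### Comparison with the singular chain complex -/

section Comparison

universe u

variable {X : Type u} [TopologicalSpace X]

/-- A singular simplex as a continuous map. -/
def Sing.toContinuousMap {n : ℕ} (σ : Sing X n) : C(stdSimplex ℝ (Fin (n + 1)), X) :=
  ⟨σ.toFun, σ.continuous_toFun⟩

theorem singularChains_hom_ext {n : ℕ} {V : Type u} [AddCommGroup V] [Module ℚ V]
    {f g : (singularChains ℚ X).X n →ₗ[ℚ] V}
    (h : ∀ σ : Sing X n, f (simplexChain ℚ σ.toContinuousMap) =
      g (simplexChain ℚ σ.toContinuousMap)) : f = g := by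
  suffices ModuleCat.ofHom f = ModuleCat.ofHom g from congrArg ModuleCat.Hom.hom this
  refine SSet.chainComplex_hom_ext (X := TopCat.toSSet.obj (TopCat.of X))
    (R := ModuleCat.of ℚ (ULift.{u} ℚ)) fun x ↦ ModuleCat.hom_ext (LinearMap.ext fun q ↦ ?_)
  obtain ⟨s, rfl⟩ := ((TopCat.of X).toSSetObjEquiv
    (Opposite.op (SimplexCategory.mk n))).symm.surjective x
  have hq : q = q.down • (ULift.up 1 : ULift.{u} ℚ) := by
    apply ULift.down_injective
    simp
  rw [hq, map_smul, map_smul]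
  exact congrArg _ (h ⟨s, s.continuous⟩)

theorem exists_ofSingularChains (n : ℕ) : ∃ f : (singularChains ℚ X).X n →ₗ[ℚ] Chains X,
    ∀ σ : Sing X n, f (simplexChain ℚ σ.toContinuousMap) = .single ⟨n, σ⟩ 1 := by
  let S := TopCat.toSSet.obj (TopCat.of X)
  let e := (TopCat.of X).toSSetObjEquiv (Opposite.op (SimplexCategory.mk n))
  let c : Limits.Cofan fun _ : S.obj (Opposite.op (SimplexCategory.mk n)) ↦
      ModuleCat.of ℚ (ULift.{u} ℚ) :=
    Limits.Cofan.mk (ModuleCat.of ℚ (Chains X)) fun x ↦ ModuleCat.ofHom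
      (((LinearMap.toSpanSingleton ℚ (Chains X) (.single ⟨n, ⟨e x, (e x).continuous⟩⟩ 1))) ∘ₗ
        (ULift.moduleEquiv : ULift.{u} ℚ ≃ₗ[ℚ] ℚ).toLinearMap)
  have hc := S.isColimitChainComplexXCofan (ModuleCat.of ℚ (ULift.{u} ℚ)) n
  refine ⟨(hc.desc c).hom, fun σ ↦ ?_⟩
  have := hc.fac c ⟨e.symm σ.toContinuousMap⟩
  have h2 := DFunLike.congr_fun (congrArg ModuleCat.Hom.hom this) (ULift.up 1)
  refine h2.trans ?_
  change (1 : ℚ) • Finsupp.single (⟨n, ⟨e (e.symm σ.toContinuousMap), _⟩⟩ : Σ n, Sing X n) 1 = _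
  rw [one_smul]
  congr 2

/-- The chain in `Chains X` of a singular chain. -/
def ofSingularChains (X : Type u) [TopologicalSpace X] (n : ℕ) :
    (singularChains ℚ X).X n →ₗ[ℚ] Chains X :=
  (exists_ofSingularChains n).choose

theorem ofSingularChains_simplexChain {n : ℕ} (σ : Sing X n) :
    ofSingularChains X n (simplexChain ℚ σ.toContinuousMap) = .single ⟨n, σ⟩ 1 :=
  (exists_ofSingularChains n).choose_spec σ

theorem d_simplexChain {n : ℕ} (σ : Sing X (n + 1)) :
    ((singularChains ℚ X).d (n + 1) n).hom (simplexChain ℚ σ.toContinuousMap) =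
      ∑ i : Fin (n + 2), (-1 : ℚ) ^ (i : ℕ) •
        simplexChain ℚ (Sing.toContinuousMap (FaceMaps.face n i σ)) := by
  have h := SSet.ιChainComplex_d (TopCat.toSSet.obj (TopCat.of X)) (ModuleCat.of ℚ (ULift.{u} ℚ))
    (((TopCat.of X).toSSetObjEquiv (Opposite.op (SimplexCategory.mk (n + 1)))).symm
      σ.toContinuousMap)
  have h2 := DFunLike.congr_fun (congrArg ModuleCat.Hom.hom h) (ULift.up 1)
  refine h2.trans ?_
  have h3 : ∀ i : Fin (n + 2), (TopCat.toSSet.obj (TopCat.of X)).δ i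
      (((TopCat.of X).toSSetObjEquiv (Opposite.op (SimplexCategory.mk (n + 1)))).symm
        σ.toContinuousMap) = ((TopCat.of X).toSSetObjEquiv (Opposite.op (SimplexCategory.mk n))).symm
          (Sing.toContinuousMap (FaceMaps.face n i σ)) := fun i ↦
    TopCat.toSSetObjEquiv_symm_naturality (X := TopCat.of X) (SimplexCategory.δ i)
      σ.toContinuousMap
  simp only [h3]
  rw [ModuleCat.hom_sum, LinearMap.sum_apply]
  refine Finset.sum_congr rfl fun i _ ↦ ?_
  rw [ModuleCat.hom_zsmul, LinearMap.smul_apply, ← Int.cast_smul_eq_zsmul ℚ]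
  push_cast
  rfl

theorem ofSingularChains_mem_homog {n : ℕ} (z : (singularChains ℚ X).X n) :
    ofSingularChains X n z ∈ homog _ n := by
  have : proj _ n ∘ₗ ofSingularChains X n = ofSingularChains X n :=
    singularChains_hom_ext fun σ ↦ by
      rw [LinearMap.comp_apply, ofSingularChains_simplexChain, proj_single, if_pos rfl]
  rw [← this]
  exact proj_mem_homog _ _

theorem ofSingularChains_d {n : ℕ} (z : (singularChains ℚ X).X (n + 1)) :
    ofSingularChains X n (((singularChains ℚ X).d (n + 1) n).hom z) =
      bd _ (ofSingularChains X (n + 1) z) := by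
  suffices ofSingularChains X n ∘ₗ ((singularChains ℚ X).d (n + 1) n).hom =
      bd _ ∘ₗ ofSingularChains X (n + 1) from LinearMap.congr_fun this z
  refine singularChains_hom_ext fun σ ↦ ?_
  rw [LinearMap.comp_apply, LinearMap.comp_apply, d_simplexChain, ofSingularChains_simplexChain,
    bd_single_succ, map_sum]
  exact Finset.sum_congr rfl fun i _ ↦ by rw [map_smul, ofSingularChains_simplexChain]

/-- The singular `n`-chain given by the part of degree `n` of a chain. -/
def toSingularChains (X : Type u) [TopologicalSpace X] (n : ℕ) :
    Chains X →ₗ[ℚ] (singularChains ℚ X).X n :=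
  Finsupp.linearCombination ℚ fun s : Σ n, Sing X n ↦
    if h : s.1 = n then simplexChain ℚ (Sing.toContinuousMap (h ▸ s.2)) else 0

theorem toSingularChains_single {n : ℕ} (σ : Sing X n) :
    toSingularChains X n (.single ⟨n, σ⟩ 1) = simplexChain ℚ σ.toContinuousMap := by
  simp [toSingularChains]

theorem toSingularChains_ofSingularChains {n : ℕ} (z : (singularChains ℚ X).X n) :
    toSingularChains X n (ofSingularChains X n z) = z := by
  suffices toSingularChains X n ∘ₗ ofSingularChains X n = LinearMap.id from
    LinearMap.congr_fun this z
  exact singularChains_hom_ext fun σ ↦ by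
    rw [LinearMap.comp_apply, ofSingularChains_simplexChain, toSingularChains_single,
      LinearMap.id_apply]

theorem ofSingularChains_injective {n : ℕ} : Function.Injective (ofSingularChains X n) :=
  Function.LeftInverse.injective toSingularChains_ofSingularChains

theorem ofSingularChains_toSingularChains {n : ℕ} {c : Chains X} (hc : c ∈ homog _ n) :
    ofSingularChains X n (toSingularChains X n c) = c := by
  refine eq_of_mem_supported (f := ofSingularChains X n ∘ₗ toSingularChains X n)
    (g := LinearMap.id) ?_ hc
  rintro ⟨_, σ⟩ rfl
  rw [LinearMap.comp_apply, toSingularChains_single, ofSingularChains_simplexChain,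
    LinearMap.id_apply]

theorem d_eq_zero_iff {k : ℕ} (z : (singularChains ℚ X).X k) :
    ((singularChains ℚ X).d k (k - 1)).hom z = 0 ↔ bd _ (ofSingularChains X k z) = 0 := by
  match k, z with
  | 0, z =>
    refine iff_of_true ?_ ?_
    -- In degree zero `0 - 1` truncates to `0`, and the differential from degree `0` to itself is
    -- zero by the shape of the complex.
    · rw [(singularChains ℚ X).shape 0 (0 - 1) (by simp)]
      rfl
    · rw [← proj_eq_self (ofSingularChains_mem_homog z), bd_proj_zero]
  | k + 1, z =>
    rw [← ofSingularChains_d, ← map_zero (ofSingularChains X k)]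
    exact ofSingularChains_injective.eq_iff.symm

theorem eq_d_iff {k : ℕ} (z : (singularChains ℚ X).X k) :
    z ∈ LinearMap.range ((singularChains ℚ X).d (k + 1) k).hom ↔
      ∃ e, bd _ e = ofSingularChains X k z := by
  constructor
  · rintro ⟨e, rfl⟩
    exact ⟨_, (ofSingularChains_d e).symm⟩
  · rintro ⟨e, he⟩
    -- The filling may have parts in several degrees; its component of degree `k + 1` already
    -- suffices.
    refine ⟨toSingularChains X (k + 1) (proj _ (k + 1) e), ofSingularChains_injective ?_⟩
    rw [ofSingularChains_d, ofSingularChains_toSingularChains (proj_mem_homog _ _), bd_proj_succ,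
      he, proj_eq_self (ofSingularChains_mem_homog z)]

/-- Singular homology as a quotient of the cycles. -/
def singularHomologyEquiv (X : Type u) [TopologicalSpace X] (k : ℕ) :
    singularHomology ℚ X k ≃ₗ[ℚ]
      LinearMap.ker ((singularChains ℚ X).d k (k - 1)).hom ⧸
        (LinearMap.range ((singularChains ℚ X).d (k + 1) k).hom).submoduleOf
          (LinearMap.ker ((singularChains ℚ X).d k (k - 1)).hom) :=
  ((singularChains ℚ X).homologyIsoSc' (k + 1) k (k - 1) (by simp)
      (by cases k <;> simp) ≪≫
    ((singularChains ℚ X).sc' (k + 1) k (k - 1)).moduleCatHomologyIso).toLinearEquiv.trans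
  (Submodule.quotEquivOfEq _ _ (by
    ext z
    constructor
    · rintro ⟨e, rfl⟩
      exact ⟨e, rfl⟩
    · rintro ⟨e, he⟩
      exact ⟨e, Subtype.ext he⟩))

theorem subsingleton_singularHomology {k : ℕ}
    (h : ∀ c ∈ homog (Sing X) k, bd _ c = 0 → ∃ e, bd _ e = c) :
    Subsingleton (singularHomology ℚ X k) := by
  refine (singularHomologyEquiv X k).toEquiv.subsingleton_congr.mpr ?_
  refine Submodule.Quotient.subsingleton_iff.mpr (eq_top_iff.mpr fun z _ ↦ ?_)
  exact (eq_d_iff _).mpr (h _ (ofSingularChains_mem_homog _) ((d_eq_zero_iff _).mp z.2))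

theorem nonempty_quotient_submoduleOf_equiv {V : Type*} [AddCommGroup V] [Module ℚ V]
    {K R : Submodule ℚ V} {z₀ : V} (hK : z₀ ∈ K) (hR : z₀ ∉ R)
    (h : ∀ z ∈ K, ∃ q : ℚ, z - q • z₀ ∈ R) : Nonempty ((K ⧸ R.submoduleOf K) ≃ₗ[ℚ] ℚ) := by
  refine ⟨(LinearEquiv.ofBijective (LinearMap.toSpanSingleton ℚ (K ⧸ R.submoduleOf K)
    (Submodule.Quotient.mk ⟨z₀, hK⟩)) ⟨?_, ?_⟩).symm⟩
  · refine (injective_iff_map_eq_zero _).mpr fun q hq ↦ ?_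
    by_contra hq0
    rw [LinearMap.toSpanSingleton_apply] at hq
    exact hR ((Submodule.Quotient.mk_eq_zero (R.submoduleOf K)).mp
      ((smul_eq_zero.mp hq).resolve_left hq0))
  · intro y
    obtain ⟨z, rfl⟩ := Submodule.Quotient.mk_surjective _ y
    obtain ⟨q, hq⟩ := h z.1 z.2
    refine ⟨q, ?_⟩
    rw [LinearMap.toSpanSingleton_apply, ← Submodule.Quotient.mk_smul, eq_comm,
      Submodule.Quotient.eq]
    exact hq

theorem nonempty_singularHomology_equiv {k : ℕ} {c₀ : Chains X} (hc₀ : c₀ ∈ homog _ k)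
    (hbd : bd _ c₀ = 0) (hne : ∀ e, c₀ ≠ bd _ e)
    (h : ∀ c ∈ homog (Sing X) k, bd _ c = 0 → ∃ q : ℚ, ∃ e, c - q • c₀ = bd _ e) :
    Nonempty (singularHomology ℚ X k ≃ₗ[ℚ] ℚ) := by
  have h₀ := ofSingularChains_toSingularChains hc₀
  obtain ⟨φ⟩ := nonempty_quotient_submoduleOf_equiv
    (K := LinearMap.ker ((singularChains ℚ X).d k (k - 1)).hom)
    (R := LinearMap.range ((singularChains ℚ X).d (k + 1) k).hom)
    (z₀ := toSingularChains X k c₀) ((d_eq_zero_iff _).mpr (by rw [h₀, hbd]))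
    (fun hz ↦ by
      obtain ⟨e, he⟩ := (eq_d_iff _).mp hz
      exact hne e (h₀.symm.trans he.symm))
    (fun z hz ↦ by
      obtain ⟨q, e, he⟩ := h _ (ofSingularChains_mem_homog z) ((d_eq_zero_iff z).mp hz)
      exact ⟨q, (eq_d_iff _).mpr ⟨e, by rw [map_sub, map_smul, h₀, he]⟩⟩)
  exact ⟨(singularHomologyEquiv X k).trans φ⟩

/-- Universal coefficients over a field: if `z` did not bound, some functional would vanish on
boundaries but not on `z`. It is a cocycle, hence a coboundary `g ∘ d`, and so vanishes on the cycle
`z` after all. -/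
theorem exists_bd_eq_of_subsingleton_singularCohomology [Subsingleton (singularCohomology ℚ X 1)]
    {ζ : Chains X} (hζ : ζ ∈ homog _ 1) (hbd : bd _ ζ = 0) : ∃ η, bd _ η = ζ := by
  have hz := ofSingularChains_toSingularChains hζ
  set z := toSingularChains X 1 ζ with hz'
  rw [← hz]
  refine (eq_d_iff z).mp ?_
  by_contra hne
  obtain ⟨f, hf, hle⟩ := Submodule.exists_le_ker_of_notMem hne
  let f' : singularCochains ℚ X 1 := f
  have hcoc : f' ∈ singularCocycles ℚ X 1 :=
    LinearMap.mem_ker.mpr (LinearMap.ext fun e ↦ hle ⟨e, rfl⟩)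
  have htop := Submodule.Quotient.subsingleton_iff.mp
    (inferInstance : Subsingleton (singularCohomology ℚ X 1))
  have hmem : (⟨f', hcoc⟩ : singularCocycles ℚ X 1) ∈
      (LinearMap.range (coboundary ℚ X (1 - 1) 1)).submoduleOf (singularCocycles ℚ X 1) := by
    rw [htop]
    exact Submodule.mem_top
  obtain ⟨g, hg⟩ := hmem
  refine hf ?_
  have h1 : f z = (show (singularChains ℚ X).X 0 →ₗ[ℚ] ℚ from g)
      (((singularChains ℚ X).d 1 0).hom z) := (LinearMap.congr_fun hg z).symm
  rw [h1, (d_eq_zero_iff z).mpr (by rw [hz, hbd]), map_zero]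

/-- A path from `x` to a point is a 1-simplex whose boundary is the difference of the two, so every
0-chain is homologous to its augmentation times `x`. -/
theorem exists_sub_smul_ptChain_eq_bd [PathConnectedSpace X] (x : X) {c : Chains X}
    (hc : c ∈ homog _ 0) : ∃ q : ℚ, ∃ e, c - q • ptChain x = bd _ e := by
  refine ⟨aug _ c, ?_⟩
  have := map_mem_of_mem_supported
    (f := LinearMap.id - (aug (Sing X)).smulRight (ptChain x)) (N := LinearMap.range (bd (Sing X)))
    (by
      rintro ⟨_, σ⟩ rfl
      rw [single_eq_ptChain]
      refine ⟨.single ⟨1, pathSing (PathConnectedSpace.somePath x (σ.atVertex 0))⟩ 1, ?_⟩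
      rw [bd_pathSing]
      simp [aug_ptChain]) hc
  obtain ⟨e, he⟩ := this
  exact ⟨e, he.symm⟩

theorem nonempty_singularHomology_zero_equiv [PathConnectedSpace X] :
    Nonempty (singularHomology ℚ X 0 ≃ₗ[ℚ] ℚ) := by
  obtain ⟨x⟩ := (inferInstance : Nonempty X)
  refine nonempty_singularHomology_equiv (ptChain_mem_homog x) (bd_ptChain x) (fun e he ↦ ?_)
    fun c hc _ ↦ exists_sub_smul_ptChain_eq_bd x hc
  have := congrArg (aug _) he
  rw [aug_ptChain, aug_bd] at this
  exact one_ne_zero this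

end Comparison

end SingularDuality

end

/-! ### Conclusion -/

namespace SingularDuality

/-- A closed connected contact `3`-manifold with `H¹(M; ℚ) = 0` is a rational homology sphere. -/
theorem hasRationalHomologyOfSphere_of_isContact {M : Type*} [TopologicalSpace M]
    [ChartedSpace E3 M] [IsManifold (𝓡 3) ∞ M] [T2Space M] [CompactSpace M] [ConnectedSpace M]
    {α : OneForm M} (hα : α.IsContact) (hH : Subsingleton (singularCohomology ℚ M 1)) :
    HasRationalHomologyOfSphere 3 M := by
  have : LocallyPathConnectedSpace M := ChartedSpace.locallyPathConnectedSpace (EuclideanSpace ℝ (Fin 3)) M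
  have : PathConnectedSpace M := pathConnectedSpace_iff_connectedSpace.mpr inferInstance
  have h1 : ∀ ζ ∈ homog (Sing M) 1, bd _ ζ = 0 → ∃ η, bd _ η = ζ := fun ζ hζ hbd ↦
    exists_bd_eq_of_subsingleton_singularCohomology hζ hbd
  have o := contactOrientation hα
  intro k
  constructor
  · rintro (rfl | rfl)
    · exact nonempty_singularHomology_zero_equiv
    · obtain ⟨μ, hμ, hbd, hdeg⟩ := o.exists_fundamentalCycle (by norm_num)
      exact nonempty_singularHomology_equiv hμ hbd (o.ne_bd_of_deg_eq_one hdeg)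
        fun z hz hz0 ↦ o.exists_sub_smul_eq_bd hμ hbd hdeg hz hz0
  · intro hk
    refine subsingleton_singularHomology fun c hc hbd ↦ ?_
    rcases lt_or_ge 3 k with h3 | h3
    · exact exists_eq_bd_of_lt h3 hc hbd
    -- Degree one is the cohomological hypothesis, and degree two is duality with `m = 2`.
    · interval_cases k
      · simp at hk
      · exact h1 c hc hbd
      · exact o.exists_bd_eq rfl h1 hc hbd
      · simp at hk

end SingularDuality

theorem mainTheorem12 {M : Type*} [TopologicalSpace M] [ChartedSpace (EuclideanSpace ℝ (Fin 3)) M]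
    [IsManifold (𝓡 3) ∞ M] [T2Space M] [CompactSpace M] [ConnectedSpace M]
    (ξ : (x : M) → Submodule ℝ (TangentSpace (𝓡 3) x))
    (hξ : IsStronglyDynamicallyConvexContactStructure ξ) :
    HasRationalHomologyOfSphere 3 M := by
  obtain ⟨α, -, hα, -, hH, -⟩ := hξ
  exact SingularDuality.hasRationalHomologyOfSphere_of_isContact hα hH
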